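/- Let $t=-2+x_1^2+x_2^2-x_1x_2x_3+x_3^2\in\mathbb C[x_1,x_2,x_3]$; this is the trace of the boundary of the one-holed torus in the trace coordinates $x_1=\operatorname{tr}\rho(F_1)$, $x_2=\operatorname{tr}\rho(F_2)$, $x_3=\operatorname{tr}\rho(F_1F_2)$ on the $\mathrm{SL}(2,\mathbb C)$-representation variety $\mathbb C^3$ of the free group $\langle F_1,F_2\rangle$. Let $\mathcal O_Y=\mathbb C[y]_{y^2-4}$ be the coordinate ring of $Y=\mathbb C\setminus\{\pm2\}$, let $\mathcal O_X=\mathbb C[x_1,x_2,x_3]_{t^2-4}$, and let $f_1:X\to Y$ be given by $y\mapsto t$. Let $\mathcal H^2$ be the second cohomology of the relative algebraic de Rham complex $\Omega^\bullet_{X/Y}$, an $\mathcal O_Y$-module. 1. $\mathcal H^2$ is a free $\mathcal O_Y$-module with basis $B=(b_1,\dots,b_5)$ given by the classes of $g\,x_1\,dx_2\wedge dx_3$ for $g=1,x_1,x_2,x_3,x_1^2$. 2. There is a unique $\mathbb C$-linear map $\nabla:\mathcal H^2\to\Omega^1_Y\otimes_{\mathcal O_Y}\mathcal H^2$ (the Gauß–Manin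 connection) such that $\nabla[\omega]=dy\otimes[w]$ whenever $\omega,w\in\Omega^2_X$ satisfy $d\omega=w\wedge dt$. In the basis $B$ it is $\nabla=d+E\,dy$, that is $\nabla\big(\sum_i c_ib_i\big)=\sum_i dc_i\otimes b_i+\sum_{i,j}c_iE_{ij}\,dy\otimes b_j$ for $c_i\in\mathcal O_Y$, with $$E(y)=\begin{pmatrix}\frac{3}{2(y+2)}-\frac1{2(y-2)}&0&0&0&-\frac1{6(y+2)}+\frac1{6(y-2)}\\0&\frac3{2(y-2)}&0&0&0\\0&0&\frac3{2(y-2)}&0&0\\0&0&0&\frac3{2(y-2)}&0\\-\frac6{y-2}&0&0&0&\frac2{y-2}\end{pmatrix},$$ which has simple poles at $y=2$ and $y=-2$: it is $\frac{R_2}{y-2}+\frac{R_{-2}}{y+2}$ with non-zero constant matrices $R_{\pm2}$. 3. $\mathcal H^2$ is the direct sum of the $\nabla$-stable submodules spanned by $b_2$, by $b_3$, by $b_4$ (rank 1) and by $b_1,b_5$ (rank 2). In the basis $(b_1,b_5)$ the rank-2 system is $$\mathcal D=d+\Big(\frac{A_2}{y-2}+\frac{A_{-2}}{y+2}\Big)dy,\qquad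 A_2=\begin{pmatrix}-\frac12&\frac16\\-6&2\end{pmatrix},\quad A_{-2}=\begin{pmatrix}\frac32&-\frac16\\0&0\end{pmatrix}$$ (acting on row vectors of coordinates, as in 2). The eigenvalues of $A_2$ and of $A_{-2}$ are $0,\frac32$, and $A_\infty=-(A_2+A_{-2})=\begin{pmatrix}-1&0\\6&-2\end{pmatrix}$ has the eigenvalues $-1,-2$. 4. Take the base point $0\in Y$, the loops $\gamma_{-2}$, $\gamma_2$ at $0$ that run once counterclockwise around the circles of radius $2$ with centers $-2$ and $2$, and the loop $\gamma_\infty$ that runs from $0$ straight to $4i$, once clockwise around the circle $|y|=4$, and straight back to $0$. Analytic continuation along every loop in $Y$ based at $0$ sends a basis $s=(s_1,s_2)^T$ of flat sections of $\mathcal D$ near $0$ to $Ns$ for a unique $N\in\mathrm{GL}(2,\mathbb C)$, and for a suitable basis $s$ the matrices of $\gamma_{-2},\gamma_2,\gamma_\infty$ are simultaneously $$\mathcal N_{-2}=\begin{pmatrix}1&0\\0&-1\end{pmatrix},\quad\mathcal N_2=\begin{pmatrix}1&-\frac{4\pi i}3\\0&-1\end{pmatrix},\quad\mathcal N_\infty=\begin{pmatrix}1&\frac{4\pi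 i}3\\0&1\end{pmatrix},$$ and the monodromy group, that is the set of the matrices of all loops in $Y$ based at $0$, is the group generated by these three matrices. -/

import Mathlib

open scoped KaehlerDifferential TensorProduct Topology
noncomputable section

namespace DeRham

variable (R S : Type*) [CommRing R] [CommRing S] [Algebra R S]

/-- The algebra of all differential forms of `S` over `R`. -/
abbrev Forms : Type _ := ExteriorAlgebra S Ω[S⁄R]

/-- The differential `da` of a function, as a form of degree one. -/
def dFun (a : S) : Forms R S := ExteriorAlgebra.ι S (KaehlerDifferential.D R S a)

/-- The sign involution: `(-1)^n` on forms of degree `n`. -/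
def sgn : Forms R S →ₐ[S] Forms R S :=
  CliffordAlgebra.involute (Q := (0 : QuadraticForm S Ω[S⁄R]))

variable {R S}

theorem sgn_ι (m : Ω[S⁄R]) :
    sgn R S (ExteriorAlgebra.ι S m) = -ExteriorAlgebra.ι S m :=
  CliffordAlgebra.involute_ι m

theorem ι_mul_eq (m : Ω[S⁄R]) (x : Forms R S) :
    ExteriorAlgebra.ι S m * x = sgn R S x * ExteriorAlgebra.ι S m := by
  induction x using ExteriorAlgebra.induction with
  | algebraMap r => rw [AlgHom.commutes, Algebra.commutes]
  | ι n =>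
    rw [sgn_ι, neg_mul]
    exact eq_neg_of_add_eq_zero_left (ExteriorAlgebra.ι_add_mul_swap m n)
  | mul a b ha hb => rw [← mul_assoc, ha, mul_assoc, hb, map_mul, mul_assoc]
  | add a b ha hb => rw [mul_add, ha, hb, map_add, add_mul]

theorem ι_mul_ι_comm (m n : Ω[S⁄R]) (x : Forms R S) :
    (ExteriorAlgebra.ι S m * ExteriorAlgebra.ι S n) * x
      = x * (ExteriorAlgebra.ι S m * ExteriorAlgebra.ι S n) := by
  have h : sgn R S (sgn R S x) = x := CliffordAlgebra.involute_involute x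
  rw [mul_assoc, ι_mul_eq n x, ← mul_assoc, ι_mul_eq m, h, mul_assoc]

variable (R S)

/-- The matrices `!![sgn x, y; 0, x]`. A graded derivation `d` of the algebra of forms is the same
as a ring homomorphism `x ↦ !![sgn x, d x; 0, x]`. -/
def TwRing : Subring (Matrix (Fin 2) (Fin 2) (Forms R S)) where
  carrier := {M | M 1 0 = 0 ∧ M 0 0 = sgn R S (M 1 1)}
  mul_mem' := by
    rintro a b ⟨ha, ha'⟩ ⟨hb, hb'⟩
    simp [Matrix.mul_apply, Fin.sum_univ_two, ha, hb, ha', hb']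
  one_mem' := by simp
  add_mem' := by
    rintro a b ⟨ha, ha'⟩ ⟨hb, hb'⟩
    simp [ha, hb, ha', hb']
  zero_mem' := by simp
  neg_mem' := by
    rintro a ⟨ha, ha'⟩
    simp [ha, ha']

/-- `TwRing R S` as a type. -/
def Tw : Type _ := TwRing R S

instance Tw.instRing : Ring (Tw R S) := inferInstanceAs (Ring (TwRing R S))

variable {R S}

/-- The matrix `!![sgn x, y; 0, x]`. -/
def Tw.mk (x y : Forms R S) : Tw R S := ⟨!![sgn R S x, y; 0, x], by simp [TwRing]⟩

def Tw.fst (M : Tw R S) : Forms R S := M.1 1 1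

def Tw.snd (M : Tw R S) : Forms R S := M.1 0 1

theorem Tw.ext' {M N : Tw R S} (h : M.fst = N.fst) (h' : M.snd = N.snd) : M = N := by
  obtain ⟨M, hM, hM'⟩ := M
  obtain ⟨N, hN, hN'⟩ := N
  simp only [Tw.fst, Tw.snd] at h h'
  apply Subtype.ext
  ext i j
  fin_cases i <;> fin_cases j <;> simp [*]

@[simp] theorem Tw.fst_mk (x y : Forms R S) : (Tw.mk x y).fst = x := by simp [Tw.fst, Tw.mk]
@[simp] theorem Tw.snd_mk (x y : Forms R S) : (Tw.mk x y).snd = y := by simp [Tw.snd, Tw.mk]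
@[simp] theorem Tw.fst_add (M N : Tw R S) : (M + N).fst = M.fst + N.fst := rfl
@[simp] theorem Tw.snd_add (M N : Tw R S) : (M + N).snd = M.snd + N.snd := rfl
@[simp] theorem Tw.fst_zero : (0 : Tw R S).fst = 0 := rfl
@[simp] theorem Tw.snd_zero : (0 : Tw R S).snd = 0 := rfl
@[simp] theorem Tw.fst_one : (1 : Tw R S).fst = 1 := rfl
@[simp] theorem Tw.snd_one : (1 : Tw R S).snd = 0 := rfl
@[simp] theorem Tw.fst_mul (M N : Tw R S) : (M * N).fst = M.fst * N.fst := by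
  have h := M.2.1
  change (M.1 * N.1) 1 1 = M.1 1 1 * N.1 1 1
  simp [Matrix.mul_apply, Fin.sum_univ_two, h]
@[simp] theorem Tw.snd_mul (M N : Tw R S) :
    (M * N).snd = sgn R S M.fst * N.snd + M.snd * N.fst := by
  have h := M.2.2
  change (M.1 * N.1) 0 1 = sgn R S (M.1 1 1) * N.1 0 1 + M.1 0 1 * N.1 1 1
  simp [Matrix.mul_apply, Fin.sum_univ_two, h]

variable (R S)

theorem dFun_add (a b : S) : dFun R S (a + b) = dFun R S a + dFun R S b := by
  simp [dFun]

theorem dFun_mul (a b : S) : dFun R S (a * b) = a • dFun R S b + b • dFun R S a := by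
  simp [dFun]

/-- The ring homomorphism `a ↦ !![a, da; 0, a]`. -/
def Tw.base : S →+* Tw R S where
  toFun a := Tw.mk (algebraMap S _ a) (dFun R S a)
  map_one' := by apply Tw.ext' <;> simp [dFun]
  map_zero' := by apply Tw.ext' <;> simp [dFun]
  map_add' a b := by apply Tw.ext' <;> simp [dFun_add]
  map_mul' a b := by
    apply Tw.ext'
    · simp
    · simp only [Tw.snd_mk, Tw.snd_mul, Tw.fst_mk, AlgHom.commutes, dFun_mul]
      rw [← Algebra.commutes b, Algebra.smul_def, Algebra.smul_def]

theorem Tw.base_comm (a : S) (M : Tw R S) : Tw.base R S a * M = M * Tw.base R S a := by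
  apply Tw.ext'
  · simp [Tw.base, Algebra.commutes]
  · simp only [Tw.base, RingHom.coe_mk, MonoidHom.coe_mk, OneHom.coe_mk, Tw.snd_mk, Tw.snd_mul,
      Tw.fst_mk, AlgHom.commutes]
    rw [dFun, ι_mul_eq, Algebra.commutes, add_comm]

instance Tw.instAlg : Algebra S (Tw R S) := (Tw.base R S).toAlgebra' (Tw.base_comm R S)

theorem Tw.smul_eq (a : S) (M : Tw R S) :
    a • M = Tw.mk (algebraMap S _ a) (dFun R S a) * M := rfl

@[simp] theorem Tw.fst_smul (a : S) (M : Tw R S) : (a • M).fst = a • M.fst := by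
  rw [Tw.smul_eq, Tw.fst_mul, Tw.fst_mk, Algebra.smul_def]

@[simp] theorem Tw.snd_smul (a : S) (M : Tw R S) :
    (a • M).snd = a • M.snd + dFun R S a * M.fst := by
  rw [Tw.smul_eq, Tw.snd_mul, Tw.snd_mk, Tw.fst_mk, AlgHom.commutes, Algebra.smul_def]

instance Tw.instAlgBase : Algebra R (Tw R S) := Algebra.compHom (Tw R S) (algebraMap R S)

instance Tw.instTower : IsScalarTower R S (Tw R S) :=
  IsScalarTower.of_algebraMap_eq fun _ => rfl

/-- The derivation `a ↦ !![-da, 0; 0, da]`. -/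
def Tw.der : Derivation R S (Tw R S) where
  toFun a := Tw.mk (dFun R S a) 0
  map_add' a b := by apply Tw.ext' <;> simp [dFun_add]
  map_smul' r a := by
    rw [RingHom.id_apply, ← algebraMap_smul S r (Tw.mk _ _)]
    apply Tw.ext'
    · rw [Tw.fst_smul, Tw.fst_mk, Tw.fst_mk, algebraMap_smul, dFun, Derivation.map_smul,
        LinearMap.map_smul_of_tower]
      rfl
    · rw [Tw.snd_smul, Tw.snd_mk, Tw.snd_mk, dFun, Derivation.map_algebraMap]
      simp
  map_one_eq_zero' := by apply Tw.ext' <;> simp [dFun]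
  leibniz' a b := by
    apply Tw.ext'
    · simp [dFun_mul]
    · simp only [LinearMap.coe_mk, AddHom.coe_mk, Tw.snd_mk, Tw.snd_add, Tw.snd_smul, Tw.fst_mk,
        smul_zero, zero_add]
      exact (ExteriorAlgebra.ι_add_mul_swap _ _).symm

/-- The map `ω ↦ !![-ω, dω; 0, ω]` on forms of degree one. -/
def Tw.one : Ω[S⁄R] →ₗ[S] Tw R S := (Tw.der R S).liftKaehlerDifferential

theorem Tw.one_spec (m : Ω[S⁄R]) : (Tw.one R S m).fst = ExteriorAlgebra.ι S m ∧
    ∀ x, (Tw.one R S m).snd * x = x * (Tw.one R S m).snd := by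
  have hm : m ∈ Submodule.span S (Set.range (KaehlerDifferential.D R S)) := by
    rw [KaehlerDifferential.span_range_derivation]; trivial
  induction hm using Submodule.span_induction with
  | mem m hm =>
    obtain ⟨a, rfl⟩ := hm
    have : Tw.one R S (KaehlerDifferential.D R S a) = Tw.mk (dFun R S a) 0 :=
      Derivation.liftKaehlerDifferential_comp_D _ _
    simp [this, dFun]
  | zero => simp
  | add m n _ _ hm hn =>
    refine ⟨by simp [hm.1, hn.1], fun x => ?_⟩
    simp [mul_add, add_mul, hm.2 x, hn.2 x]
  | smul a m _ hm =>
    refine ⟨by simp [hm.1], fun x => ?_⟩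
    have := ι_mul_ι_comm (KaehlerDifferential.D R S a) m x
    simp only [map_smul, Tw.snd_smul, add_mul, mul_add, hm.1, dFun, this]
    simp [hm.2 x]

/-- The homomorphism `x ↦ !![sgn x, d x; 0, x]` on the algebra of forms. -/
def Tw.hom : Forms R S →ₐ[S] Tw R S :=
  ExteriorAlgebra.lift S ⟨Tw.one R S, fun m => by
    obtain ⟨h1, h2⟩ := Tw.one_spec R S m
    apply Tw.ext'
    · simp [h1]
    · simp [h1, sgn_ι, h2]⟩

theorem Tw.hom_fst (x : Forms R S) : (Tw.hom R S x).fst = x := by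
  induction x using ExteriorAlgebra.induction with
  | algebraMap r =>
    rw [AlgHom.commutes]
    exact Tw.fst_mk _ _
  | ι n =>
    rw [Tw.hom, ExteriorAlgebra.lift_ι_apply]
    exact (Tw.one_spec R S n).1
  | mul a b ha hb => rw [map_mul, Tw.fst_mul, ha, hb]
  | add a b ha hb => rw [map_add, Tw.fst_add, ha, hb]

/-- The exterior derivative. -/
def d : Forms R S →ₗ[R] Forms R S where
  toFun x := (Tw.hom R S x).snd
  map_add' x y := by simp
  map_smul' r x := by
    rw [← algebraMap_smul S r x, map_smul, Tw.snd_smul, RingHom.id_apply,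
      ← algebraMap_smul S r (Tw.snd _)]
    simp [dFun]

theorem d_algebraMap (a : S) : d R S (algebraMap S _ a) = dFun R S a := by
  change (Tw.hom R S _).snd = _
  rw [AlgHom.commutes]
  exact Tw.snd_mk _ _

theorem d_dFun (a : S) : d R S (dFun R S a) = 0 := by
  change (Tw.hom R S _).snd = _
  rw [dFun, Tw.hom, ExteriorAlgebra.lift_ι_apply]
  have : Tw.one R S (KaehlerDifferential.D R S a) = Tw.mk (dFun R S a) 0 :=
    Derivation.liftKaehlerDifferential_comp_D _ _
  simp [this]

theorem d_mul (x y : Forms R S) : d R S (x * y) = d R S x * y + sgn R S x * d R S y := by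
  change (Tw.hom R S _).snd = _
  rw [map_mul, Tw.snd_mul, Tw.hom_fst, Tw.hom_fst, add_comm]
  rfl

/-- `d(a db) = da ∧ db` -/
theorem d_smul (a : S) (x : Forms R S) : d R S (a • x) = dFun R S a * x + a • d R S x := by
  rw [Algebra.smul_def, d_mul, d_algebraMap, AlgHom.commutes, Algebra.smul_def]

/-- The forms of degree `n`, as a module over the base. -/
def degForms (n : ℕ) : Submodule R (Forms R S) := (⋀[S]^n Ω[S⁄R]).restrictScalars R

/-- The closed forms of degree `n`. -/
def closedForms (n : ℕ) : Submodule R (Forms R S) := degForms R S n ⊓ LinearMap.ker (d R S)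

/-- The exact forms of degree `n`. -/
def exactForms : ℕ → Submodule R (Forms R S)
  | 0 => ⊥
  | n + 1 => (degForms R S n).map (d R S)

/-- The `n`-th algebraic de Rham cohomology of `S` over `R`. -/
abbrev H (n : ℕ) : Type _ := closedForms R S n ⧸ (exactForms R S n).submoduleOf (closedForms R S n)

/-- The class of a closed form. -/
def H.mk {n : ℕ} (ω : Forms R S) (hω : ω ∈ closedForms R S n) : H R S n :=
  Submodule.Quotient.mk ⟨ω, hω⟩

section Relative

variable (k A S : Type*) [CommRing k] [CommRing A] [CommRing S] [Algebra k A] [Algebra k S]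
  [Algebra A S] [IsScalarTower k A S]

/-- The projection from the forms of `S` over `k` to the relative forms of `S` over `A`. -/
def toRel : Forms k S →ₐ[S] Forms A S := ExteriorAlgebra.map (KaehlerDifferential.map k A S S)

/-- The form `ω` of `S` over `k` is closed as a relative form of `S` over `A` of degree `n`,
and `h` is its relative cohomology class. -/
def IsClassOf {n : ℕ} (h : H A S n) (ω : Forms k S) : Prop :=
  ∃ hω : toRel k A S ω ∈ closedForms A S n, h = H.mk A S (toRel k A S ω) hω

/-- For a base with one coordinate `y`: `nabla` is the connecting map
`[ω] ↦ dy ⊗ [w]`, where `ω` is a form of `S` over `k` of degree `n` that represents the relative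
class and `dω = w ∧ dy` (here `dy` is the pullback to `S`). -/
def IsGaussManin (n : ℕ) (y : A) (nabla : H A S n →ₗ[k] Ω[A⁄k] ⊗[A] H A S n) : Prop :=
  ∀ ω ∈ degForms k S n, ∀ w ∈ degForms k S n,
    d k S ω = w * dFun k S (algebraMap A S y) →
    ∀ h h' : H A S n, IsClassOf k A S h ω → IsClassOf k A S h' w →
      nabla h = KaehlerDifferential.D k A y ⊗ₜ[A] h'

/-- The submodule `N` is preserved by the connection `nabla`: it maps `N` to the image of
`Ω ⊗ N`. -/
def IsHorizontal {k A M : Type*} [CommRing k] [CommRing A] [Algebra k A] [AddCommGroup M]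
    [Module A M] [Module k M] (nabla : M →ₗ[k] Ω[A⁄k] ⊗[A] M) (N : Submodule A M) : Prop :=
  ∀ h ∈ N, nabla h ∈ LinearMap.range (LinearMap.lTensor (Ω[A⁄k]) N.subtype)

end Relative

end DeRham

namespace OneHoledTorus

/-! ### The family -/

/-- The trace of the boundary of the one-holed torus in the trace coordinates
`x₁ = tr ρ(F₁)`, `x₂ = tr ρ(F₂)`, `x₃ = tr ρ(F₁F₂)`. -/
def t : MvPolynomial (Fin 3) ℂ :=
  -2 + MvPolynomial.X 0 ^ 2 + MvPolynomial.X 1 ^ 2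
    - MvPolynomial.X 0 * MvPolynomial.X 1 * MvPolynomial.X 2 + MvPolynomial.X 2 ^ 2

theorem eval_t (g h : Matrix.SpecialLinearGroup (Fin 2) ℂ) :
    MvPolynomial.eval ![g.1.trace, h.1.trace, (g * h).1.trace] t
      = (g * h * g⁻¹ * h⁻¹).1.trace := by
  have hg := g.2
  have hh := h.2
  rw [Matrix.det_fin_two] at hg hh
  simp only [t, Matrix.SpecialLinearGroup.coe_mul, Matrix.SpecialLinearGroup.coe_inv,
    Matrix.adjugate_fin_two, Matrix.trace_fin_two, Matrix.mul_apply, Fin.sum_univ_two,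
    map_add, map_sub, map_mul, map_pow, MvPolynomial.eval_X, map_neg, map_ofNat]
  simp only [Matrix.of_apply, Matrix.cons_val]
  generalize g.1 0 0 = a at *
  generalize g.1 0 1 = b at *
  generalize g.1 1 0 = c at *
  generalize g.1 1 1 = e at *
  generalize h.1 0 0 = p at *
  generalize h.1 0 1 = q at *
  generalize h.1 1 0 = r at *
  generalize h.1 1 1 = s at *
  linear_combination (-(p + s) ^ 2 + 2 * (p * s - q * r)) * hg + (-(a + e) ^ 2 + 2) * hh

/-- The polynomial `y² - 4`. -/
def psi : Polynomial ℂ := Polynomial.X ^ 2 - 4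

/-- The coordinate ring of `Y = ℂ ∖ {2, -2}`. -/
abbrev OY : Type := Localization.Away psi

/-- The coordinate ring of the preimage `X` of `Y` in `ℂ³` under `t`. -/
abbrev OX : Type := Localization.Away (Polynomial.aeval t psi)

/-- The homomorphism of coordinate rings `y ↦ t`. -/
def pullback : OY →+* OX :=
  IsLocalization.Away.lift psi
    (g := (algebraMap (MvPolynomial (Fin 3) ℂ) OX).comp (Polynomial.aeval t).toRingHom)
    (IsLocalization.Away.algebraMap_isUnit (Polynomial.aeval t psi))

instance instAlgebraOYOX : Algebra OY OX := pullback.toAlgebra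

instance instTower : IsScalarTower ℂ OY OX := IsScalarTower.of_algebraMap_eq fun r => by
  rw [IsScalarTower.algebraMap_apply ℂ (Polynomial ℂ) OY]
  change _ = pullback _
  rw [pullback, IsLocalization.Away.lift_eq, RingHom.comp_apply]
  rw [IsScalarTower.algebraMap_apply ℂ (MvPolynomial (Fin 3) ℂ) OX]
  exact congrArg _ ((Polynomial.aeval t).commutes r).symm

/-- The coordinate of `Y`. -/
def y : OY := algebraMap (Polynomial ℂ) OY Polynomial.X

/-- The coordinates of `X`. -/
def x (i : Fin 3) : OX := algebraMap (MvPolynomial (Fin 3) ℂ) OX (MvPolynomial.X i)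

/-- The function `1 / (y - 2)` on `Y`. -/
def u : OY := Ring.inverse (y - 2)

/-- The function `1 / (y + 2)` on `Y`. -/
def v : OY := Ring.inverse (y + 2)

/-- The forms `g x₁ dx₂ ∧ dx₃` with `g` one of `1, x₁, x₂, x₃, x₁²`. -/
def B (i : Fin 5) : DeRham.Forms ℂ OX :=
  (![1, x 0, x 1, x 2, x 0 ^ 2] i * x 0) •
    (DeRham.dFun ℂ OX (x 1) * DeRham.dFun ℂ OX (x 2))

/-- The second relative de Rham cohomology of the family. -/
abbrev H2 : Type := DeRham.H OY OX 2

/-! ### The connection matrices -/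

/-- The connection matrix, where `u` stands for `1 / (y - 2)` and `v` for `1 / (y + 2)`. -/
def E {R : Type*} [CommRing R] [Algebra ℂ R] (u v : R) : Matrix (Fin 5) (Fin 5) R :=
  !![(3 / 2 : ℂ) • v + (-1 / 2 : ℂ) • u, 0, 0, 0, (-1 / 6 : ℂ) • v + (1 / 6 : ℂ) • u;
     0, (3 / 2 : ℂ) • u, 0, 0, 0;
     0, 0, (3 / 2 : ℂ) • u, 0, 0;
     0, 0, 0, (3 / 2 : ℂ) • u, 0;
     (-6 : ℂ) • u, 0, 0, 0, (2 : ℂ) • u]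

/-- The residue at `2` of the rank two system. -/
def A2 : Matrix (Fin 2) (Fin 2) ℂ := !![-1 / 2, 1 / 6; -6, 2]

/-- The residue at `-2` of the rank two system. -/
def Am2 : Matrix (Fin 2) (Fin 2) ℂ := !![3 / 2, -1 / 6; 0, 0]

/-- The residue at infinity of the rank two system. -/
def Ainf : Matrix (Fin 2) (Fin 2) ℂ := -(A2 + Am2)

/-- The matrix of the rank two system, where `u` stands for `1 / (y - 2)` and `v` for
`1 / (y + 2)`. -/
def A {R : Type*} [CommRing R] [Algebra ℂ R] (u v : R) : Matrix (Fin 2) (Fin 2) R :=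
  u • A2.map (algebraMap ℂ R) + v • Am2.map (algebraMap ℂ R)

end OneHoledTorus

/-! ### Monodromy of a linear system on a subset of the complex plane -/

namespace Monodromy

variable {n : Type*} [Fintype n] [DecidableEq n]

/-- The rows of `Φ` are flat at `z` for the connection `c ↦ dc + c A dz` on row vectors. -/
def IsFlatAt (A Φ : ℂ → Matrix n n ℂ) (z : ℂ) : Prop :=
  ∀ i j, HasDerivAt (fun z' => Φ z' i j) (-(Φ z * A z) i j) z

/-- Continuation of flat sections along the path `γ` leads from the initial values `C₀` (the rows
of `C₀` are the values of flat sections at the start of `γ`) to the values `C₁` at its end: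
`F s` is the value at `γ s`. -/
def Continues (A : ℂ → Matrix n n ℂ) {p q : ℂ} (γ : Path p q) (C₀ C₁ : Matrix n n ℂ) : Prop :=
  ∃ F : unitInterval → Matrix n n ℂ, F 0 = C₀ ∧ F 1 = C₁ ∧
    ∀ s, ∃ Φ : ℂ → Matrix n n ℂ,
      (∀ᶠ z in 𝓝 (γ s), IsFlatAt A Φ z) ∧ ∀ᶠ s' in 𝓝 s, F s' = Φ (γ s')

/-- The path `γ` stays in the domain `Y`, and the basis of flat sections with initial values
(rows) `C` is continued along the loop `γ` to the basis `N * C`. -/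
def HasMonodromy (Y : Set ℂ) (A : ℂ → Matrix n n ℂ) {p : ℂ} (γ : Path p p)
    (C N : GL n ℂ) : Prop :=
  (∀ s, γ s ∈ Y) ∧ Continues A γ C.1 (N.1 * C.1)

end Monodromy

namespace OneHoledTorus

/-- The points of `Y`. -/
def Y : Set ℂ := {2, -2}ᶜ

/-- The matrix of the rank two system as a function on `Y`. -/
def sys (z : ℂ) : Matrix (Fin 2) (Fin 2) ℂ := A (1 / (z - 2)) (1 / (z + 2))

open Complex in
/-- The circle around `c` that starts at `p`, run once counterclockwise. -/
def circle (c p : ℂ) : Path p p where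
  toFun s := c + (p - c) * exp (2 * Real.pi * I * (s : ℝ))
  continuous_toFun := by fun_prop
  source' := by simp
  target' := by simp

/-- The segment from `p` to `q`. -/
def seg (p q : ℂ) : Path p q where
  toFun s := p + (s : ℝ) * (q - p)
  continuous_toFun := by fun_prop
  source' := by simp
  target' := by simp

/-- The loop around `-2`. -/
def loopm2 : Path (0 : ℂ) 0 := circle (-2) 0

/-- The loop around `2`. -/
def loop2 : Path (0 : ℂ) 0 := circle 2 0

/-- The loop around infinity: from `0` to `4i`, once clockwise around the circle of radius four
with center `0`, and back. -/
def loopInf : Path (0 : ℂ) 0 :=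
  (seg 0 (4 * Complex.I)).trans
    ((circle 0 (4 * Complex.I)).symm.trans (seg 0 (4 * Complex.I)).symm)

def Nm2 : GL (Fin 2) ℂ :=
  Matrix.GeneralLinearGroup.mkOfDetNeZero !![1, 0; 0, -1] (by simp [Matrix.det_fin_two])

def N2 : GL (Fin 2) ℂ :=
  Matrix.GeneralLinearGroup.mkOfDetNeZero !![1, -(4 * Real.pi * Complex.I / 3); 0, -1]
    (by simp [Matrix.det_fin_two])

def Ninf : GL (Fin 2) ℂ :=
  Matrix.GeneralLinearGroup.mkOfDetNeZero !![1, 4 * Real.pi * Complex.I / 3; 0, 1]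
    (by simp [Matrix.det_fin_two])

end OneHoledTorus
end

/-! Cohomology. The critical values of t are ±2, so over Y the partial derivatives of t generate the
unit ideal (`exists_sum_mul_gradT`). Hence the relative two-forms are free of rank one on ω = dx₁ ∧
dx₂ ∧ dx₃ / dt (`leray`), all of them are closed, and H² is O_X modulo the functions curl W · ∇t
(`cls_eq_zero`). The two-form with coefficient vector V has the class of V · ∇t, and the Gauss–Manin
connection sends it to dy ⊗ [div V].

Spanning. The classes of monomials satisfy the relations `IsMarkov`: three families come from exact
forms, one from the definition of t. They reduce every monomial by induction on the degree to 1, x₁,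
x₂, x₃, x₁² (`IsMarkov.mem`).

Independence. Put x₁ = a + 1/a on the fibre over y₀. Its equation becomes (x₂ - a x₃)(x₂ - x₃/a) =
(y₀ - 2) - (a - 1/a)², and with T = x₂ - a x₃ this gives a chart by Laurent polynomials in T in
which ω = da/a ∧ dT/T. Taking the constant term in T is integration over a circle. The constant term
of a function with zero class is therefore a d/da of some h(a). Where (a - 1/a)² = y₀ - 2 the chart
has no negative powers of T, the circle becomes contractible, and h vanishes
(`exists_constTerm_chart`). For a combination of 1, x₁, x₁² this forces all coefficients to vanish:
the residue gives one condition, and the values at the four special points give the others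
(`eq_zero_of_θ_eq_poly`). Cyclic rotations of the chart treat x₂ and x₃.

Connection. The forms in B have the classes of g x₁ ∂₁t; they are related to the classes of the five
functions g by a matrix that is invertible because y - 2 and y + 2 are (`IsMarkovBasis`). The
divergence of g x₁ ∂₁ is a number times g, and rewriting g in the basis B gives E
(`IsMarkovBasis.sum_E`). That the connection does not depend on representatives is the identity
div(∇t × U) = -∇t · curl U (`exists_div_eq_sum_curl`).

Monodromy. On the cover y = 2 cosh l the rank-two system has an explicit fundamental matrix `flat`,
built from cosh l, sinh l and l. Paths in Y lift to the cover (`exists_lift`), so the monodromy of a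
loop depends only on the end `basePt k` of its lift and is `Nk k`. These matrices form an infinite
dihedral group, and the three loops have explicit lifts with k = 1, -1, -2. -/

set_option linter.unusedSimpArgs false

noncomputable section

/-! ### Flat sections and path lifting on the cover y = 2 cosh l -/

namespace OneHoledTorus

open Complex in
/-- A fundamental matrix of periods, on the cover of `Y` with `y = 2 cosh l`. -/
def periods (l : ℂ) : Matrix (Fin 2) (Fin 2) ℂ :=
  !![2 * cosh l, 2 / 3 * (2 * cosh l * (l - Real.pi * I) - 2 * sinh l);
     6 * (2 * cosh l - 1), 2 / 3 * (6 * (2 * cosh l - 1) * (l - Real.pi * I)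
      + (3 * cosh l - 6) * (2 * sinh l))]

open Complex in
/-- A fundamental matrix of flat sections (rows), on the cover of `Y` with `y = 2 cosh l`. -/
def flat (l : ℂ) : Matrix (Fin 2) (Fin 2) ℂ :=
  !![2 / 3 * (6 * (2 * cosh l - 1) * (l - Real.pi * I) + (3 * cosh l - 6) * (2 * sinh l))
        / (2 * sinh l) ^ 3,
      -(2 / 3 * (2 * cosh l * (l - Real.pi * I) - 2 * sinh l)) / (2 * sinh l) ^ 3;
     -(6 * (2 * cosh l - 1)) / (2 * sinh l) ^ 3, 2 * cosh l / (2 * sinh l) ^ 3]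

/-- Since (y - 2)(y + 2) = 4 sinh² l, the branch points of the cover lie exactly over the two
removed points. -/
theorem two_cosh_mem_Y {l : ℂ} : 2 * Complex.cosh l ∈ Y ↔ Complex.sinh l ≠ 0 := by
  have h := Complex.cosh_sq_sub_sinh_sq l
  simp only [Y, Set.mem_compl_iff, Set.mem_insert_iff, Set.mem_singleton_iff]
  constructor
  · intro hl h0
    rw [h0] at h
    have : (2 * Complex.cosh l - 2) * (2 * Complex.cosh l + 2) = 0 := by linear_combination 4 * h
    rcases mul_eq_zero.1 this with h1 | h1
    · exact hl (Or.inl (by linear_combination h1))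
    · exact hl (Or.inr (by linear_combination h1))
  · rintro h0 (h1 | h1)
    · exact h0 (pow_eq_zero_iff two_ne_zero |>.1
        (by linear_combination (Complex.cosh l / 2 + 1 / 2) * h1 - h))
    · exact h0 (pow_eq_zero_iff two_ne_zero |>.1
        (by linear_combination (Complex.cosh l / 2 - 1 / 2) * h1 - h))

theorem cosh_ne_of_sinh_ne_zero {l : ℂ} (hl : Complex.sinh l ≠ 0) :
    2 * Complex.cosh l - 2 ≠ 0 ∧ 2 * Complex.cosh l + 2 ≠ 0 := by
  have h := two_cosh_mem_Y.2 hl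
  simp only [Y, Set.mem_compl_iff, Set.mem_insert_iff, Set.mem_singleton_iff, not_or] at h
  exact ⟨sub_ne_zero.2 h.1, fun h' => h.2 (eq_neg_of_add_eq_zero_left h')⟩

theorem sys_eq (z : ℂ) : sys z =
    !![-1 / 2 * (1 / (z - 2)) + 3 / 2 * (1 / (z + 2)),
        1 / 6 * (1 / (z - 2)) - 1 / 6 * (1 / (z + 2));
       -6 * (1 / (z - 2)), 2 * (1 / (z - 2))] := by
  ext i j
  fin_cases i <;> fin_cases j <;> simp [sys, A, A2, Am2] <;> ring

theorem sys_two_cosh {l : ℂ} (hl : Complex.sinh l ≠ 0) :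
    sys (2 * Complex.cosh l) =
    !![(Complex.cosh l - 2) / (2 * Complex.sinh l ^ 2), 1 / (6 * Complex.sinh l ^ 2);
       -3 * (Complex.cosh l + 1) / Complex.sinh l ^ 2,
       (Complex.cosh l + 1) / Complex.sinh l ^ 2] := by
  obtain ⟨h1, h2⟩ := cosh_ne_of_sinh_ne_zero hl
  have e1 : 1 / (2 * Complex.cosh l - 2) = (Complex.cosh l + 1) / (2 * Complex.sinh l ^ 2) := by
    rw [div_eq_div_iff h1 (by simp [hl]), Complex.sinh_sq]; ring
  have e2 : 1 / (2 * Complex.cosh l + 2) = (Complex.cosh l - 1) / (2 * Complex.sinh l ^ 2) := by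
    rw [div_eq_div_iff h2 (by simp [hl]), Complex.sinh_sq]; ring
  rw [sys_eq, e1, e2]
  ext i j
  fin_cases i <;> fin_cases j <;> simp <;> field_simp <;> ring

/-- The columns P solve the dual system dP/dy = A P; the factor 2 sinh l is dy/dl. The first column
is (y, 6y - 6). The second is 2/3 (l - πi) times the first plus a term odd in l, which is where the
unipotent part of the monodromy comes from. -/
theorem hasDerivAt_periods {l : ℂ} (hl : Complex.sinh l ≠ 0) (i j : Fin 2) :
    HasDerivAt (fun l => periods l i j)
      ((sys (2 * Complex.cosh l) * periods l) i j * (2 * Complex.sinh l)) l := by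
  have hc := Complex.hasDerivAt_cosh l
  have hs := Complex.hasDerivAt_sinh l
  have hi := (hasDerivAt_id l).sub_const (Real.pi * Complex.I : ℂ)
  have h := Complex.cosh_sq l
  rw [sys_two_cosh hl]
  fin_cases i <;> fin_cases j <;>
    simp only [periods, Matrix.of_apply, Matrix.cons_val, Matrix.mul_apply, Fin.sum_univ_two,
      Fin.mk_one, Fin.zero_eta, Fin.isValue]
  · refine (hc.const_mul 2).congr_deriv ?_
    field_simp
    linear_combination -h
  · refine ((((hc.const_mul 2).mul hi).sub (hs.const_mul 2)).const_mul (2 / 3)).congr_deriv ?_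
    simp only [id]
    field_simp
    linear_combination -6 * (l - Real.pi * Complex.I) * h
  · refine (((hc.const_mul 2).sub_const 1).const_mul 6).congr_deriv ?_
    field_simp
    linear_combination -6 * h
  · refine ((((((hc.const_mul 2).sub_const 1).const_mul 6).mul hi).add
      (((hc.const_mul 3).sub_const 6).mul (hs.const_mul 2))).const_mul (2 / 3)).congr_deriv ?_
    simp only [id]
    field_simp
    linear_combination (-6 * Complex.sinh l - 12 * (l - Real.pi * Complex.I)) * h

theorem hasDerivAt_flat {l : ℂ} (hl : Complex.sinh l ≠ 0) (i j : Fin 2) :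
    HasDerivAt (fun l => flat l i j)
      (-(flat l * sys (2 * Complex.cosh l)) i j * (2 * Complex.sinh l)) l := by
  have hc := Complex.hasDerivAt_cosh l
  have hs := Complex.hasDerivAt_sinh l
  have hi := (hasDerivAt_id l).sub_const (Real.pi * Complex.I : ℂ)
  have h := Complex.cosh_sq l
  have hs3 := (hs.const_mul 2).pow 3
  have h0 : (2 * Complex.sinh l) ^ 3 ≠ 0 := by simp [hl]
  rw [sys_two_cosh hl]
  fin_cases i <;> fin_cases j <;>
    simp only [flat, Matrix.of_apply, Matrix.cons_val, Matrix.mul_apply, Fin.sum_univ_two,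
      Fin.mk_one, Fin.zero_eta, Fin.isValue]
  · refine (((((((hc.const_mul 2).sub_const 1).const_mul 6).mul hi).add
      (((hc.const_mul 3).sub_const 6).mul (hs.const_mul 2))).const_mul (2 / 3)).div
        hs3 h0).congr_deriv ?_
    simp only [id, Pi.pow_apply, Pi.mul_apply, Pi.add_apply, Pi.sub_apply, Pi.neg_apply]
    field_simp
    grind
  · refine (((((hc.const_mul 2).mul hi).sub (hs.const_mul 2)).const_mul (2 / 3)).neg.div
        hs3 h0).congr_deriv ?_
    simp only [id, Pi.pow_apply, Pi.mul_apply, Pi.add_apply, Pi.sub_apply, Pi.neg_apply]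
    field_simp
    grind
  · refine ((((hc.const_mul 2).sub_const 1).const_mul 6).neg.div hs3 h0).congr_deriv ?_
    simp only [id, Pi.pow_apply, Pi.mul_apply, Pi.add_apply, Pi.sub_apply, Pi.neg_apply]
    field_simp
    grind
  · refine ((hc.const_mul 2).div hs3 h0).congr_deriv ?_
    simp only [id, Pi.pow_apply, Pi.mul_apply, Pi.add_apply, Pi.sub_apply, Pi.neg_apply]
    field_simp
    grind
open Monodromy

/-- The determinant of `periods` is (2 sinh l)³, and `flat` is the adjugate divided by it. -/
theorem flat_mul_periods {l : ℂ} (hl : Complex.sinh l ≠ 0) : flat l * periods l = 1 := by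
  have h := Complex.cosh_sq l
  ext i j
  fin_cases i <;> fin_cases j <;>
    simp [flat, periods, Matrix.mul_apply, Fin.sum_univ_two] <;> field_simp <;> grind

theorem det_flat_ne_zero {l : ℂ} (hl : Complex.sinh l ≠ 0) : (flat l).det ≠ 0 := fun h => by
  have := congrArg Matrix.det (flat_mul_periods hl)
  simp [h] at this

/-- Lifts of paths to the cover compute the continuation of flat sections. -/
theorem continues_of_lift {p q : ℂ} (γ : Path p q) (hγ : ∀ s, γ s ∈ Y)
    (L : C(unitInterval, ℂ)) (hL : ∀ s, 2 * Complex.cosh (L s) = γ s) :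
    Continues sys γ (flat (L 0)) (flat (L 1)) := by
  refine ⟨fun s => flat (L s), rfl, rfl, fun s => ?_⟩
  have hs : Complex.sinh (L s) ≠ 0 := two_cosh_mem_Y.1 (by rw [hL]; exact hγ s)
  have hd : HasStrictDerivAt (fun l => 2 * Complex.cosh l) (2 * Complex.sinh (L s)) (L s) :=
    (Complex.hasStrictDerivAt_cosh _).const_mul 2
  have h2 : 2 * Complex.sinh (L s) ≠ 0 := by simp [hs]
  set g := hd.localInverse _ _ _ h2 with hg
  have hgL : ∀ᶠ l in 𝓝 (L s), g (2 * Complex.cosh l) = l := hd.eventually_left_inverse h2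
  have hgR : ∀ᶠ z in 𝓝 (γ s), 2 * Complex.cosh (g z) = z := by
    have := hd.eventually_right_inverse h2
    rwa [hL s] at this
  have hgs : g (γ s) = L s := by rw [← hL s]; exact hgL.self_of_nhds
  have hgd : HasStrictDerivAt g (2 * Complex.sinh (L s))⁻¹ (γ s) := by
    have := hd.to_localInverse h2
    rwa [hL s] at this
  have hgc : ContinuousAt g (γ s) := hgd.hasDerivAt.continuousAt
  have hsinh : ∀ᶠ z in 𝓝 (γ s), Complex.sinh (g z) ≠ 0 := by
    apply ((Complex.continuous_sinh.continuousAt).comp hgc).eventually_ne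
    simpa [hgs] using hs
  refine ⟨fun z => flat (g z), ?_, ?_⟩
  -- Flatness is needed at all points near γ s. Strict differentiability at the one point γ s makes
  -- the local inverse Lipschitz, hence continuous, on a neighbourhood; the rule for the derivative
  -- of an inverse then applies throughout.
  · have hcont : ∀ᶠ z in 𝓝 (γ s), ContinuousAt g z := by
      obtain ⟨K, U, hU, hK⟩ := hgd.hasStrictFDerivAt.exists_lipschitzOnWith
      filter_upwards [eventually_mem_nhds_iff.2 hU] with z hz
      exact hK.continuousOn.continuousAt hz
    filter_upwards [hgR.eventually_nhds, hsinh, hcont] with z hz hz0 hzc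
    have hz' : 2 * Complex.cosh (g z) = z := hz.self_of_nhds
    have hder : HasDerivAt g (2 * Complex.sinh (g z))⁻¹ z :=
      HasDerivAt.of_local_left_inverse hzc ((Complex.hasDerivAt_cosh (g z)).const_mul 2)
        (by simp [hz0]) hz
    intro i j
    have := (hasDerivAt_flat hz0 i j).comp z hder
    rw [hz', mul_assoc, mul_inv_cancel₀ (by simp [hz0]), mul_one] at this
    exact this
  · have := (L.continuous.continuousAt (x := s)).eventually hgL
    filter_upwards [this] with s' hs'
    rw [← hL s', hs']

/-- Continuation is determined by the ends of a lift of the path. -/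
theorem mul_periods_eq_of_continues {p q : ℂ} {γ : Path p q} {C₀ C₁ : Matrix (Fin 2) (Fin 2) ℂ}
    (h : Continues sys γ C₀ C₁) (hγ : ∀ s, γ s ∈ Y)
    (L : C(unitInterval, ℂ)) (hL : ∀ s, 2 * Complex.cosh (L s) = γ s) :
    C₀ * periods (L 0) = C₁ * periods (L 1) := by
  obtain ⟨F, rfl, rfl, hF⟩ := h
  -- Flat rows satisfy Φ' = -ΦA and the columns of periods satisfy P' = AP, so ΦP has derivative
  -- zero.
  have hlc : IsLocallyConstant fun s => F s * periods (L s) := by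
    rw [IsLocallyConstant.iff_eventually_eq]
    intro s
    obtain ⟨Φ, hΦ, hFΦ⟩ := hF s
    have hs : Complex.sinh (L s) ≠ 0 := two_cosh_mem_Y.1 (by rw [hL]; exact hγ s)
    have hc : Continuous fun l : ℂ => 2 * Complex.cosh l := by fun_prop
    have h1 : ∀ᶠ l in 𝓝 (L s), IsFlatAt sys Φ (2 * Complex.cosh l) ∧ Complex.sinh l ≠ 0 := by
      refine (hc.continuousAt.eventually (by simpa only [hL s] using hΦ)).and
        (Complex.continuous_sinh.continuousAt.eventually_ne hs)
    obtain ⟨r, hr, hball⟩ := Metric.eventually_nhds_iff_ball.1 h1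
    have hder : ∀ l ∈ Metric.ball (L s) r, ∀ i j,
        HasDerivAt (fun l => (Φ (2 * Complex.cosh l) * periods l) i j) 0 l := by
      intro l hl i j
      obtain ⟨hfl, hl0⟩ := hball l hl
      simp only [Matrix.mul_apply, Fin.sum_univ_two]
      have hΦd := fun i j => (hfl i j).comp l ((Complex.hasDerivAt_cosh l).const_mul 2)
      have hPd := hasDerivAt_periods hl0
      refine ((((hΦd i 0).mul (hPd 0 j))).add ((hΦd i 1).mul (hPd 1 j))).congr_deriv ?_
      simp only [Matrix.mul_apply, Fin.sum_univ_two, Function.comp]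
      ring
    have hconst : ∀ l ∈ Metric.ball (L s) r,
        Φ (2 * Complex.cosh l) * periods l = Φ (2 * Complex.cosh (L s)) * periods (L s) := by
      intro l hl
      ext i j
      refine Metric.isOpen_ball.is_const_of_deriv_eq_zero
        (convex_ball (L s) r).isPreconnected
        (f := fun l => (Φ (2 * Complex.cosh l) * periods l) i j)
        (fun l hl => (hder l hl i j).differentiableAt.differentiableWithinAt)
        (fun l hl => (hder l hl i j).deriv) hl (Metric.mem_ball_self hr)
    have hLs := (L.continuous.continuousAt (x := s)).eventually
      (Metric.ball_mem_nhds (L s) hr)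
    filter_upwards [hLs, hFΦ] with s' h1 h2
    rw [h2, hFΦ.self_of_nhds, ← hL, ← hL]
    exact hconst _ h1
  exact hlc.apply_eq_of_isPreconnected isPreconnected_univ trivial trivial

/-- Paths in `Y` lift to the cover. -/
theorem exists_lift {p q : ℂ} (γ : Path p q) (hγ : ∀ s, γ s ∈ Y) {l₀ : ℂ}
    (h0 : 2 * Complex.cosh l₀ = p) :
    ∃ L : C(unitInterval, ℂ), L 0 = l₀ ∧ ∀ s, 2 * Complex.cosh (L s) = γ s := by
  -- A path in ℂ ∖ 0 has a continuous logarithm because exp is a covering. It is used twice: to get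
  -- R = √(γ² - 4), and then to solve e^L = (γ + R)/2, which is equivalent to e^L + e^(-L) = γ with
  -- the chosen sign of R.
  have key : ∀ f : C(unitInterval, ℂ), (∀ s, f s ≠ 0) → ∀ a, Complex.exp a = f 0 →
      ∃ g : C(unitInterval, ℂ), g 0 = a ∧ ∀ s, Complex.exp (g s) = f s := by
    intro f hf a ha
    obtain ⟨g, hg, hg0⟩ := Complex.isCoveringMap_exp.exists_path_lifts
      ⟨fun s => (⟨f s, hf s⟩ : {z : ℂ // z ≠ 0}), by fun_prop⟩ a (Subtype.ext ha.symm)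
    exact ⟨g, hg0, fun s => congrArg Subtype.val (congrFun hg s)⟩
  obtain ⟨h, -, hh⟩ := key ⟨fun s => γ s ^ 2 - 4, by fun_prop⟩ (fun s hs => by
    have := hγ s
    simp only [Y, Set.mem_compl_iff, Set.mem_insert_iff, Set.mem_singleton_iff] at this
    have hs' : (γ s - 2) * (γ s + 2) = 0 := by
      simp only [ContinuousMap.coe_mk] at hs; linear_combination hs
    rcases mul_eq_zero.1 hs' with h | h
    · exact this (Or.inl (by linear_combination h))
    · exact this (Or.inr (by linear_combination h))) (Complex.log (γ 0 ^ 2 - 4)) (by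
    refine Complex.exp_log fun hs => ?_
    have := hγ 0
    simp only [Y, Set.mem_compl_iff, Set.mem_insert_iff, Set.mem_singleton_iff] at this
    have hs' : (γ 0 - 2) * (γ 0 + 2) = 0 := by linear_combination hs
    rcases mul_eq_zero.1 hs' with h | h
    · exact this (Or.inl (by linear_combination h))
    · exact this (Or.inr (by linear_combination h)))
  -- a continuous square root of `γ² - 4` with the right sign at the start
  obtain ⟨R, hR0, hR⟩ : ∃ R : C(unitInterval, ℂ), R 0 = 2 * Complex.sinh l₀ ∧
      ∀ s, R s ^ 2 = γ s ^ 2 - 4 := by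
    have hsq : ∀ s, Complex.exp (h s / 2) ^ 2 = γ s ^ 2 - 4 := fun s => by
      rw [← Complex.exp_nat_mul]
      rw [← show Complex.exp (h s) = γ s ^ 2 - 4 from hh s]
      congr 1
      push_cast; ring
    have h00 : Complex.exp (h 0 / 2) ^ 2 = (2 * Complex.sinh l₀) ^ 2 := by
      rw [hsq, γ.source, ← h0, mul_pow, mul_pow, Complex.sinh_sq]; ring
    rcases sq_eq_sq_iff_eq_or_eq_neg.1 h00 with h1 | h1
    · exact ⟨⟨fun s => Complex.exp (h s / 2), by fun_prop⟩, h1, hsq⟩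
    · refine ⟨⟨fun s => -Complex.exp (h s / 2), by fun_prop⟩, by simp [h1], fun s => ?_⟩
      simpa using hsq s
  have hmul : ∀ s, (γ s + R s) / 2 * ((γ s - R s) / 2) = 1 := fun s => by
    linear_combination -(1 / 4 : ℂ) * hR s
  obtain ⟨L, hL0, hL⟩ := key ⟨fun s => (γ s + R s) / 2, by fun_prop⟩
    (fun s => left_ne_zero_of_mul_eq_one (hmul s)) l₀ (by
      simp only [ContinuousMap.coe_mk, γ.source, hR0, ← h0, ← Complex.cosh_add_sinh]
      ring)
  refine ⟨L, hL0, fun s => ?_⟩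
  have h1 : Complex.exp (L s) = (γ s + R s) / 2 := hL s
  have h2 : Complex.exp (-L s) = (γ s - R s) / 2 := by
    rw [Complex.exp_neg, h1]
    exact inv_eq_of_mul_eq_one_right (hmul s)
  rw [Complex.cosh, h1, h2]
  ring

/-! ### The monodromy group from the points over the base point -/

open Monodromy

/-- The points over the base point `0`. -/
def basePt (k : ℤ) : ℂ := Real.pi * Complex.I / 2 + k * (Real.pi * Complex.I)

theorem cosh_basePt (k : ℤ) : Complex.cosh (basePt k) = 0 := by
  have : basePt k = ((Real.pi / 2 + k * Real.pi : ℂ)) * Complex.I := by rw [basePt]; ring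
  rw [this, Complex.cosh_mul_I, Complex.cos_add]
  simp [Complex.sin_int_mul_pi]

theorem sinh_basePt (k : ℤ) : Complex.sinh (basePt k) = (-1) ^ k * Complex.I := by
  have : basePt k = ((Real.pi / 2 + k * Real.pi : ℂ)) * Complex.I := by rw [basePt]; ring
  rw [this, Complex.sinh_mul_I, Complex.sin_add]
  simp only [Complex.sin_pi_div_two, Complex.cos_pi_div_two, one_mul, zero_mul, add_zero]
  have h := congrArg Complex.ofReal (Real.cos_int_mul_pi k)
  push_cast at h
  rw [h]

theorem exists_basePt {l : ℂ} (h : 2 * Complex.cosh l = 0) : ∃ k, l = basePt k := by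
  have h' : Complex.cos (l * Complex.I) = 0 := by
    rw [Complex.cos_mul_I]; linear_combination h / 2
  obtain ⟨k, hk⟩ := Complex.cos_eq_zero_iff.1 h'
  -- From l i = (2k + 1)π/2 one gets l = -(2k + 1)πi/2 = πi/2 + (-k - 1)πi.
  refine ⟨-k - 1, ?_⟩
  rw [basePt]
  push_cast
  linear_combination -Complex.I * hk + l * Complex.I_mul_I

theorem neg_one_zpow_mul_self (k : ℤ) : ((-1) ^ k * (-1) ^ k : ℂ) = 1 := by
  rw [← mul_zpow]; simp

/-- The monodromy matrix of the paths that lift to paths from `basePt 0` to `basePt k`. -/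
def Nk (k : ℤ) : GL (Fin 2) ℂ :=
  Matrix.GeneralLinearGroup.mkOfDetNeZero
    !![1, -(Real.pi * Complex.I / 3) * (1 + (-1) ^ k * (2 * k - 1)); 0, (-1) ^ k]
    (by rw [Matrix.det_fin_two_of, one_mul, mul_zero, sub_zero]
        exact zpow_ne_zero _ (by norm_num))

theorem coe_Nk (k : ℤ) : (Nk k : Matrix (Fin 2) (Fin 2) ℂ) =
    !![1, -(Real.pi * Complex.I / 3) * (1 + (-1) ^ k * (2 * k - 1)); 0, (-1) ^ k] := rfl

theorem Nk_one : Nk 1 = Nm2 := by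
  ext i j
  fin_cases i <;> fin_cases j <;> simp [coe_Nk, Nm2, Matrix.GeneralLinearGroup.mkOfDetNeZero]
  norm_num

theorem Nk_neg_one : Nk (-1) = N2 := by
  ext i j
  fin_cases i <;> fin_cases j <;> simp [coe_Nk, N2, Matrix.GeneralLinearGroup.mkOfDetNeZero]
  ring

theorem Nk_neg_two : Nk (-2) = Ninf := by
  ext i j
  fin_cases i <;> fin_cases j <;> simp [coe_Nk, Ninf, Matrix.GeneralLinearGroup.mkOfDetNeZero]
  ring

theorem Nk_zero : Nk 0 = 1 := by
  ext i j
  fin_cases i <;> fin_cases j <;> simp [coe_Nk]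

/-- The deck transformations of l ↦ 2 cosh l are l ↦ ±l + 2πi m. Even k correspond to the
translations and odd k to the reflections, so the products follow the rule of the infinite dihedral
group. -/
theorem Nk_mul_of_even {k : ℤ} (hk : Even k) (l : ℤ) : Nk k * Nk l = Nk (k + l) := by
  ext i j
  have h := hk.neg_one_zpow (α := ℂ)
  have h' : ((-1) ^ (k + l) : ℂ) = (-1) ^ l := by rw [zpow_add₀ (by norm_num), h, one_mul]
  fin_cases i <;> fin_cases j <;>
    simp [coe_Nk, Matrix.mul_apply, Fin.sum_univ_two, h, h']
  ring

theorem Nk_mul_of_odd {k : ℤ} (hk : Odd k) (l : ℤ) : Nk k * Nk l = Nk (k - l) := by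
  ext i j
  have h := hk.neg_one_zpow (α := ℂ)
  have h' : ((-1) ^ (k - l) : ℂ) = -(-1) ^ l := by
    rw [zpow_sub₀ (by norm_num), h, div_eq_iff (zpow_ne_zero _ (by norm_num))]
    linear_combination neg_one_zpow_mul_self l
  fin_cases i <;> fin_cases j <;>
    simp [coe_Nk, Matrix.mul_apply, Fin.sum_univ_two, h, h']
  ring

/-- The range is a group by the dihedral rule. It is generated by the given matrices since the
powers of `Ninf` are the `Nk k` with k even, and each odd one is such a power times `Nm2`. -/
theorem range_Nk : Set.range Nk = (Subgroup.closure {Nm2, N2, Ninf} : Set (GL (Fin 2) ℂ)) := by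
  have hmul : ∀ k l, ∃ m, Nk k * Nk l = Nk m := by
    intro k l
    rcases Int.even_or_odd k with hk | hk
    · exact ⟨_, Nk_mul_of_even hk l⟩
    · exact ⟨_, Nk_mul_of_odd hk l⟩
  have hinv : ∀ k, ∃ m, (Nk k)⁻¹ = Nk m := by
    intro k
    rcases Int.even_or_odd k with hk | hk
    · exact ⟨-k, inv_eq_of_mul_eq_one_right (by rw [Nk_mul_of_even hk, add_neg_cancel, Nk_zero])⟩
    · exact ⟨k, inv_eq_of_mul_eq_one_right (by rw [Nk_mul_of_odd hk, sub_self, Nk_zero])⟩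
  let G : Subgroup (GL (Fin 2) ℂ) :=
    { carrier := Set.range Nk
      mul_mem' := by
        rintro _ _ ⟨k, rfl⟩ ⟨l, rfl⟩
        obtain ⟨m, hm⟩ := hmul k l
        exact ⟨m, hm.symm⟩
      one_mem' := ⟨0, Nk_zero⟩
      inv_mem' := by
        rintro _ ⟨k, rfl⟩
        obtain ⟨m, hm⟩ := hinv k
        exact ⟨m, hm.symm⟩ }
  apply Set.Subset.antisymm
  · have h2 : ∀ m : ℤ, Nk (-2 * m) = Ninf ^ m := by
      have hn : ∀ n : ℕ, Nk (-2 * n) = Ninf ^ n := by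
        intro n
        induction n with
        | zero => simpa using Nk_zero
        | succ n ih =>
          rw [pow_succ', ← ih, ← Nk_neg_two, Nk_mul_of_even (by decide)]
          congr 1
          push_cast; ring
      intro m
      obtain ⟨n, rfl | rfl⟩ := m.eq_nat_or_neg
      · rw [hn, zpow_natCast]
      · rw [zpow_neg, zpow_natCast, ← hn]
        refine (inv_eq_of_mul_eq_one_right ?_).symm
        rw [Nk_mul_of_even ⟨-n, by ring⟩]
        rw [← Nk_zero]; congr 1; ring
    have hinf : Ninf ∈ Subgroup.closure {Nm2, N2, Ninf} := Subgroup.subset_closure (by simp)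
    have hm2 : Nm2 ∈ Subgroup.closure {Nm2, N2, Ninf} := Subgroup.subset_closure (by simp)
    rintro _ ⟨k, rfl⟩
    obtain ⟨m, rfl | rfl⟩ := Int.even_or_odd' k
    · have := h2 (-m)
      rw [show (-2 * -m : ℤ) = 2 * m by ring] at this
      rw [this]
      exact Subgroup.zpow_mem _ hinf _
    · have h := Nk_mul_of_even (k := 2 * m) ⟨m, by ring⟩ 1
      have := h2 (-m)
      rw [show (-2 * -m : ℤ) = 2 * m by ring] at this
      rw [← h, this, Nk_one]
      exact Subgroup.mul_mem _ (Subgroup.zpow_mem _ hinf _) hm2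
  · change Subgroup.closure {Nm2, N2, Ninf} ≤ G
    rw [Subgroup.closure_le]
    rintro _ (rfl | rfl | rfl)
    · exact ⟨1, Nk_one⟩
    · exact ⟨-1, Nk_neg_one⟩
    · exact ⟨-2, Nk_neg_two⟩

/-- Over the base point cosh l = 0 and sinh l = (-1)^k i, so passing between sheets changes only
this sign and the linear term l - πi. -/
theorem flat_basePt (k : ℤ) : flat (basePt k) = Nk k * flat (basePt 0) := by
  have hI := Complex.I_sq
  have h3 : ((2:ℂ) * ((-1) ^ k * Complex.I)) ^ 3 = -8 * Complex.I * (-1) ^ k := by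
    linear_combination 8 * Complex.I ^ 3 * (-1) ^ k * neg_one_zpow_mul_self k
      + 8 * Complex.I * (-1) ^ k * hI
  have h0 : ((-1) ^ k : ℂ) ≠ 0 := zpow_ne_zero _ (by norm_num)
  have e := neg_one_zpow_mul_self k
  have h3' : ((2:ℂ) * Complex.I) ^ 3 = -8 * Complex.I := by
    linear_combination 8 * Complex.I * hI
  ext i j
  fin_cases i <;> fin_cases j <;>
    simp [coe_Nk, flat, cosh_basePt, sinh_basePt, h3, h3', Matrix.mul_apply, Fin.sum_univ_two] <;>
    (try simp only [basePt]) <;> field_simp <;> grind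

/-- The basis of flat sections near `0`, normalized at `basePt 0`. -/
def initialFlat : GL (Fin 2) ℂ :=
  Matrix.GeneralLinearGroup.mkOfDetNeZero (flat (basePt 0))
    (det_flat_ne_zero (by rw [sinh_basePt]; simp))

theorem hasMonodromy_of_lift {γ : Path (0 : ℂ) 0} (hγ : ∀ s, γ s ∈ Y) (L : C(unitInterval, ℂ))
    (hL : ∀ s, 2 * Complex.cosh (L s) = γ s) {k : ℤ} (h0 : L 0 = basePt 0) (h1 : L 1 = basePt k) :
    HasMonodromy Y sys γ initialFlat (Nk k) := by
  refine ⟨hγ, ?_⟩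
  have := continues_of_lift γ hγ L hL
  rw [h0, h1, flat_basePt k] at this
  exact this

/-- The lift from `basePt 0` ends at some `basePt k`. Two continuations along γ with the same
initial values have the same product with `periods` at that end, and this matrix is invertible. -/
theorem exists_hasMonodromy_Nk {γ : Path (0 : ℂ) 0} (hγ : ∀ s, γ s ∈ Y) :
    ∃ k, HasMonodromy Y sys γ initialFlat (Nk k) ∧
      ∀ N, HasMonodromy Y sys γ initialFlat N → N = Nk k := by
  obtain ⟨L, h0, hL⟩ := exists_lift γ hγ (l₀ := basePt 0) (by rw [cosh_basePt, mul_zero])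
  obtain ⟨k, hk⟩ := exists_basePt (l := L 1) (by rw [hL, γ.target])
  refine ⟨k, hasMonodromy_of_lift hγ L hL h0 hk, fun N hN => ?_⟩
  have h1 := mul_periods_eq_of_continues hN.2 hγ L hL
  have h2 := mul_periods_eq_of_continues (continues_of_lift γ hγ L hL) hγ L hL
  have hs : Complex.sinh (basePt k) ≠ 0 := by
    rw [sinh_basePt]
    exact mul_ne_zero (zpow_ne_zero _ (by norm_num)) Complex.I_ne_zero
  have hd : IsUnit (periods (basePt k)) :=
    IsUnit.of_mul_eq_one_right _ (flat_mul_periods hs)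
  rw [h0, hk] at h1 h2
  have h3 : N.1 * initialFlat.1 = (Nk k).1 * initialFlat.1 := by
    have := h1.symm.trans h2
    rw [flat_basePt k] at this
    exact hd.mul_left_injective this
  have h4 : N * initialFlat = Nk k * initialFlat := Units.ext h3
  exact mul_right_cancel h4

theorem existsUnique_hasMonodromy {γ : Path (0 : ℂ) 0} (hγ : ∀ s, γ s ∈ Y) :
    ∃! N, HasMonodromy Y sys γ initialFlat N := by
  obtain ⟨k, h, hu⟩ := exists_hasMonodromy_Nk hγ
  exact ⟨Nk k, h, hu⟩

open Complex in
theorem exists_path_hasMonodromy_Nk (k : ℤ) :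
    ∃ γ : Path (0 : ℂ) 0, HasMonodromy Y sys γ initialFlat (Nk k) := by
  -- An arc on the cover bulging into the right half plane: its interior has positive real part,
  -- whereas the zeros of sinh are purely imaginary.
  let L : C(unitInterval, ℂ) := ⟨fun s => (Real.sin (Real.pi * s) : ℝ) +
    ((Real.pi / 2 + k * Real.pi * s : ℝ)) * I, by fun_prop⟩
  have h0 : L 0 = basePt 0 := by simp [L, basePt]; ring
  have h1 : L 1 = basePt k := by simp [L, basePt]; ring
  let γ : Path (0 : ℂ) 0 :=
    { toFun s := 2 * cosh (L s)
      continuous_toFun := by fun_prop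
      source' := by rw [h0, cosh_basePt, mul_zero]
      target' := by rw [h1, cosh_basePt, mul_zero] }
  refine ⟨γ, hasMonodromy_of_lift (fun s => ?_) L (fun s => rfl) h0 h1⟩
  change 2 * cosh (L s) ∈ Y
  rw [two_cosh_mem_Y]
  rcases s.2.1.eq_or_lt with hs0 | hs0
  · rw [show s = 0 from Subtype.ext hs0.symm, h0, sinh_basePt]; simp
  rcases s.2.2.eq_or_lt with hs1 | hs1
  · rw [show s = 1 from Subtype.ext hs1, h1, sinh_basePt]
    exact mul_ne_zero (zpow_ne_zero _ (by norm_num)) I_ne_zero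
  intro hs
  have hpos : 0 < Real.sin (Real.pi * s) :=
    Real.sin_pos_of_pos_of_lt_pi (by positivity) (by nlinarith [Real.pi_pos])
  have hexp : exp (2 * L s) = 1 := by
    have h1 := exp_add (L s) (L s)
    have h2 : exp (L s) = exp (-L s) := by rw [← cosh_add_sinh, ← cosh_sub_sinh, hs]; ring
    rw [two_mul, h1]
    nth_rewrite 2 [h2]
    rw [← exp_add, add_neg_cancel, exp_zero]
  have := congrArg norm hexp
  rw [norm_exp, norm_one, Real.exp_eq_one_iff] at this
  have hre : (L s).re = Real.sin (Real.pi * s) := by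
    simp only [L, ContinuousMap.coe_mk, add_re, ofReal_re, mul_re, ofReal_im, I_re, I_im]
    ring
  have h2 : (2 * L s).re = 2 * (L s).re := by simp
  rw [h2, hre] at this
  linarith

theorem setOf_hasMonodromy : {N | ∃ γ : Path (0 : ℂ) 0, HasMonodromy Y sys γ initialFlat N} =
    (Subgroup.closure {Nm2, N2, Ninf} : Set (GL (Fin 2) ℂ)) := by
  rw [← range_Nk]
  apply Set.Subset.antisymm
  · rintro N ⟨γ, hN⟩
    obtain ⟨k, -, hu⟩ := exists_hasMonodromy_Nk hN.1
    exact ⟨k, (hu N hN).symm⟩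
  · rintro _ ⟨k, rfl⟩
    exact exists_path_hasMonodromy_Nk k

/-! ### Lifts of the loops around -2 and 2 -/

open Monodromy Complex

/-- `exp (log z / 2)` is a square root with positive real part on the right half plane. -/
theorem exp_log_div_two_sq {z : ℂ} (hz : z ≠ 0) : exp (log z / 2) ^ 2 = z := by
  rw [← exp_nat_mul, show ((2 : ℕ) : ℂ) * (log z / 2) = log z by push_cast; ring, exp_log hz]

theorem re_exp_log_div_two_pos {z : ℂ} (hz : 0 < z.re) : 0 < (exp (log z / 2)).re := by
  rw [exp_re]
  refine mul_pos (Real.exp_pos _) (Real.cos_pos_of_mem_Ioo ?_)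
  have h := abs_lt.1 (abs_arg_lt_pi_div_two_iff.2 (Or.inl hz))
  have : (log z / 2).im = z.arg / 2 := by simp [log_im]
  rw [this]
  constructor <;> linarith [Real.pi_pos]

/-- The square root of `1 - ζ² = 1 - e^{2πis} / 2`. -/
def rootAlong (s : unitInterval) : ℂ := exp (log (1 - exp (2 * Real.pi * I * (s : ℝ)) / 2) / 2)

/-- The function `e^{πis} / √2`. -/
def zetaAlong (s : unitInterval) : ℂ := exp (Real.pi * I * (s : ℝ)) * (√2 / 2 : ℝ)

theorem re_one_sub_pos (s : unitInterval) :
    0 < (1 - exp (2 * Real.pi * I * (s : ℝ)) / 2).re := by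
  have h : ‖exp (2 * Real.pi * I * (s : ℝ)) / 2‖ = 1 / 2 := by
    rw [norm_div, show (2 * Real.pi * I * (s : ℝ) : ℂ) = ((2 * Real.pi * s : ℝ) : ℂ) * I by
      push_cast; ring, norm_exp_ofReal_mul_I]
    simp
  have := (abs_le.1 (abs_re_le_norm (exp (2 * Real.pi * I * (s : ℝ)) / 2))).2
  rw [h] at this
  rw [sub_re, one_re]
  linarith

theorem rootAlong_sq (s : unitInterval) :
    rootAlong s ^ 2 = 1 - exp (2 * Real.pi * I * (s : ℝ)) / 2 :=
  exp_log_div_two_sq fun h => by have := re_one_sub_pos s; rw [h] at this; simp at this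

theorem zetaAlong_sq (s : unitInterval) :
    zetaAlong s ^ 2 = exp (2 * Real.pi * I * (s : ℝ)) / 2 := by
  have h : ((√2 / 2 : ℝ) : ℂ) ^ 2 = 1 / 2 := by
    rw [← ofReal_pow, div_pow, Real.sq_sqrt (by norm_num)]; norm_num
  rw [zetaAlong, mul_pow, h, ← exp_nat_mul]
  rw [show (((2 : ℕ) : ℂ) * (Real.pi * I * (s : ℝ))) = 2 * Real.pi * I * (s : ℝ) by push_cast; ring]
  ring

theorem re_rootAlong_pos (s : unitInterval) : 0 < (rootAlong s).re :=
  re_exp_log_div_two_pos (re_one_sub_pos s)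

@[fun_prop] theorem continuous_rootAlong : Continuous rootAlong := by
  unfold rootAlong
  refine continuous_exp.comp (Continuous.div_const (Continuous.clog (by fun_prop) fun s => ?_) 2)
  exact Or.inl (re_one_sub_pos s)

@[fun_prop] theorem continuous_zetaAlong : Continuous zetaAlong := by
  unfold zetaAlong; fun_prop

/-- With ζ = `zetaAlong s` and ρ = `rootAlong s`, the loop around -2 is y = -2 + 4ζ², so cosh(l/2) =
ζ and the factors are e^(±l/2). On the loop around 2, y = 2 - 4ζ², the roles change: cosh(l/2) = ρ
and sinh(l/2) = iζ. -/
theorem zeta_mul (s : unitInterval) :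
    (zetaAlong s + I * rootAlong s) * (zetaAlong s - I * rootAlong s) = 1 := by
  linear_combination zetaAlong_sq s + rootAlong_sq s - rootAlong s ^ 2 * I_sq

theorem zeta_mul' (s : unitInterval) :
    (rootAlong s + I * zetaAlong s) * (rootAlong s - I * zetaAlong s) = 1 := by
  linear_combination zetaAlong_sq s + rootAlong_sq s - zetaAlong s ^ 2 * I_sq

theorem mem_slitPlane_of_mul_eq_one {a b : ℂ} (h : a * b = 1)
    (h' : ∀ r : ℝ, 0 < r → a = -r → b = -r⁻¹ → False) : a ∈ slitPlane := by
  rw [mem_slitPlane_iff]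
  by_contra! hc
  have ha : a = a.re := Complex.ext rfl (by simp [hc.2])
  have h0 : a.re ≠ 0 := fun h0 => by rw [ha, h0] at h; simp at h
  refine h' (-a.re) (by have := lt_of_le_of_ne hc.1 h0; linarith) (by rw [ha]; simp) ?_
  rw [eq_inv_of_mul_eq_one_right h]
  nth_rewrite 1 [ha]
  push_cast
  rw [inv_neg, neg_neg]

theorem two_cosh_two_mul_log {a b : ℂ} (h : a * b = 1) :
    2 * cosh (2 * log a) = a ^ 2 + b ^ 2 := by
  have h0 := left_ne_zero_of_mul_eq_one h
  rw [cosh, exp_neg, show 2 * log a = ((2 : ℕ) : ℂ) * log a by push_cast; ring, exp_nat_mul,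
    exp_log h0, eq_inv_of_mul_eq_one_right h, inv_pow]
  ring

theorem rootAlong_zero : rootAlong 0 = (√2 / 2 : ℝ) := by
  have h : rootAlong 0 = (Real.exp (Real.log (1 / 2) / 2) : ℝ) := by
    rw [rootAlong, ofReal_exp, ofReal_div, ofReal_log (by norm_num)]
    simp; norm_num
  rw [h]; congr 1
  rw [Real.exp_half, Real.exp_log (by norm_num), Real.sqrt_div (by norm_num)]
  field_simp; simp

theorem rootAlong_one : rootAlong 1 = (√2 / 2 : ℝ) := by
  rw [← rootAlong_zero, rootAlong, rootAlong]
  simp [exp_two_pi_mul_I]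

theorem zetaAlong_zero : zetaAlong 0 = (√2 / 2 : ℝ) := by simp [zetaAlong]

theorem zetaAlong_one : zetaAlong 1 = -(√2 / 2 : ℝ) := by simp [zetaAlong, exp_pi_mul_I]

theorem log_of_angle (θ : ℝ) (h : θ ∈ Set.Ioc (-Real.pi) Real.pi) {a : ℂ}
    (ha : a = Real.cos θ + Real.sin θ * I) : log a = θ * I := by
  rw [ha, ofReal_cos, ofReal_sin, ← exp_mul_I, log_exp] <;> simp [h.1, h.2]

theorem hasMonodromy_loopm2 : HasMonodromy Y sys loopm2 initialFlat Nm2 := by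
  have hslit : ∀ s, zetaAlong s + I * rootAlong s ∈ slitPlane := fun s =>
    mem_slitPlane_of_mul_eq_one (zeta_mul s) fun r hr h1 h2 => by
      have h3 := re_rootAlong_pos s
      -- If e^(l/2) were a negative real, then ρ would be purely imaginary, contrary to Re ρ > 0. So
      -- the principal logarithm is continuous along the whole loop.
      have h4 : rootAlong s = I * ((r - r⁻¹) / 2 : ℝ) := by
        rw [ofReal_inv] at h2
        push_cast
        linear_combination -I / 2 * (h1 - h2) + rootAlong s * I_sq
      rw [h4] at h3
      simp only [mul_re, I_re, I_im, ofReal_re, ofReal_im] at h3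
      linarith
  have hval : ∀ s, loopm2 s = -2 + 2 * exp (2 * Real.pi * I * (s : ℝ)) := fun s => by
    change (-2 : ℂ) + (0 - -2) * _ = _
    ring
  let L : C(unitInterval, ℂ) := ⟨fun s => 2 * log (zetaAlong s + I * rootAlong s),
    continuous_const.mul (Continuous.clog (by fun_prop) hslit)⟩
  have hL : ∀ s, 2 * cosh (L s) = loopm2 s := fun s => by
    change 2 * cosh (2 * log _) = _
    rw [two_cosh_two_mul_log (zeta_mul s), hval]
    linear_combination 2 * zetaAlong_sq s - 2 * rootAlong_sq s + 2 * rootAlong s ^ 2 * I_sq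
  rw [← Nk_one]
  refine hasMonodromy_of_lift (fun s => ?_) L hL ?_ ?_
  · rw [hval]
    have hn : ‖exp (2 * Real.pi * I * (s : ℝ))‖ = 1 := by
      rw [show (2 * Real.pi * I * (s : ℝ) : ℂ) = ((2 * Real.pi * s : ℝ) : ℂ) * I by
        push_cast; ring, norm_exp_ofReal_mul_I]
    simp only [Y, Set.mem_compl_iff, Set.mem_insert_iff, Set.mem_singleton_iff]
    rintro (h | h)
    · rw [show exp (2 * Real.pi * I * (s : ℝ)) = 2 by linear_combination h / 2] at hn
      norm_num at hn
    · rw [show exp (2 * Real.pi * I * (s : ℝ)) = 0 by linear_combination h / 2] at hn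
      norm_num at hn
  · change 2 * log _ = _
    rw [log_of_angle (Real.pi / 4) ⟨by linarith [Real.pi_pos], by linarith [Real.pi_pos]⟩
      (by rw [zetaAlong_zero, rootAlong_zero, Real.cos_pi_div_four, Real.sin_pi_div_four]; ring)]
    simp only [basePt]; push_cast; ring
  -- Here e^(l/2) has moved from e^(πi/4) to e^(3πi/4), so l ends at 3πi/2 = `basePt 1`.
  · change 2 * log _ = _
    rw [log_of_angle (Real.pi - Real.pi / 4)
      ⟨by linarith [Real.pi_pos], by linarith [Real.pi_pos]⟩
      (by rw [zetaAlong_one, rootAlong_one, Real.cos_pi_sub, Real.sin_pi_sub,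
            Real.cos_pi_div_four, Real.sin_pi_div_four]; push_cast; ring)]
    simp only [basePt]; push_cast; ring

theorem hasMonodromy_loop2 : HasMonodromy Y sys loop2 initialFlat N2 := by
  have hslit : ∀ s, rootAlong s + I * zetaAlong s ∈ slitPlane := fun s =>
    mem_slitPlane_of_mul_eq_one (zeta_mul' s) fun r hr h1 h2 => by
      have h3 := re_rootAlong_pos s
      have h4 : rootAlong s = ((-r - r⁻¹) / 2 : ℝ) := by
        rw [ofReal_inv] at h2
        push_cast
        linear_combination (h1 + h2) / 2
      rw [h4, ofReal_re] at h3
      have := inv_pos.2 hr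
      linarith
  have hval : ∀ s, loop2 s = 2 - 2 * exp (2 * Real.pi * I * (s : ℝ)) := fun s => by
    change (2 : ℂ) + (0 - 2) * _ = _
    ring
  let L : C(unitInterval, ℂ) := ⟨fun s => 2 * log (rootAlong s + I * zetaAlong s),
    continuous_const.mul (Continuous.clog (by fun_prop) hslit)⟩
  have hL : ∀ s, 2 * cosh (L s) = loop2 s := fun s => by
    change 2 * cosh (2 * log _) = _
    rw [two_cosh_two_mul_log (zeta_mul' s), hval]
    linear_combination 2 * rootAlong_sq s - 2 * zetaAlong_sq s + 2 * zetaAlong s ^ 2 * I_sq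
  rw [← Nk_neg_one]
  refine hasMonodromy_of_lift (fun s => ?_) L hL ?_ ?_
  · rw [hval]
    have hn : ‖exp (2 * Real.pi * I * (s : ℝ))‖ = 1 := by
      rw [show (2 * Real.pi * I * (s : ℝ) : ℂ) = ((2 * Real.pi * s : ℝ) : ℂ) * I by
        push_cast; ring, norm_exp_ofReal_mul_I]
    simp only [Y, Set.mem_compl_iff, Set.mem_insert_iff, Set.mem_singleton_iff]
    rintro (h | h)
    · rw [show exp (2 * Real.pi * I * (s : ℝ)) = 0 by linear_combination -h / 2] at hn
      norm_num at hn
    · rw [show exp (2 * Real.pi * I * (s : ℝ)) = 2 by linear_combination -h / 2] at hn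
      norm_num at hn
  · change 2 * log _ = _
    rw [log_of_angle (Real.pi / 4) ⟨by linarith [Real.pi_pos], by linarith [Real.pi_pos]⟩
      (by rw [zetaAlong_zero, rootAlong_zero, Real.cos_pi_div_four, Real.sin_pi_div_four]; ring)]
    simp only [basePt]; push_cast; ring
  -- The other loop brings e^(l/2) from e^(πi/4) to e^(-πi/4), so l ends at -πi/2 = `basePt (-1)`.
  · change 2 * log _ = _
    rw [log_of_angle (-(Real.pi / 4))
      ⟨by linarith [Real.pi_pos], by linarith [Real.pi_pos]⟩
      (by rw [zetaAlong_one, rootAlong_one, Real.cos_neg, Real.sin_neg,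
            Real.cos_pi_div_four, Real.sin_pi_div_four]; push_cast; ring)]
    simp only [basePt]; push_cast; ring

/-! ### The lift of the loop around infinity -/

open Monodromy Complex

/-- The lifts of the segment from `0` to `4i`. -/
def segLift (k : ℤ) : Path (basePt k) (basePt k + (Real.arsinh 2 : ℝ)) where
  toFun s := basePt k + (Real.arsinh (2 * s) : ℝ)
  continuous_toFun := by
    have : Continuous fun s : unitInterval => Real.arsinh (2 * s) :=
      Real.continuous_arsinh.comp (by fun_prop)
    fun_prop
  source' := by simp
  target' := by simp

theorem two_cosh_segLift {k : ℤ} (hk : Even k) (s : unitInterval) :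
    2 * cosh (segLift k s) = seg 0 (4 * I) s := by
  change 2 * cosh (basePt k + (Real.arsinh (2 * s) : ℝ)) = 0 + ((s : ℝ) : ℂ) * (4 * I - 0)
  rw [cosh_add, cosh_basePt, sinh_basePt, hk.neg_one_zpow, ← ofReal_sinh, Real.sinh_arsinh]
  push_cast
  ring

/-- The square root of `1 - 4 / y²` along the circle `|y| = 4`. -/
def rootInf (s : unitInterval) : ℂ := exp (log (1 + exp (-(4 * Real.pi * I * (s : ℝ))) / 4) / 2)

theorem re_one_add_pos (s : unitInterval) :
    0 < (1 + exp (-(4 * Real.pi * I * (s : ℝ))) / 4).re := by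
  have h : ‖exp (-(4 * Real.pi * I * (s : ℝ))) / 4‖ = 1 / 4 := by
    rw [norm_div, show (-(4 * Real.pi * I * (s : ℝ)) : ℂ) = ((-(4 * Real.pi * s) : ℝ) : ℂ) * I by
      push_cast; ring, norm_exp_ofReal_mul_I]
    simp
  have := (abs_le.1 (abs_re_le_norm (exp (-(4 * Real.pi * I * (s : ℝ))) / 4))).1
  rw [h] at this
  rw [add_re, one_re]
  linarith

theorem rootInf_sq (s : unitInterval) :
    rootInf s ^ 2 = 1 + exp (-(4 * Real.pi * I * (s : ℝ))) / 4 :=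
  exp_log_div_two_sq fun h => by have := re_one_add_pos s; rw [h] at this; simp at this

theorem one_add_rootInf_mem (s : unitInterval) : (1 + rootInf s) / 2 ∈ slitPlane := by
  left
  have := re_exp_log_div_two_pos (re_one_add_pos s)
  have h : ((1 + rootInf s) / 2).re = (1 + (rootInf s).re) / 2 := by simp
  rw [h]
  change 0 < (rootInf s).re at this
  linarith

theorem continuous_rootInf : Continuous rootInf := by
  unfold rootInf
  refine continuous_exp.comp (Continuous.div_const (Continuous.clog (by fun_prop) fun s => ?_) 2)
  exact Or.inl (re_one_add_pos s)

/-- The hypothesis holds at both ends of the circle, where y² = -16 and the root is √5/2; then 4 ·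
(1 + √5/2)/2 = 2 + √5 = e^(arsinh 2). This glues the lifted circle to the lifted segments. -/
theorem log_one_add_rootInf {s : unitInterval} (hs : exp (-(4 * Real.pi * I * (s : ℝ))) = 1) :
    log 4 + log ((1 + rootInf s) / 2) = (Real.arsinh 2 : ℝ) := by
  have h : rootInf s = (√5 / 2 : ℝ) := by
    have : rootInf s = (Real.exp (Real.log (5 / 4) / 2) : ℝ) := by
      rw [rootInf, ofReal_exp, ofReal_div, ofReal_log (by norm_num), hs]
      push_cast; norm_num
    rw [this, Real.exp_half, Real.exp_log (by norm_num), Real.sqrt_div (by norm_num),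
      show (4 : ℝ) = 2 ^ 2 by norm_num, Real.sqrt_sq (by norm_num)]
  have h4 : log 4 = (Real.log 4 : ℝ) := by rw [ofReal_log (by norm_num)]; norm_num
  have hb : log ((1 + rootInf s) / 2) = (Real.log ((1 + √5 / 2) / 2) : ℝ) := by
    rw [ofReal_log (by positivity), h]; push_cast; ring_nf
  rw [h4, hb, ← ofReal_add, ← Real.log_mul (by norm_num) (by positivity), Real.arsinh]
  congr 2
  norm_num
  ring

/-- The lift of the circle around infinity. -/
def circleLift : Path (basePt (-2) + (Real.arsinh 2 : ℝ)) (basePt 0 + (Real.arsinh 2 : ℝ)) where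
  toFun s := basePt (-2) + 2 * Real.pi * I * (s : ℝ) + (log 4 + log ((1 + rootInf s) / 2))
  continuous_toFun := by
    have h := continuous_rootInf
    have : Continuous fun s => log ((1 + rootInf s) / 2) :=
      Continuous.clog (by fun_prop) one_add_rootInf_mem
    fun_prop
  source' := by rw [log_one_add_rootInf] <;> simp
  target' := by
    rw [log_one_add_rootInf]
    · simp [basePt]; ring
    · rw [show (-(4 * Real.pi * I * ((1 : unitInterval) : ℝ)) : ℂ)
        = (-2 : ℤ) * (2 * Real.pi * I) by simp; ring, exp_int_mul_two_pi_mul_I]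

/-- With y = 4i e^(2πis), the lift solves e^l = y (1 + √(1 - 4/y²))/2. The root stays in the right
half plane, so only y winds, and l grows by exactly 2πi, two steps of `basePt`. -/
theorem two_cosh_circleLift (s : unitInterval) :
    2 * cosh (circleLift s) = circle 0 (4 * I) s := by
  set e := exp (2 * Real.pi * I * (s : ℝ)) with he
  have he' : exp (-(4 * Real.pi * I * (s : ℝ))) = (e ^ 2)⁻¹ := by
    rw [he, ← exp_nat_mul, ← exp_neg]; congr 1; push_cast; ring
  have he0 : e ≠ 0 := exp_ne_zero _
  have hb0 : (1 + rootInf s) / 2 ≠ 0 := slitPlane_ne_zero (one_add_rootInf_mem s)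
  have hq := rootInf_sq s
  rw [he'] at hq
  have hbase : exp (basePt (-2)) = I := by
    rw [← cosh_add_sinh, cosh_basePt, sinh_basePt]; simp
  have hexp : exp (circleLift s) = 4 * I * e * ((1 + rootInf s) / 2) := by
    change exp (basePt (-2) + 2 * Real.pi * I * (s : ℝ) + (log 4 + log ((1 + rootInf s) / 2))) = _
    rw [exp_add, exp_add, exp_add, exp_log hb0, exp_log (by norm_num), hbase]
    ring
  change _ = (0 : ℂ) + (4 * I - 0) * e
  rw [cosh, exp_neg, hexp]
  have hI := I_ne_zero
  have hb1 : 1 + rootInf s ≠ 0 := fun h => hb0 (by rw [h, zero_div])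
  have hI2 := I_sq
  field_simp
  field_simp at hq
  grind

theorem hasMonodromy_loopInf : HasMonodromy Y sys loopInf initialFlat Ninf := by
  -- The circle is run clockwise, so its lift is reversed and descends from the sheet of `basePt 0`
  -- to that of `basePt (-2)`.
  let P := (segLift 0).trans (circleLift.symm.trans (segLift (-2)).symm)
  let L : C(unitInterval, ℂ) := P.toContinuousMap
  have hL : ∀ s, 2 * cosh (L s) = loopInf s := fun s => by
    change 2 * cosh (P s) = loopInf s
    simp only [P, loopInf, Path.trans_apply, Path.symm_apply]
    split_ifs
    · exact two_cosh_segLift (by decide) _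
    · exact two_cosh_circleLift _
    · exact two_cosh_segLift (by decide) _
  rw [← Nk_neg_two]
  refine hasMonodromy_of_lift (fun s => ?_) L hL P.source P.target
  have key1 : ∀ s : unitInterval, seg 0 (4 * I) s ∈ Y := fun s => by
    change (0 : ℂ) + ((s : ℝ) : ℂ) * (4 * I - 0) ∈ Y
    simp only [Y, Set.mem_compl_iff, Set.mem_insert_iff, Set.mem_singleton_iff]
    rintro (h | h) <;> · have := congrArg re h; norm_num at this
  have key2 : ∀ s : unitInterval, circle 0 (4 * I) s ∈ Y := fun s => by
    have hn : ‖circle 0 (4 * I) s‖ = 4 := by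
      change ‖(0 : ℂ) + (4 * I - 0) * exp (2 * Real.pi * I * (s : ℝ))‖ = 4
      rw [show (2 * Real.pi * I * (s : ℝ) : ℂ) = ((2 * Real.pi * s : ℝ) : ℂ) * I by
        push_cast; ring, zero_add, norm_mul, norm_exp_ofReal_mul_I]
      simp
    simp only [Y, Set.mem_compl_iff, Set.mem_insert_iff, Set.mem_singleton_iff]
    rintro (h | h) <;> · rw [h] at hn; norm_num at hn
  simp only [loopInf, Path.trans_apply, Path.symm_apply]
  split_ifs
  exacts [key1 _, key2 _, key1 _]

/-! ### Eigenvalues of the residues -/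

theorem charpoly_roots {a b c d r s : ℂ} (h : a + d = r + s) (h' : a * d - b * c = r * s) :
    (!![a, b; c, d] : Matrix (Fin 2) (Fin 2) ℂ).charpoly.roots = {r, s} := by
  have : (!![a, b; c, d] : Matrix (Fin 2) (Fin 2) ℂ).charpoly
      = (Polynomial.X - Polynomial.C r) * (Polynomial.X - Polynomial.C s) := by
    rw [Matrix.charpoly_fin_two]
    simp only [Matrix.trace_fin_two_of, Matrix.det_fin_two_of, h, h', Polynomial.C_add,
      Polynomial.C_mul]
    ring
  rw [this, Polynomial.roots_mul (mul_ne_zero (Polynomial.X_sub_C_ne_zero _)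
    (Polynomial.X_sub_C_ne_zero _)), Polynomial.roots_X_sub_C, Polynomial.roots_X_sub_C]
  rfl

theorem Ainf_eq : Ainf = !![-1, 0; 6, -2] := by
  ext i j
  fin_cases i <;> fin_cases j <;> norm_num [Ainf, A2, Am2]

end OneHoledTorus

/-! ### Derivations of localizations -/

section Localization

variable {k P S : Type*} [CommRing k] [CommRing P] [CommRing S] [Algebra k P] [Algebra k S]
  [Algebra P S] [IsScalarTower k P S] (M : Submonoid P) [IsLocalization M S]

-- Localizations are formally étale, so S ⊗ Ω_P ≅ Ω_S. A derivation of P is a linear map on Ω_P and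
-- extends by base change.
include M in
theorem Derivation.exists_extend_localization (D : Derivation k P P) :
    ∃ D' : Derivation k S S, ∀ f, D' (algebraMap P S f) = algebraMap P S (D f) := by
  have := Algebra.FormallyEtale.of_isLocalization (Rₘ := S) M
  let e := KaehlerDifferential.tensorKaehlerEquivOfFormallyEtale k P S
  let l : S ⊗[P] Ω[P⁄k] →ₗ[S] S :=
    LinearMap.liftBaseChange S ((Algebra.linearMap P S).comp D.liftKaehlerDifferential)
  refine ⟨(l.comp e.symm.toLinearMap).compDer (KaehlerDifferential.D k S), fun f => ?_⟩
  have h : e.symm (KaehlerDifferential.D k S (algebraMap P S f))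
      = 1 ⊗ₜ KaehlerDifferential.D k P f := by
    rw [LinearEquiv.symm_apply_eq]
    simp [e, KaehlerDifferential.tensorKaehlerEquivOfFormallyEtale_apply]
  exact (congrArg l h).trans (by simp [l])

omit [Algebra k P] [IsScalarTower k P S] in
include M in
theorem Derivation.ext_localization {N : Type*} [AddCommGroup N] [Module k N] [Module S N]
    {D₁ D₂ : Derivation k S N} (h : ∀ f, D₁ (algebraMap P S f) = D₂ (algebraMap P S f)) :
    D₁ = D₂ := by
  ext a
  obtain ⟨⟨p, s⟩, hs⟩ := IsLocalization.surj M a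
  have h1 := congrArg D₁ hs
  have h2 := congrArg D₂ hs
  simp only [Derivation.leibniz, h] at h1 h2
  have h3 := (h1.trans h2.symm)
  rw [add_right_inj] at h3
  exact (IsLocalization.map_units S s).smul_left_cancel.1 h3

end Localization

/-! ### Vector fields on X and Y, and the smoothness of t -/

namespace OneHoledTorus

theorem exists_partial (i : Fin 3) : ∃ D : Derivation ℂ OX OX, ∀ f,
    D (algebraMap (MvPolynomial (Fin 3) ℂ) OX f) = algebraMap _ OX (MvPolynomial.pderiv i f) :=
  Derivation.exists_extend_localization (Submonoid.powers (Polynomial.aeval t psi)) _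

/-- The partial derivatives on `X`. -/
def dX (i : Fin 3) : Derivation ℂ OX OX := (exists_partial i).choose

theorem dX_x (i j : Fin 3) : dX i (x j) = if j = i then 1 else 0 := by
  rw [x, dX, (exists_partial i).choose_spec, MvPolynomial.pderiv_X]
  by_cases h : j = i <;> simp [h, Pi.single_apply]

theorem exists_dY : ∃ D : Derivation ℂ OY OY, ∀ f,
    D (algebraMap (Polynomial ℂ) OY f) = algebraMap _ OY (Polynomial.derivative' f) :=
  Derivation.exists_extend_localization (Submonoid.powers psi) _

/-- The derivation `d / dy`. -/
def dY : Derivation ℂ OY OY := exists_dY.choose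

theorem dY_y : dY y = 1 := by
  rw [y, dY, exists_dY.choose_spec]; simp

theorem derivation_OX_ext {N : Type*} [AddCommGroup N] [Module ℂ N] [Module OX N]
    [IsScalarTower ℂ OX N] {D₁ D₂ : Derivation ℂ OX N} (h : ∀ i, D₁ (x i) = D₂ (x i)) :
    D₁ = D₂ := by
  refine Derivation.ext_localization (Submonoid.powers (Polynomial.aeval t psi)) fun f => ?_
  let _ : Module (MvPolynomial (Fin 3) ℂ) N := Module.compHom N (algebraMap _ OX)
  have : IsScalarTower (MvPolynomial (Fin 3) ℂ) OX N := ⟨fun a b c => by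
    rw [Algebra.smul_def, mul_smul]; rfl⟩
  have : D₁.compAlgebraMap (MvPolynomial (Fin 3) ℂ) = D₂.compAlgebraMap _ :=
    MvPolynomial.derivation_ext h
  exact congrArg (fun D => D f) this

theorem derivation_OY_ext {N : Type*} [AddCommGroup N] [Module ℂ N] [Module OY N]
    [IsScalarTower ℂ OY N] {D₁ D₂ : Derivation ℂ OY N} (h : D₁ y = D₂ y) :
    D₁ = D₂ := by
  refine Derivation.ext_localization (Submonoid.powers psi) fun f => ?_
  let _ : Module (Polynomial ℂ) N := Module.compHom N (algebraMap _ OY)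
  have : IsScalarTower (Polynomial ℂ) OY N := ⟨fun a b c => by
    rw [Algebra.smul_def, mul_smul]; rfl⟩
  have : D₁.compAlgebraMap (Polynomial ℂ) = D₂.compAlgebraMap _ :=
    Polynomial.derivation_ext h
  exact congrArg (fun D => D f) this

/-- The function `t` on `X`. -/
def tX : OX := algebraMap _ OX t

theorem tX_eq : tX = -2 + x 0 ^ 2 + x 1 ^ 2 - x 0 * x 1 * x 2 + x 2 ^ 2 := by
  have h2 : algebraMap (MvPolynomial (Fin 3) ℂ) OX 2 = 2 := map_ofNat _ 2
  simp [tX, t, x, h2]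

theorem algebraMap_algebraMap (f : Polynomial ℂ) :
    algebraMap OY OX (algebraMap (Polynomial ℂ) OY f) = algebraMap _ OX (Polynomial.aeval t f) := by
  change pullback _ = _
  rw [pullback, IsLocalization.Away.lift_eq]
  rfl

theorem algebraMap_y : algebraMap OY OX y = tX := by
  rw [y, algebraMap_algebraMap, Polynomial.aeval_X, tX]

theorem isUnit_y_sq_sub : IsUnit ((y - 2) * (y + 2)) := by
  have h := IsLocalization.Away.algebraMap_isUnit (S := OY) psi
  have : algebraMap (Polynomial ℂ) OY psi = (y - 2) * (y + 2) := by
    have h4 : algebraMap (Polynomial ℂ) OY 4 = 4 := map_ofNat _ 4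
    simp only [psi, y, map_sub, map_pow, h4]; ring
  rwa [this] at h

theorem u_mul : u * (y - 2) = 1 :=
  Ring.inverse_mul_cancel _ (isUnit_of_mul_isUnit_left isUnit_y_sq_sub)

theorem v_mul : v * (y + 2) = 1 :=
  Ring.inverse_mul_cancel _ (isUnit_of_mul_isUnit_right isUnit_y_sq_sub)

/-- The partial derivatives of `t`. -/
def gradT (i : Fin 3) : OX := 2 * x i - x (i + 1) * x (i + 2)

theorem dX_tX (i : Fin 3) : dX i tX = gradT i := by
  rw [tX_eq]
  have h2 : ∀ i, dX i 2 = 0 := fun i => Derivation.map_natCast (dX i) 2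
  fin_cases i <;> simp [dX_x, gradT, Derivation.leibniz, Derivation.leibniz_pow, h2] <;> ring

theorem dX_algebraMap (i : Fin 3) (c : OY) :
    dX i (algebraMap OY OX c) = algebraMap OY OX (dY c) * gradT i := by
  have : (dX i).compAlgebraMap OY = (gradT i • (Algebra.linearMap OY OX)).compDer dY := by
    apply derivation_OY_ext
    simp [algebraMap_y, dX_tX, dY_y]
  have := congrArg (fun D => D c) this
  simpa [mul_comm] using this

/-- The gradient ideal of t contains 4(t² - 4), a unit on X. The coefficients in the proof are an
explicit certificate of this membership. -/
theorem exists_sum_mul_gradT : ∃ w : Fin 3 → OX, ∑ i, w i * gradT i = 1 := by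
  have h : ∃ w : Fin 3 → OX, ∑ i, w i * gradT i = 4 * ((tX - 2) * (tX + 2)) := by
    let e : OX := 4 * x 0 ^ 2 - 8 + x 1 * gradT 1 + x 2 * gradT 2
    refine ⟨![-8 * x 0 + 2 * x 0 ^ 3, -2 * x 0 ^ 2 * x 1 + x 1 * e, -4 * x 0 * x 1 + x 2 * e], ?_⟩
    simp only [Fin.sum_univ_three, tX_eq, e, gradT, Matrix.cons_val, Fin.isValue, Fin.reduceAdd]
    ring
  have hu : IsUnit (4 * ((tX - 2) * (tX + 2))) := by
    have := isUnit_y_sq_sub.map (algebraMap OY OX)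
    have h2 : algebraMap OY OX 2 = 2 := map_ofNat _ 2
    rw [map_mul, map_sub, map_add, algebraMap_y, h2] at this
    have h4 : algebraMap ℂ OX 4 = 4 := map_ofNat _ 4
    exact (h4 ▸ (IsUnit.mk0 (4 : ℂ) (by norm_num)).map (algebraMap ℂ OX)).mul this
  obtain ⟨w, hw⟩ := h
  obtain ⟨z, hz⟩ := hu.exists_right_inv
  refine ⟨fun i => z * w i, ?_⟩
  rw [← hz, ← hw, Finset.sum_mul]
  exact Finset.sum_congr rfl fun i _ => by ring

open DeRham

/-! ### Differential forms in coordinates -/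

section Forms

variable (R : Type*) [CommRing R] [Algebra R OX]

/-- The coordinate one-forms. -/
def dx (i : Fin 3) : Forms R OX := dFun R OX (x i)

/-- The coordinate two-forms. -/
def dx2 (k : Fin 3) : Forms R OX := dx R (k + 1) * dx R (k + 2)

/-- The coordinate three-form. -/
def vol : Forms R OX := dx R 0 * dx R 1 * dx R 2

/-- The one-form with the coefficients `W`. -/
def form1 (W : Fin 3 → OX) : Forms R OX := ∑ i, W i • dx R i

/-- The two-form with the coefficients `V`. -/
def form2 (V : Fin 3 → OX) : Forms R OX := ∑ k, V k • dx2 R k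

theorem dx_mul_self (i : Fin 3) : dx R i * dx R i = 0 := ExteriorAlgebra.ι_sq_zero _

theorem dx_mul_comm (i j : Fin 3) : dx R i * dx R j = -(dx R j * dx R i) :=
  eq_neg_of_add_eq_zero_left (ExteriorAlgebra.ι_add_mul_swap _ _)

theorem form1_mul_form1 (V W : Fin 3 → OX) : form1 R V * form1 R W =
    form2 R fun k => V (k + 1) * W (k + 2) - V (k + 2) * W (k + 1) := by
  have h0 := dx_mul_self R
  have h1 := dx_mul_comm R 1 0
  have h2 := dx_mul_comm R 2 1
  have h3 := dx_mul_comm R 0 2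
  simp only [form1, form2, dx2, Fin.sum_univ_three, Fin.isValue, Fin.reduceAdd, add_mul, mul_add,
    smul_mul_smul_comm, h0, h1, h2, h3, smul_zero, sub_smul, smul_neg]
  abel

theorem dx_mul_dx_mul_self (i : Fin 3) (z : Forms R OX) : dx R i * (dx R i * z) = 0 := by
  rw [← mul_assoc, dx_mul_self, zero_mul]

theorem dx_mul_dx_mul_comm (i j : Fin 3) (z : Forms R OX) :
    dx R i * (dx R j * z) = -(dx R j * (dx R i * z)) := by
  rw [← mul_assoc, dx_mul_comm, neg_mul, mul_assoc]

theorem dx2_mul_dx (k l : Fin 3) : dx2 R k * dx R l = if k = l then vol R else 0 := by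
  fin_cases k <;> fin_cases l <;>
    simp [dx2, vol, mul_assoc, dx_mul_self, dx_mul_dx_mul_self, dx_mul_comm R 1 0,
      dx_mul_comm R 2 0, dx_mul_comm R 2 1, dx_mul_dx_mul_comm R 1 0, dx_mul_dx_mul_comm R 2 0,
      dx_mul_dx_mul_comm R 2 1]

theorem form1_mem (W : Fin 3 → OX) : form1 R W ∈ degForms R OX 1 := by
  change form1 R W ∈ LinearMap.range (ExteriorAlgebra.ι OX) ^ 1
  rw [pow_one]
  exact Submodule.sum_mem _ fun i _ => Submodule.smul_mem _ _ ⟨_, rfl⟩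

theorem form2_mem (V : Fin 3 → OX) : form2 R V ∈ degForms R OX 2 := by
  change form2 R V ∈ LinearMap.range (ExteriorAlgebra.ι OX) ^ 2
  rw [pow_two]
  exact Submodule.sum_mem _ fun i _ => Submodule.smul_mem _ _
    (Submodule.mul_mem_mul ⟨_, rfl⟩ ⟨_, rfl⟩)

theorem form2_add (V W : Fin 3 → OX) : form2 R (V + W) = form2 R V + form2 R W := by
  simp only [form2, Pi.add_apply, add_smul, Finset.sum_add_distrib]

theorem form2_smul (a : OX) (V : Fin 3 → OX) : form2 R (a • V) = a • form2 R V := by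
  simp only [form2, Pi.smul_apply, smul_eq_mul, mul_smul, Finset.smul_sum]

theorem form2_mul_form1 (V W : Fin 3 → OX) :
    form2 R V * form1 R W = (∑ k, V k * W k) • vol R := by
  simp only [form1, form2, Fin.sum_univ_three, add_mul, mul_add, smul_mul_smul_comm, dx2_mul_dx,
    Fin.isValue, Fin.reduceEq, if_true, if_false, smul_zero, add_smul]
  abel

theorem d_dx (i : Fin 3) : d R OX (dx R i) = 0 := d_dFun R OX _

theorem d_dx2 (k : Fin 3) : d R OX (dx2 R k) = 0 := by
  rw [dx2, d_mul, d_dx, d_dx, zero_mul, mul_zero, add_zero]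

theorem dx_mul_comm_dx2 (k l : Fin 3) : dx R l * dx2 R k = dx2 R k * dx R l := by
  rw [dx2, ← mul_assoc, dx_mul_comm R l, neg_mul, mul_assoc, dx_mul_comm R l, mul_neg, neg_neg,
    mul_assoc]

end Forms

section Differential

variable (R : Type*) [CommRing R] [Algebra ℂ R] [Algebra R OX] [IsScalarTower ℂ R OX]

/-- R will be ℂ or O_Y. Either way the universal derivation is ℂ-linear, hence determined by its
values on the coordinates. Over O_Y the dx_i still span, though they are not independent, as dt = 0.
-/
theorem D_eq_sum (f : OX) :
    KaehlerDifferential.D R OX f = ∑ i, dX i f • KaehlerDifferential.D R OX (x i) := by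
  have : (KaehlerDifferential.D R OX).restrictScalars ℂ =
      ∑ i, ((LinearMap.toSpanSingleton OX _ (KaehlerDifferential.D R OX (x i))).compDer (dX i)) := by
    apply derivation_OX_ext
    intro j
    fin_cases j <;> simp [Fin.sum_univ_three, dX_x]
  have := congrArg (fun D => D f) this
  simpa [Fin.sum_univ_three] using this

theorem dFun_eq (f : OX) : dFun R OX f = form1 R fun i => dX i f := by
  rw [dFun, D_eq_sum, map_sum]
  simp only [map_smul]
  rfl

theorem exists_eq_sum (m : Ω[OX⁄R]) :
    ∃ W : Fin 3 → OX, m = ∑ i, W i • KaehlerDifferential.D R OX (x i) := by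
  have hm : m ∈ Submodule.span OX (Set.range fun i => KaehlerDifferential.D R OX (x i)) := by
    have : (⊤ : Submodule OX Ω[OX⁄R]) ≤
        Submodule.span OX (Set.range fun i => KaehlerDifferential.D R OX (x i)) := by
      rw [← KaehlerDifferential.span_range_derivation, Submodule.span_le]
      rintro _ ⟨f, rfl⟩
      rw [D_eq_sum]
      exact Submodule.sum_mem _ fun i _ =>
        Submodule.smul_mem _ _ (Submodule.subset_span ⟨i, rfl⟩)
    exact this trivial
  obtain ⟨W, hW⟩ := (Submodule.mem_span_range_iff_exists_fun OX).1 hm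
  exact ⟨W, hW.symm⟩

theorem exists_eq_form1 (m : Ω[OX⁄R]) : ∃ W, ExteriorAlgebra.ι OX m = form1 R W := by
  obtain ⟨W, rfl⟩ := exists_eq_sum R m
  exact ⟨W, by simp only [map_sum, map_smul]; rfl⟩

theorem mem_degForms_one {η : Forms R OX} (h : η ∈ degForms R OX 1) : ∃ W, η = form1 R W := by
  change η ∈ LinearMap.range (ExteriorAlgebra.ι OX) ^ 1 at h
  rw [pow_one] at h
  obtain ⟨m, rfl⟩ := h
  exact exists_eq_form1 R m

theorem mem_degForms_two {η : Forms R OX} (h : η ∈ degForms R OX 2) : ∃ V, η = form2 R V := by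
  change η ∈ LinearMap.range (ExteriorAlgebra.ι OX) ^ 2 at h
  rw [pow_two] at h
  induction h using Submodule.mul_induction_on' with
  | mem_mul_mem a ha b hb =>
    obtain ⟨m, rfl⟩ := ha
    obtain ⟨n, rfl⟩ := hb
    obtain ⟨V, hV⟩ := exists_eq_form1 R m
    obtain ⟨W, hW⟩ := exists_eq_form1 R n
    exact ⟨_, by rw [hV, hW, form1_mul_form1]⟩
  | add a _ b _ ha hb =>
    obtain ⟨V, rfl⟩ := ha
    obtain ⟨W, rfl⟩ := hb
    exact ⟨_, (form2_add R V W).symm⟩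

/-- The curl of a vector field. -/
def curl (W : Fin 3 → OX) (k : Fin 3) : OX := dX (k + 1) (W (k + 2)) - dX (k + 2) (W (k + 1))

/-- The divergence of a vector field. -/
def div (V : Fin 3 → OX) : OX := ∑ k, dX k (V k)

theorem d_form1 (W : Fin 3 → OX) : d R OX (form1 R W) = form2 R (curl W) := by
  have h : ∀ i, dx R i = form1 R (Pi.single i 1) := fun i => by
    simp [form1, Pi.single_apply]
  have : d R OX (form1 R W) = ∑ i, form1 R (fun j => dX j (W i)) * dx R i := by
    rw [form1, map_sum]
    exact Finset.sum_congr rfl fun i _ => by rw [d_smul, d_dx, smul_zero, add_zero, dFun_eq]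
  rw [this]
  simp only [h, form1_mul_form1]
  simp only [Fin.sum_univ_three, ← form2_add]
  congr 1
  funext k
  fin_cases k <;> simp [curl, Pi.single_apply] <;> ring

theorem d_form2 (V : Fin 3 → OX) : d R OX (form2 R V) = div V • vol R := by
  have : d R OX (form2 R V) = ∑ k, form1 R (fun j => dX j (V k)) * dx2 R k := by
    rw [form2, map_sum]
    exact Finset.sum_congr rfl fun i _ => by rw [d_smul, d_dx2, smul_zero, add_zero, dFun_eq]
  rw [this]
  simp only [form1, Fin.sum_univ_three, div, add_mul, smul_mul_assoc, dx_mul_comm_dx2, dx2_mul_dx,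
    Fin.isValue, Fin.reduceEq, if_true, if_false, smul_zero, add_smul]
  abel

end Differential

end OneHoledTorus

/-! ### The relative two-forms and H² as a quotient of O_X -/

section

open DeRham

/-- The multiples of a form whose multiples are all closed. -/
def DeRham.multiples {R S : Type*} [CommRing R] [CommRing S] [Algebra R S] {n : ℕ}
    (ω : Forms R S) (h : ∀ f : S, f • ω ∈ closedForms R S n) : S →ₗ[R] closedForms R S n where
  toFun f := ⟨f • ω, h f⟩
  map_add' f g := Subtype.ext (add_smul f g ω)
  map_smul' c f := Subtype.ext (smul_assoc c f ω)

/-- The class of the multiples of a form whose multiples are all closed. -/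
def DeRham.classOfMul {R S : Type*} [CommRing R] [CommRing S] [Algebra R S] {n : ℕ}
    (ω : Forms R S) (h : ∀ f : S, f • ω ∈ closedForms R S n) : S →ₗ[R] H R S n :=
  (Submodule.mkQ _).comp (multiples ω h)

section

variable {R S : Type*} [CommRing R] [CommRing S] [Algebra R S] {n : ℕ}

theorem DeRham.classOfMul_apply (ω : Forms R S) (h : ∀ f : S, f • ω ∈ closedForms R S n) (f : S) :
    classOfMul ω h f = H.mk R S (f • ω) (h f) := rfl

theorem DeRham.H.mk_congr {ω ω' : Forms R S} (hω : ω ∈ closedForms R S n) (e : ω = ω') :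
    H.mk R S ω hω = H.mk R S ω' (e ▸ hω) := by
  subst e; rfl

theorem DeRham.H.mk_eq_zero {ω : Forms R S} (hω : ω ∈ closedForms R S n) :
    H.mk R S ω hω = 0 ↔ ω ∈ exactForms R S n := by
  rw [H.mk, Submodule.Quotient.mk_eq_zero]
  rfl

theorem DeRham.H.exists_eq_mk (h : H R S n) :
    ∃ (ω : Forms R S) (hω : ω ∈ closedForms R S n), h = H.mk R S ω hω := by
  obtain ⟨⟨ω, hω⟩, rfl⟩ := Submodule.Quotient.mk_surjective _ h
  exact ⟨ω, hω, rfl⟩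

end

namespace OneHoledTorus

open DeRham

/-- The evaluation of `n`-forms on `n` derivations. -/
def pairing {R : Type*} [CommRing R] [Algebra R OX] {n : ℕ} (D : Fin n → Derivation R OX OX) :
    Forms R OX →ₗ[OX] OX :=
  ExteriorAlgebra.liftAlternating (Pi.single n (Matrix.detRowAlternating.compLinearMap
    (LinearMap.pi fun i => (D i).liftKaehlerDifferential)))

theorem pairing_dFun {R : Type*} [CommRing R] [Algebra R OX] {n : ℕ}
    (D : Fin n → Derivation R OX OX) (f : Fin n → OX) :
    pairing D (List.ofFn fun i => dFun R OX (f i)).prod =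
      (Matrix.of fun i j => D j (f i)).det := by
  have : (List.ofFn fun i => dFun R OX (f i)).prod =
      ExteriorAlgebra.ιMulti OX n fun i => KaehlerDifferential.D R OX (f i) := by
    rw [ExteriorAlgebra.ιMulti_apply]; rfl
  rw [this, pairing, ExteriorAlgebra.liftAlternating_apply_ιMulti, Pi.single_eq_same]
  change Matrix.det _ = _
  congr 1
  ext i j
  simp

theorem vol_smul_injective {a b : OX} (h : a • vol ℂ = b • vol ℂ) : a = b := by
  have h1 : pairing dX (vol ℂ) = 1 := by
    have := pairing_dFun dX x
    simp only [List.ofFn_succ, List.ofFn_zero, List.prod_cons, List.prod_nil, mul_one,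
      ← mul_assoc] at this
    refine Eq.trans this ?_
    rw [← Matrix.det_one (n := Fin 3)]
    congr 1
    ext i j
    simp [dX_x, Matrix.one_apply]
  have := congrArg (pairing dX) h
  simpa [h1] using this

/-- The Hamiltonian vector fields `∇t × ∇`. -/
def ham (k : Fin 3) : Derivation OY OX OX where
  toFun f := gradT (k + 1) * dX (k + 2) f - gradT (k + 2) * dX (k + 1) f
  map_add' f g := by simp only [map_add]; ring
  map_smul' c f := by
    simp only [Algebra.smul_def, Derivation.leibniz, dX_algebraMap, smul_eq_mul, RingHom.id_apply,
      Algebra.algebraMap_self]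
    ring
  map_one_eq_zero' := by simp
  leibniz' f g := by
    simp only [LinearMap.coe_mk, AddHom.coe_mk, Derivation.leibniz, smul_eq_mul]
    ring

theorem ham_x (k j : Fin 3) : ham k (x j) =
    gradT (k + 1) * (if j = k + 2 then 1 else 0) - gradT (k + 2) * (if j = k + 1 then 1 else 0) := by
  rw [← dX_x, ← dX_x]; rfl

/-- Relative two-forms can be evaluated on fields tangent to the fibres, and the Hamiltonian fields
are such. Together with `sum_bezout` this evaluates `leray` to `gradT k`, so that its multiples can
be told apart. -/
theorem pairing_ham (k l : Fin 3) :
    pairing ![ham (k + 1), ham (k + 2)] (dx2 OY l) = gradT l * gradT k := by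
  have := pairing_dFun ![ham (k + 1), ham (k + 2)] ![x (l + 1), x (l + 2)]
  simp only [List.ofFn_succ, List.ofFn_zero, List.prod_cons, List.prod_nil, mul_one] at this
  refine Eq.trans this ?_
  rw [Matrix.det_fin_two]
  fin_cases k <;> fin_cases l <;> simp [ham_x] <;> ring

/-- The coefficients of a relation `∑ w_i ∂_i t = 1`. -/
def bezout : Fin 3 → OX := exists_sum_mul_gradT.choose

theorem sum_bezout : ∑ i, bezout i * gradT i = 1 := exists_sum_mul_gradT.choose_spec

/-- The relative form `dx₁ ∧ dx₂ ∧ dx₃ / dt`. -/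
def leray : Forms OY OX := form2 OY bezout

theorem form1_gradT : form1 OY gradT = 0 := by
  have h : dFun OY OX tX = 0 := by
    rw [← algebraMap_y, dFun, Derivation.map_algebraMap, map_zero]
  rw [dFun_eq] at h
  simpa only [dX_tX] using h

theorem vol_OY : vol OY = 0 := by
  have := form2_mul_form1 OY bezout gradT
  rwa [sum_bezout, form1_gradT, mul_zero, one_smul, eq_comm] at this

/-- Relatively dt = 0; these are the coefficients of dt ∧ dx_l = 0. -/
theorem gradT_smul_dx2 (j k : Fin 3) : gradT j • dx2 OY k = gradT k • dx2 OY j := by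
  have h : ∀ l : Fin 3, gradT (l + 2) • dx2 OY (l + 1) = gradT (l + 1) • dx2 OY (l + 2) := by
    intro l
    have := form1_mul_form1 OY gradT (Pi.single l 1)
    rw [form1_gradT, zero_mul] at this
    rw [← sub_eq_zero, this]
    fin_cases l <;> simp [form2, Fin.sum_univ_three, Pi.single_apply] <;> abel
  have h0 := h 0
  have h1 := h 1
  have h2 := h 2
  simp only [Fin.isValue, Fin.reduceAdd] at h0 h1 h2
  fin_cases j <;> fin_cases k <;> first | rfl | assumption | exact Eq.symm ‹_›

theorem dx2_OY (k : Fin 3) : dx2 OY k = gradT k • leray := by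
  have : ∀ i, gradT k • bezout i • dx2 OY i = (bezout i * gradT i) • dx2 OY k := fun i => by
    rw [smul_comm, gradT_smul_dx2, mul_smul]
  rw [leray, form2, Finset.smul_sum]
  simp only [this]
  rw [← Finset.sum_smul, sum_bezout, one_smul]

theorem form2_OY (V : Fin 3 → OX) : form2 OY V = (∑ k, V k * gradT k) • leray := by
  simp only [form2, dx2_OY, smul_smul, Finset.sum_smul]

theorem leray_smul_injective {a b : OX} (h : a • leray = b • leray) : a = b := by
  have h1 : ∀ k, pairing ![ham (k + 1), ham (k + 2)] leray = gradT k := fun k => by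
    simp only [leray, form2, map_sum, map_smul, pairing_ham, smul_eq_mul, ← mul_assoc]
    rw [← Finset.sum_mul, sum_bezout, one_mul]
  have h2 : ∀ k, a * gradT k = b * gradT k := fun k => by
    have := congrArg (pairing ![ham (k + 1), ham (k + 2)]) h
    simpa [h1] using this
  have h3 : ∀ c : OX, c = ∑ k, bezout k * (c * gradT k) := fun c => by
    have : ∀ k, bezout k * (c * gradT k) = c * (bezout k * gradT k) := fun k => by ring
    simp only [this]
    rw [← Finset.mul_sum, sum_bezout, mul_one]
  rw [h3 a, h3 b]
  simp only [h2]

theorem smul_leray_mem (f : OX) : f • leray ∈ closedForms OY OX 2 := by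
  rw [leray, ← form2_smul]
  refine ⟨form2_mem OY _, ?_⟩
  rw [SetLike.mem_coe, LinearMap.mem_ker, d_form2, vol_OY, smul_zero]

/-- The class of `f dx₁ ∧ dx₂ ∧ dx₃ / dt`. -/
def cls : OX →ₗ[OY] H2 := classOfMul leray smul_leray_mem

theorem cls_eq_mk (f : OX) : cls f = H.mk OY OX (f • leray) (smul_leray_mem f) :=
  classOfMul_apply _ _ _

theorem cls_surjective : Function.Surjective cls := by
  intro h
  obtain ⟨ω, hω, rfl⟩ := H.exists_eq_mk h
  obtain ⟨V, rfl⟩ := mem_degForms_two OY hω.1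
  exact ⟨∑ k, V k * gradT k, by rw [cls_eq_mk, H.mk_congr hω (form2_OY V)]⟩

/-- The differential of the one-form with coefficients W is curl W as a two-form, hence (curl W ·
∇t) times `leray`, and the coefficient of `leray` is unique. -/
theorem cls_eq_zero {f : OX} : cls f = 0 ↔ ∃ W, f = ∑ k, curl W k * gradT k := by
  rw [cls_eq_mk, H.mk_eq_zero]
  constructor
  · rintro ⟨η, hη, h⟩
    obtain ⟨W, rfl⟩ := mem_degForms_one OY hη
    rw [d_form1, form2_OY] at h
    exact ⟨W, (leray_smul_injective h).symm⟩
  · rintro ⟨W, rfl⟩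
    exact ⟨form1 OY W, form1_mem OY W, by rw [d_form1, form2_OY]⟩

theorem toRel_form2 (V : Fin 3 → OX) : toRel ℂ OY OX (form2 ℂ V) = form2 OY V := by
  have h : ∀ i, toRel ℂ OY OX (dx ℂ i) = dx OY i := fun i => by
    simp only [toRel, dx, dFun, ExteriorAlgebra.map_apply_ι, KaehlerDifferential.map_D]
    rfl
  simp only [form2, map_sum, map_smul, dx2, map_mul, h]

theorem isClassOf_form2 {h : H2} {V : Fin 3 → OX} :
    IsClassOf ℂ OY OX h (form2 ℂ V) ↔ h = cls (∑ k, V k * gradT k) := by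
  have e : toRel ℂ OY OX (form2 ℂ V) = (∑ k, V k * gradT k) • leray := by
    rw [toRel_form2, form2_OY]
  rw [cls_eq_mk]
  constructor
  · rintro ⟨hω, rfl⟩
    exact H.mk_congr hω e
  · rintro rfl
    exact ⟨e ▸ smul_leray_mem _, H.mk_congr _ e.symm⟩

end OneHoledTorus

/-! ### Reduction of monomials to five classes -/

/-- The relations between the classes `M a b c` of the monomials `x₁^a x₂^b x₃^c` in the
cohomology of the fibres of `x₁² + x₂² + x₃² - x₁x₂x₃`, with `T` the action of this function. -/
structure IsMarkov {A H : Type*} [CommRing A] [AddCommGroup H] [Module A H] (T : A)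
    (M : ℕ → ℕ → ℕ → H) : Prop where
  r1 : ∀ a b c : ℕ, ((b : A) - a) • M a b (c + 1) =
    (2 * b : A) • M (a + 1) (b - 1) c - (2 * a : A) • M (a - 1) (b + 1) c
  r2 : ∀ a b c : ℕ, ((c : A) - b) • M (a + 1) b c =
    (2 * c : A) • M a (b + 1) (c - 1) - (2 * b : A) • M a (b - 1) (c + 1)
  r3 : ∀ a b c : ℕ, ((a : A) - c) • M a (b + 1) c =
    (2 * a : A) • M (a - 1) b (c + 1) - (2 * c : A) • M (a + 1) b (c - 1)
  rT : ∀ a b c : ℕ, T • M a b c =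
    M (a + 2) b c + M a (b + 2) c + M a b (c + 2) - M (a + 1) (b + 1) (c + 1)

namespace IsMarkov

variable {A H : Type*} [CommRing A] [Algebra ℂ A] [AddCommGroup H] [Module A H] {T : A}
  {M : ℕ → ℕ → ℕ → H}

omit [Algebra ℂ A] in
theorem rotate (h : IsMarkov T M) : IsMarkov T fun a b c => M c a b where
  r1 a b c := h.r2 c a b
  r2 a b c := h.r3 c a b
  r3 a b c := h.r1 c a b
  rT a b c := by rw [h.rT]; abel

theorem mem_of_smul_mem {N : Submodule A H} {z : ℂ} (hz : z ≠ 0) {m : H}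
    (h : algebraMap ℂ A z • m ∈ N) : m ∈ N := by
  have := N.smul_mem (algebraMap ℂ A z⁻¹) h
  rwa [smul_smul, ← map_mul, inv_mul_cancel₀ hz, map_one, one_smul] at this

/-- The factor b - a in `r1` is a nonzero number, and the right-hand side has degree one less. When
a truncated exponent occurs, its coefficient is zero. -/
theorem mem_of_ne (h : IsMarkov T M) {N : Submodule A H} {n : ℕ}
    (ih : ∀ a b c, a + b + c < n → M a b c ∈ N) {a b c : ℕ} (hn : a + b + c < n) (hab : a ≠ b) :
    M a b (c + 1) ∈ N := by
  have hz : (b : ℂ) - a ≠ 0 := sub_ne_zero.2 (by exact_mod_cast hab.symm)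
  apply mem_of_smul_mem hz
  rw [map_sub, map_natCast, map_natCast, h.r1]
  refine N.sub_mem ?_ ?_
  · rcases b with _ | b
    · simp
    · exact N.smul_mem _ (ih _ _ _ (by omega))
  · rcases a with _ | a
    · simp
    · exact N.smul_mem _ (ih _ _ _ (by omega))

/-- Pure powers escape `mem_of_ne`. Modulo N, `rT` says M (a+2) 0 0 - M (a+1) 1 1 = 0 and `r1` says
a M (a+1) 1 1 + 2 M (a+2) 0 0 = 0; the determinant a + 2 is nonzero. -/
theorem mem_pow (h : IsMarkov T M) {N : Submodule A H} {n : ℕ}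
    (ih : ∀ a b c, a + b + c < n → M a b c ∈ N) {a : ℕ} (hn : a + 2 = n) (ha : a ≠ 0) :
    M (a + 2) 0 0 ∈ N := by
  have h1 : M a 0 2 ∈ N := h.mem_of_ne ih (by omega) ha
  have h2 : M a 2 0 ∈ N :=
    h.rotate.rotate.mem_of_ne (n := n) (fun p q r _ => ih q r p (by omega)) (a := 0) (b := a)
      (c := 1) (by omega) ha.symm
  have h3 : M (a + 2) 0 0 - M (a + 1) 1 1 ∈ N := by
    have := N.sub_mem (N.smul_mem T (ih a 0 0 (by omega))) (N.add_mem h1 h2)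
    rw [h.rT] at this
    convert this using 1
    abel
  have h4 : (a : A) • M (a + 1) 1 1 + (2 : A) • M (a + 2) 0 0 ∈ N := by
    have := N.smul_mem (2 * ((a + 1 : ℕ) : A)) h2
    have e := h.r1 (a + 1) 1 0
    simp only [Nat.sub_self, zero_add, Nat.add_sub_cancel] at e
    convert this using 1
    have e' : (a : A) • M (a + 1) 1 1 = -((((1 : ℕ) : A) - ((a + 1 : ℕ) : A)) • M (a + 1) 1 1) := by
      rw [← neg_smul]; congr 1; push_cast; ring
    rw [e', e]
    simp only [Nat.cast_one, mul_one, show a + 1 + 1 = a + 2 from rfl, show 1 + 1 = 2 from rfl]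
    abel
  have hz : (a : ℂ) + 2 ≠ 0 := by exact_mod_cast (by omega : a + 2 ≠ 0)
  apply mem_of_smul_mem hz
  have := N.add_mem h4 (N.smul_mem (a : A) h3)
  convert this using 1
  rw [map_add, map_natCast, map_ofNat, add_smul, smul_sub]
  abel

omit [Algebra ℂ A] in
theorem sq_eq [Invertible (2 : A)] (h : IsMarkov T M) : M 2 0 0 = M 0 2 0 := by
  have := h.r1 1 1 0
  simp only [sub_self, zero_smul, Nat.sub_self, Nat.cast_one, mul_one, Nat.reduceAdd] at this
  rw [eq_comm, sub_eq_zero] at this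
  exact (isUnit_of_invertible (2 : A)).smul_left_cancel.1 this

theorem mem (h : IsMarkov T M) {N : Submodule A H} (h0 : M 0 0 0 ∈ N) (hx : M 1 0 0 ∈ N)
    (hy : M 0 1 0 ∈ N) (hz : M 0 0 1 ∈ N) (hxx : M 2 0 0 ∈ N) (a b c : ℕ) : M a b c ∈ N := by
  have h2 : IsUnit (2 : A) := by
    have := (IsUnit.mk0 (2 : ℂ) two_ne_zero).map (algebraMap ℂ A)
    rwa [map_ofNat] at this
  let _ := h2.invertible
  have hyy : M 0 2 0 ∈ N := h.sq_eq ▸ hxx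
  have hzz : M 0 0 2 ∈ N := h.rotate.sq_eq ▸ hyy
  -- A positive exponent whose two partners differ is lowered by `mem_of_ne`; three equal positive
  -- exponents are lowered by `rT`; what remains are pure powers.
  induction hn : a + b + c using Nat.strong_induction_on generalizing a b c with
  | _ n ih =>
    have ih' : ∀ a b c, a + b + c < n → M a b c ∈ N := fun a b c h => ih _ h a b c rfl
    have m1 : ∀ p q r, p + q + r + 1 = n → p ≠ q → M p q (r + 1) ∈ N := fun p q r _ hpq =>
      h.mem_of_ne ih' (by omega) hpq
    have m2 : ∀ p q r, p + q + r + 1 = n → p ≠ q → M q (r + 1) p ∈ N := fun p q r _ hpq =>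
      h.rotate.rotate.mem_of_ne (n := n) (fun p q r _ => ih' q r p (by omega)) (a := p) (b := q)
        (c := r) (by omega) hpq
    by_cases hab : a = b
    · by_cases hbc : b = c
      · subst hab hbc
        rcases a with _ | a
        · exact h0
        · have e := h.rT a a a
          have : M (a + 1) (a + 1) (a + 1) =
              M (a + 2) a a + M a (a + 2) a + M a a (a + 2) - T • M a a a := by rw [e]; abel
          rw [this]
          exact N.sub_mem (N.add_mem (N.add_mem (ih' _ _ _ (by omega)) (ih' _ _ _ (by omega)))
            (ih' _ _ _ (by omega))) (N.smul_mem _ (ih' _ _ _ (by omega)))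
      · subst hab
        rcases a with _ | a
        · rcases c with _ | _ | _ | c
          · exact h0
          · exact hz
          · exact hzz
          · exact h.rotate.rotate.mem_pow (n := n) (a := c + 1)
              (fun p q r _ => ih' q r p (by omega)) (by omega) (by omega)
        · exact m2 c (a + 1) a (by omega) (Ne.symm hbc)
    · rcases c with _ | c
      · rcases a with _ | a
        · rcases b with _ | _ | _ | b
          · exact h0
          · exact hy
          · exact hyy
          · exact h.rotate.mem_pow (n := n) (a := b + 1)
              (fun p q r _ => ih' r p q (by omega)) (by omega) (by omega)
        · rcases b with _ | b
          · rcases a with _ | _ | a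
            · exact hx
            · exact hxx
            · exact h.mem_pow ih' (a := a + 1) (by omega) (by omega)
          · exact m2 0 (a + 1) b (by omega) (by omega)
      · exact m1 a b c (by omega) hab

end IsMarkov

namespace OneHoledTorus

/-- The monomial functions. -/
def mono (a b c : ℕ) : OX := x 0 ^ a * x 1 ^ b * x 2 ^ c

theorem cls_sub_eq_zero (m : OX) (i : Fin 3) :
    cls (dX (i + 2) m * gradT (i + 1) - dX (i + 1) m * gradT (i + 2)) = 0 := by
  rw [cls_eq_zero]
  refine ⟨Pi.single i m, ?_⟩
  fin_cases i <;> simp [Fin.sum_univ_three, curl, Pi.single_apply] <;> ring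

theorem algebraMap_smul_cls (c : OY) (f : OX) : c • cls f = cls (algebraMap OY OX c * f) := by
  rw [← Algebra.smul_def, map_smul]

theorem dX_mono_zero (a b c : ℕ) : dX 0 (mono a b c) = a * mono (a - 1) b c := by
  simp [mono, Derivation.leibniz, Derivation.leibniz_pow, dX_x]; ring

theorem dX_mono_one (a b c : ℕ) : dX 1 (mono a b c) = b * mono a (b - 1) c := by
  simp [mono, Derivation.leibniz, Derivation.leibniz_pow, dX_x]; ring

theorem dX_mono_two (a b c : ℕ) : dX 2 (mono a b c) = c * mono a b (c - 1) := by
  simp [mono, Derivation.leibniz, Derivation.leibniz_pow, dX_x]; ring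

theorem cls_eq_sub_of_relation {p q r z : OX} (hz : cls z = 0) (e : p = q - r - z) :
    cls p = cls q - cls r := by
  rw [e, LinearMap.map_sub, hz, LinearMap.map_sub, sub_zero]

/-- The first three relations are the exactness of d(m dx_i) for a monomial m; the last is the
equation t + 2 = x₁² + x₂² + x₃² - x₁x₂x₃. -/
theorem isMarkov : IsMarkov (y + 2) fun a b c => cls (mono a b c) where
  r1 a b c := by
    have h2 : algebraMap OY OX 2 = 2 := map_ofNat _ 2
    simp only [algebraMap_smul_cls, map_mul, (algebraMap OY OX).map_sub, map_natCast, h2]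
    refine cls_eq_sub_of_relation (cls_sub_eq_zero (mono a b c) 2) ?_
    simp only [Fin.isValue, Fin.reduceAdd, dX_mono_zero, dX_mono_one, gradT]
    rcases a with _ | a <;> rcases b with _ | b <;> simp [mono] <;> ring
  r2 a b c := by
    have h2 : algebraMap OY OX 2 = 2 := map_ofNat _ 2
    simp only [algebraMap_smul_cls, map_mul, (algebraMap OY OX).map_sub, map_natCast, h2]
    refine cls_eq_sub_of_relation (cls_sub_eq_zero (mono a b c) 0) ?_
    simp only [Fin.isValue, Fin.reduceAdd, dX_mono_one, dX_mono_two, gradT]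
    rcases b with _ | b <;> rcases c with _ | c <;> simp [mono] <;> ring
  r3 a b c := by
    have h2 : algebraMap OY OX 2 = 2 := map_ofNat _ 2
    simp only [algebraMap_smul_cls, map_mul, (algebraMap OY OX).map_sub, map_natCast, h2]
    refine cls_eq_sub_of_relation (cls_sub_eq_zero (mono a b c) 1) ?_
    simp only [Fin.isValue, Fin.reduceAdd, dX_mono_zero, dX_mono_two, gradT]
    rcases a with _ | a <;> rcases c with _ | c <;> simp [mono] <;> ring
  rT a b c := by
    have h2 : algebraMap OY OX 2 = 2 := map_ofNat _ 2
    simp only [algebraMap_smul_cls, (algebraMap OY OX).map_add, h2, algebraMap_y, tX_eq]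
    rw [← map_add, ← map_add, ← map_sub]
    congr 1
    simp only [mono]
    ring

end OneHoledTorus

/-! ### The classes of the forms in B in terms of monomials -/

namespace IsMarkov

variable {A H : Type*} [CommRing A] [AddCommGroup H] [Module A H] {T : A}
  {M : ℕ → ℕ → ℕ → H}

theorem eq_111 [Invertible (2 : A)] (h : IsMarkov T M) :
    M 1 1 1 = (3 : A) • M 2 0 0 - T • M 0 0 0 := by
  have e := h.rT 0 0 0
  have e1 := h.sq_eq
  have e2 : M 0 2 0 = M 0 0 2 := h.rotate.sq_eq
  simp only [Nat.reduceAdd] at e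
  linear_combination (norm := module) (1 : A) • e + (-2 : A) • e1 + (-1 : A) • e2

theorem class_one [Invertible (2 : A)] (h : IsMarkov T M) :
    (2 : A) • M 2 0 0 - M 1 1 1 = T • M 0 0 0 - M 2 0 0 := by
  rw [h.eq_111]; module

/-- The argument is x₁ · x₁ ∂₁t with ∂₁t = 2x₁ - x₂x₃. All monomials except x₁ cancel between the
listed relations, and T - 4 stands for y - 2. -/
theorem class_x (h : IsMarkov T M) :
    (3 : A) • ((2 : A) • M 3 0 0 - M 2 1 1) = (4 * (T - 4)) • M 1 0 0 := by
  have e1 := h.r1 2 1 0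
  have e3 := h.r1 0 1 0
  have e4 := h.r1 1 0 1
  have e5 := h.rT 1 0 0
  simp only [Nat.reduceAdd, Nat.reduceSub, Nat.cast_zero, Nat.cast_one, Nat.cast_ofNat]
    at e1 e3 e4 e5
  linear_combination (norm := module) (-4 : A) • e5 + (-1 : A) • e1 + (-8 : A) • e3 + (4 : A) • e4

theorem class_y (h : IsMarkov T M) :
    (3 : A) • ((2 : A) • M 2 1 0 - M 1 2 1) = (2 * (T - 4)) • M 0 1 0 := by
  have e1 := h.r1 1 0 0
  have e3 := h.r1 0 1 1
  have e4 := h.r1 1 2 0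
  have e5 := h.rT 0 1 0
  simp only [Nat.reduceAdd, Nat.reduceSub, Nat.cast_zero, Nat.cast_one, Nat.cast_ofNat]
    at e1 e3 e4 e5
  linear_combination (norm := module) (-2 : A) • e5 + (4 : A) • e1 + (-2 : A) • e3 + (-1 : A) • e4

theorem class_z (h : IsMarkov T M) :
    (3 : A) • ((2 : A) • M 2 0 1 - M 1 1 2) = (2 * (T - 4)) • M 0 0 1 := by
  have e1 := h.r3 1 0 0
  have e3 := h.r1 0 2 0
  have e4 := h.r3 1 0 2
  have e5 := h.rT 0 0 1
  simp only [Nat.reduceAdd, Nat.reduceSub, Nat.cast_zero, Nat.cast_one, Nat.cast_ofNat]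
    at e1 e3 e4 e5
  linear_combination (norm := module) (-2 : A) • e5 + (-4 : A) • e1 + (-1 : A) • e3 + (1 : A) • e4

theorem class_sq [Invertible (2 : A)] (h : IsMarkov T M) :
    (2 : A) • ((2 : A) • M 4 0 0 - M 3 1 1) =
      (3 * (T - 6)) • M 2 0 0 + (6 * T) • M 0 0 0 := by
  apply (isUnit_of_invertible (2 : A)).smul_left_cancel.1
  have e1 := h.r1 3 1 0
  have e3 := h.r1 2 0 1
  have e5 := h.rT 2 0 0
  have e6 := h.eq_111
  simp only [Nat.reduceAdd, Nat.reduceSub, Nat.cast_zero, Nat.cast_one, Nat.cast_ofNat]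
    at e1 e3 e5
  linear_combination (norm := module) (-6 : A) • e5 + (-1 : A) • e1 + (3 : A) • e3 + (-12 : A) • e6

end IsMarkov

theorem mem_of_isUnit_smul_mem {R M : Type*} [CommRing R] [AddCommGroup M] [Module R M]
    {N : Submodule R M} {r : R} (hr : IsUnit r) {m : M} (h : r • m ∈ N) : m ∈ N := by
  obtain ⟨w, hw⟩ := hr.exists_left_inv
  rw [← one_smul R m, ← hw, mul_smul]
  exact N.smul_mem w h

/-! ### The five monomial classes span -/

namespace OneHoledTorus

/-- The composition of `cls` with the localization map. -/
def clsPoly : MvPolynomial (Fin 3) ℂ →ₗ[ℂ] H2 :=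
  (cls.restrictScalars ℂ).comp (Algebra.linearMap _ OX |>.restrictScalars ℂ)

theorem clsPoly_apply (p : MvPolynomial (Fin 3) ℂ) : clsPoly p = cls (algebraMap _ OX p) := rfl

theorem algebraMap_monomial (s : Fin 3 →₀ ℕ) (a : ℂ) :
    algebraMap (MvPolynomial (Fin 3) ℂ) OX (MvPolynomial.monomial s a) =
      algebraMap OY OX (algebraMap ℂ OY a) * mono (s 0) (s 1) (s 2) := by
  rw [MvPolynomial.monomial_eq, Finsupp.prod_fintype _ _ (by simp), Fin.prod_univ_three,
    ← IsScalarTower.algebraMap_apply]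
  simp only [map_mul, map_pow]
  rfl

theorem clsPoly_mem {N : Submodule OY H2} (h : ∀ a b c, cls (mono a b c) ∈ N)
    (p : MvPolynomial (Fin 3) ℂ) : clsPoly p ∈ N := by
  induction p using MvPolynomial.induction_on' with
  | add p q hp hq =>
    rw [LinearMap.map_add]
    exact N.add_mem hp hq
  | monomial s a =>
    rw [clsPoly_apply, algebraMap_monomial, ← algebraMap_smul_cls]
    exact N.smul_mem _ (h _ _ _)

theorem algebraMap_aeval_psi :
    algebraMap (MvPolynomial (Fin 3) ℂ) OX (Polynomial.aeval t psi) =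
      algebraMap OY OX ((y - 2) * (y + 2)) := by
  have h2 : algebraMap OY OX 2 = 2 := map_ofNat _ 2
  have h4 : algebraMap (MvPolynomial (Fin 3) ℂ) OX 4 = 4 := map_ofNat _ 4
  have h4' : Polynomial.aeval t (4 : Polynomial ℂ) = 4 := map_ofNat _ 4
  rw [map_mul, map_sub, map_add, h2, algebraMap_y]
  simp only [psi, tX, map_sub, map_pow, Polynomial.aeval_X, h4, h4']
  ring

/-- The only denominators on X are powers of t² - 4, and these come from units of O_Y; so statements
about O_Y-spans reduce to polynomials. -/
theorem exists_algebraMap_mul (f : OX) : ∃ (n : ℕ) (p : MvPolynomial (Fin 3) ℂ),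
    algebraMap OY OX (((y - 2) * (y + 2)) ^ n) * f = algebraMap _ OX p := by
  obtain ⟨n, p, h⟩ := IsLocalization.Away.surj (Polynomial.aeval t psi) f
  refine ⟨n, p, ?_⟩
  rw [map_pow, ← algebraMap_aeval_psi, mul_comm, h]

theorem cls_mem_of_mono {N : Submodule OY H2} (h : ∀ a b c, cls (mono a b c) ∈ N) (f : OX) :
    cls f ∈ N := by
  obtain ⟨n, p, hp⟩ := exists_algebraMap_mul f
  have h1 : ((y - 2) * (y + 2)) ^ n • cls f ∈ N := by
    rw [algebraMap_smul_cls, hp, ← clsPoly_apply]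
    exact clsPoly_mem h p
  exact mem_of_isUnit_smul_mem (isUnit_y_sq_sub.pow n) h1

/-- The functions `1, x₁, x₂, x₃, x₁²`. -/
def gens : Fin 5 → OX := ![1, x 0, x 1, x 2, x 0 ^ 2]

theorem mono_eq_gens : mono 0 0 0 = gens 0 ∧ mono 1 0 0 = gens 1 ∧ mono 0 1 0 = gens 2 ∧
    mono 0 0 1 = gens 3 ∧ mono 2 0 0 = gens 4 := by
  simp [mono, gens]

theorem cls_mem_of_gens {N : Submodule OY H2} (hi : ∀ i, cls (gens i) ∈ N) (f : OX) :
    cls f ∈ N := by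
  obtain ⟨e0, e1, e2, e3, e4⟩ := mono_eq_gens
  have h : ∀ {f i}, f = gens i → cls f ∈ N := fun e => by rw [e]; exact hi _
  have h' := isMarkov.mem (N := N) (h e0) (h e1) (h e2) (h e3) (h e4)
  exact cls_mem_of_mono h' f

theorem span_cls : Submodule.span OY (Set.range fun i => cls (gens i)) = ⊤ := by
  have hi : ∀ i, cls (gens i) ∈ Submodule.span OY (Set.range fun i => cls (gens i)) := fun i =>
    Submodule.subset_span ⟨i, rfl⟩
  refine Submodule.eq_top_iff'.2 fun h => ?_
  obtain ⟨f, rfl⟩ := cls_surjective h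
  exact cls_mem_of_gens hi f

end OneHoledTorus

/-! ### Derivations and constant terms of Laurent polynomials -/

namespace LaurentPolynomial

variable {k L : Type*} [CommRing k] [CommRing L] [Algebra k L]

/-- The linear map that acts on the coefficient of index `n` by `e n`. -/
def diag (e : ℤ → L →ₗ[k] L) : LaurentPolynomial L →ₗ[k] LaurentPolynomial L :=
  (AddMonoidAlgebra.coeffLinearEquiv k).symm.toLinearMap ∘ₗ
    Finsupp.lsum k (fun n => (Finsupp.lsingle n).comp (e n)) ∘ₗ
    (AddMonoidAlgebra.coeffLinearEquiv k).toLinearMap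

theorem diag_C_mul_T (e : ℤ → L →ₗ[k] L) (r : L) (n : ℤ) :
    diag e (C r * T n) = C (e n r) * T n := by
  rw [← single_eq_C_mul_T, ← single_eq_C_mul_T]
  apply AddMonoidAlgebra.coeff_injective
  change Finsupp.lsum k _ (Finsupp.single n r) = Finsupp.single n (e n r)
  simp

theorem C_mul_T_mul (r s : L) (m n : ℤ) : C r * T m * (C s * T n) = C (r * s) * T (m + n) := by
  rw [map_mul, T_add]; ring

/-- The derivation that acts on the coefficient of index `n` by `e n`. -/
def diagDer (e : ℤ → L →ₗ[k] L)
    (h : ∀ m n r s, e (m + n) (r * s) = r * e n s + s * e m r) :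
    Derivation k (LaurentPolynomial L) (LaurentPolynomial L) :=
  Derivation.mk' (diag e) fun p q => by
    induction p using LaurentPolynomial.induction_on' with
    | add p p' hp hp' => rw [add_mul, map_add, hp, hp', map_add]; simp only [smul_eq_mul]; ring
    | C_mul_T m r =>
      induction q using LaurentPolynomial.induction_on' with
      | add q q' hq hq' => rw [mul_add, map_add, hq, hq', map_add]; simp only [smul_eq_mul]; ring
      | C_mul_T n s =>
        simp only [C_mul_T_mul, diag_C_mul_T, h, smul_eq_mul, map_add, add_mul]
        rw [add_comm n m]

theorem diagDer_C_mul_T (e : ℤ → L →ₗ[k] L)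
    (h : ∀ m n r s, e (m + n) (r * s) = r * e n s + s * e m r) (r : L) (n : ℤ) :
    diagDer e h (C r * T n) = C (e n r) * T n := diag_C_mul_T e r n

/-- The derivation that acts on the coefficients. -/
def coeffDer (θ : Derivation k L L) : Derivation k (LaurentPolynomial L) (LaurentPolynomial L) :=
  diagDer (fun _ => θ) fun _ _ r s => by simp

/-- The derivation `T d/dT`. -/
def eulerDer : Derivation k (LaurentPolynomial L) (LaurentPolynomial L) :=
  diagDer (fun n => n • LinearMap.id) fun m n r s => by simp; ring

theorem coeffDer_C_mul_T (θ : Derivation k L L) (r : L) (n : ℤ) :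
    coeffDer θ (C r * T n) = C (θ r) * T n := diagDer_C_mul_T _ _ r n

theorem eulerDer_C_mul_T (r : L) (n : ℤ) :
    eulerDer (k := k) (C r * T n) = C (n * r) * T n := by
  rw [eulerDer, diagDer_C_mul_T]; simp

theorem coeffDer_C (θ : Derivation k L L) (r : L) : coeffDer θ (C r) = C (θ r) := by
  simpa using coeffDer_C_mul_T θ r 0

theorem coeffDer_T (θ : Derivation k L L) (n : ℤ) : coeffDer θ (T n) = 0 := by
  simpa using coeffDer_C_mul_T θ 1 n

theorem eulerDer_C (r : L) : eulerDer (k := k) (C r) = 0 := by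
  simpa using eulerDer_C_mul_T (k := k) r 0

theorem eulerDer_T (n : ℤ) : eulerDer (k := k) (T n : LaurentPolynomial L) = C (n : L) * T n := by
  simpa using eulerDer_C_mul_T (k := k) (1 : L) n

variable (L) in
/-- The constant term. -/
def constTerm : LaurentPolynomial L →ₗ[L] L :=
  (Finsupp.lapply 0).comp (AddMonoidAlgebra.coeffLinearEquiv L).toLinearMap

theorem constTerm_C_mul_T (r : L) (n : ℤ) :
    constTerm L (C r * T n) = if n = 0 then r else 0 := by
  rw [← single_eq_C_mul_T]
  change (Finsupp.single n r) 0 = _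
  rw [Finsupp.single_apply]

theorem constTerm_C (r : L) : constTerm L (C r) = r := by
  simpa using constTerm_C_mul_T r 0

theorem constTerm_C_mul (r : L) (p : LaurentPolynomial L) :
    constTerm L (C r * p) = r * constTerm L p := by
  rw [← smul_eq_C_mul, map_smul, smul_eq_mul]

/-- The constant term of the bracket of two Laurent polynomials is a derivative. -/
theorem constTerm_bracket (θ : Derivation k L L) (f g : LaurentPolynomial L) :
    constTerm L (coeffDer θ f * eulerDer (k := k) g - eulerDer (k := k) f * coeffDer θ g) =
      θ (constTerm L (f * eulerDer (k := k) g)) := by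
  induction f using LaurentPolynomial.induction_on' with
  | add f f' hf hf' =>
    simp only [map_add, add_mul, map_sub] at *
    linear_combination hf + hf'
  | C_mul_T m r =>
    induction g using LaurentPolynomial.induction_on' with
    | add g g' hg hg' =>
      simp only [map_add, mul_add, map_sub] at *
      linear_combination hg + hg'
    | C_mul_T n s =>
      simp only [coeffDer_C_mul_T, eulerDer_C_mul_T, C_mul_T_mul, map_sub, constTerm_C_mul_T]
      -- Only m + n = 0 contributes to the constant term, and then n θ(r) s - m r θ(s) = θ(n r s).
      split_ifs with h
      · have : (m : L) = -n := by 
          rw [eq_neg_iff_add_eq_zero]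
          exact_mod_cast congrArg (Int.cast : ℤ → L) h
        simp [this]; ring
      · simp

variable {K : Type*} [CommRing K]

variable (K) in
/-- The variable as a unit. -/
def unitT : (LaurentPolynomial K)ˣ :=
  ⟨T 1, T (-1), by rw [← T_add]; simp, by rw [← T_add]; simp⟩

theorem unitT_zpow (n : ℤ) :
    ((unitT K ^ n : (LaurentPolynomial K)ˣ) : LaurentPolynomial K) = T n := by
  cases n with
  | ofNat n => simp [unitT, T_pow]
  | negSucc n =>
    rw [zpow_negSucc, ← inv_pow, Units.val_pow_eq_pow_val]
    change T (-1) ^ (n + 1) = _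
    rw [T_pow]
    congr 1
    omega

/-- The change of coefficients. -/
def mapCoeff (ε : L →+* K) : LaurentPolynomial L →+* LaurentPolynomial K :=
  eval₂ (C.comp ε) (unitT K)

theorem mapCoeff_C (ε : L →+* K) (r : L) : mapCoeff ε (C r) = C (ε r) := by
  rw [mapCoeff, eval₂_C]; rfl

theorem mapCoeff_T (ε : L →+* K) (n : ℤ) : mapCoeff ε (T n) = T n := by
  rw [mapCoeff, eval₂_T, unitT_zpow]

theorem constTerm_mapCoeff (ε : L →+* K) (f : LaurentPolynomial L) :
    constTerm K (mapCoeff ε f) = ε (constTerm L f) := by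
  induction f using LaurentPolynomial.induction_on' with
  | add f g hf hg => simp only [map_add, hf, hg]
  | C_mul_T n r =>
    rw [map_mul, mapCoeff_C, mapCoeff_T, constTerm_C_mul_T, constTerm_C_mul_T]
    split_ifs <;> simp

theorem constTerm_toLaurent_mul_T (p : Polynomial K) :
    constTerm K (Polynomial.toLaurent p * T 1) = 0 := by
  induction p using Polynomial.induction_on' with
  | add p q hp hq => rw [map_add, add_mul, map_add, hp, hq, add_zero]
  | monomial n a =>
    rw [← Polynomial.C_mul_X_pow_eq_monomial, Polynomial.toLaurent_C_mul_X_pow, mul_T_assoc,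
      constTerm_C_mul_T, if_neg (by omega)]

end LaurentPolynomial

/-! ### Functions of a on ℂ ∖ {0, 1, -1} and their primitives -/

namespace OneHoledTorus

/-- The ring of regular functions on `ℂ ∖ {0, 1, -1}`. -/
abbrev OL : Type := Localization.Away (Polynomial.X ^ 3 - Polynomial.X : Polynomial ℂ)

namespace OL

/-- The coordinate. -/
def a : OL := algebraMap (Polynomial ℂ) OL Polynomial.X

theorem exists_inverses : ∃ a' w' : OL, a * a' = 1 ∧ (a - a') * w' = 1 := by
  have h := IsLocalization.Away.algebraMap_isUnit (S := OL)
    (Polynomial.X ^ 3 - Polynomial.X : Polynomial ℂ)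
  obtain ⟨e, he⟩ := h.exists_right_inv
  simp only [map_sub, map_pow] at he
  change (a ^ 3 - a) * e = 1 at he
  -- With e = 1/(a³ - a): 1/a = (a² - 1)e and 1/(a - 1/a) = a²e.
  exact ⟨(a ^ 2 - 1) * e, a ^ 2 * e, by linear_combination he,
    by linear_combination (1 - a * e) * he⟩

/-- The inverse of the coordinate. -/
def a' : OL := exists_inverses.choose

/-- The inverse of `a - a'`. -/
def w' : OL := exists_inverses.choose_spec.choose

theorem a_mul : a * a' = 1 := exists_inverses.choose_spec.choose_spec.1

theorem w_mul : (a - a') * w' = 1 := exists_inverses.choose_spec.choose_spec.2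

theorem exists_θ : ∃ D : Derivation ℂ OL OL, ∀ f, D (algebraMap (Polynomial ℂ) OL f) =
    algebraMap (Polynomial ℂ) OL (Polynomial.X * Polynomial.derivative f) :=
  Derivation.exists_extend_localization
    (Submonoid.powers (Polynomial.X ^ 3 - Polynomial.X : Polynomial ℂ))
    ((Polynomial.X : Polynomial ℂ) • Polynomial.derivative')

/-- The derivation `a d/da`. -/
def θ : Derivation ℂ OL OL := exists_θ.choose

theorem θ_algebraMap (p : Polynomial ℂ) :
    θ (algebraMap _ OL p) = algebraMap _ OL (Polynomial.X * Polynomial.derivative p) :=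
  exists_θ.choose_spec p

theorem θ_a : θ a = a := by
  rw [a, θ_algebraMap]; simp

theorem θ_a' : θ a' = -a' := by
  have h := congrArg θ a_mul
  rw [Derivation.leibniz, θ_a, Derivation.map_one_eq_zero, smul_eq_mul, smul_eq_mul] at h
  linear_combination a' * h - (θ a' + a') * a_mul

theorem θ_w' : θ w' = -((a + a') * w' ^ 2) := by
  have h := congrArg θ w_mul
  rw [Derivation.leibniz, map_sub, θ_a, θ_a', Derivation.map_one_eq_zero, smul_eq_mul,
    smul_eq_mul] at h
  linear_combination w' * h - θ w' * w_mul

section Evaluation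

variable {z : ℂ} (hz : z ^ 3 - z ≠ 0)

include hz in
theorem isUnit_eval : IsUnit (Polynomial.aeval (R := ℂ) z
    (Polynomial.X ^ 3 - Polynomial.X : Polynomial ℂ)) := by
  simpa using hz

/-- The evaluation at a point. -/
def ev : OL →+* ℂ :=
  IsLocalization.Away.lift (Polynomial.X ^ 3 - Polynomial.X : Polynomial ℂ)
    (g := (Polynomial.aeval (R := ℂ) z).toRingHom) (isUnit_eval hz)

theorem ev_algebraMap (p : Polynomial ℂ) : ev hz (algebraMap _ OL p) = p.eval z := by
  rw [ev, IsLocalization.Away.lift_eq]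
  simp [Polynomial.coe_aeval_eq_eval]

theorem ev_a : ev hz a = z := by rw [a, ev_algebraMap]; simp

theorem ev_const (c : ℂ) : ev hz (algebraMap ℂ OL c) = c := by
  rw [IsScalarTower.algebraMap_apply ℂ (Polynomial ℂ) OL, ev_algebraMap]; simp

include hz in
theorem ne_zero_of_mem : z ≠ 0 := by rintro rfl; simp at hz

theorem ev_a' : ev hz a' = z⁻¹ := by
  have h := congrArg (ev hz) a_mul
  rw [map_mul, ev_a, map_one] at h
  exact eq_inv_of_mul_eq_one_right h

end Evaluation

/-- The function on the complex plane defined by an element of the ring. -/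
def fn (h : OL) (z : ℂ) : ℂ := by
  classical exact if hz : z ^ 3 - z ≠ 0 then ev hz h else 0

theorem fn_eq {z : ℂ} (hz : z ^ 3 - z ≠ 0) (h : OL) : fn h z = ev hz h := dif_pos hz

theorem isOpen_domain : IsOpen {z : ℂ | z ^ 3 - z ≠ 0} :=
  isOpen_ne_fun (by fun_prop) (by fun_prop)

theorem hasDerivAt_fn {z : ℂ} (hz : z ^ 3 - z ≠ 0) (h : OL) :
    HasDerivAt (fn h) (ev hz (θ h) / z) z := by
  obtain ⟨n, p, hp⟩ := IsLocalization.Away.surj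
    (Polynomial.X ^ 3 - Polynomial.X : Polynomial ℂ) h
  rw [← map_pow] at hp
  set q : Polynomial ℂ := (Polynomial.X ^ 3 - Polynomial.X) ^ n with hq
  have hqz : ∀ z' : ℂ, z' ^ 3 - z' ≠ 0 → q.eval z' ≠ 0 := fun z' h' => by
    simpa [hq] using fun h0 => absurd h0 h'
  have h1 : ∀ z', z' ^ 3 - z' ≠ 0 → fn h z' = p.eval z' / q.eval z' := fun z' h' => by
    have := congrArg (ev h') hp
    rw [map_mul, ev_algebraMap, ev_algebraMap] at this
    rw [fn_eq h', eq_div_iff (hqz z' h'), this]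
  have h2 := congrArg (fun f => ev hz (θ f)) hp
  simp only [Derivation.leibniz, smul_eq_mul, θ_algebraMap, map_add, map_mul, ev_algebraMap,
    Polynomial.eval_X] at h2
  have h3 := (p.hasDerivAt z).div (q.hasDerivAt z) (hqz z hz)
  have h4 : fn h =ᶠ[𝓝 z] fun z' => p.eval z' / q.eval z' := by
    filter_upwards [isOpen_domain.mem_nhds hz] with z' h' using h1 z' h'
  refine (h3.congr_of_eventuallyEq h4).congr_deriv ?_
  have h5 := h1 z hz
  rw [fn_eq hz, eq_div_iff (hqz z hz)] at h5
  have hz0 := ne_zero_of_mem hz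
  have hq0 := hqz z hz
  rw [div_eq_div_iff (pow_ne_zero 2 hq0) hz0]
  linear_combination (-Polynomial.eval z q) * h2 +
    z * Polynomial.eval z (Polynomial.derivative q) * h5

theorem isPreconnected_domain : IsPreconnected {z : ℂ | z ^ 3 - z ≠ 0} := by
  have : {z : ℂ | z ^ 3 - z ≠ 0} = {0, 1, -1}ᶜ := by
    ext z
    have e : z ^ 3 - z = z * ((z - 1) * (z - -1)) := by ring
    rw [Set.mem_ofPred_eq, e]
    simp only [mul_ne_zero_iff, sub_ne_zero, Set.mem_compl_iff,
      Set.mem_insert_iff, Set.mem_singleton_iff, not_or, Ne]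
  rw [this]
  exact (Set.Countable.isPathConnected_compl_of_one_lt_rank (by simp)
    (Set.toFinite _).countable).isConnected.isPreconnected

/-- A primitive of m/z makes its integral over |z| = 2 vanish, but that integral is 2πi m. -/
theorem eq_zero_of_θ_eq {m : ℂ} {h : OL} (hm : θ h = algebraMap ℂ OL m) : m = 0 := by
  have hs : ∀ z ∈ Metric.sphere (0 : ℂ) 2, z ^ 3 - z ≠ 0 := fun z hz => by
    have hz : ‖z‖ = 2 := by simpa using hz
    intro h0
    have : ‖z ^ 3‖ = ‖z‖ := by rw [sub_eq_zero.1 h0]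
    rw [norm_pow, hz] at this
    norm_num at this
  have h1 : (∮ z in C(0, 2), m / z) = 0 := by
    refine circleIntegral.integral_eq_zero_of_hasDerivWithinAt (by norm_num) (f := fn h)
      fun z hz => ?_
    have := hasDerivAt_fn (hs z hz) h
    rw [hm, ev_const] at this
    exact this.hasDerivWithinAt
  have h2 : (∮ z in C(0, 2), m / z) = m * (2 * Real.pi * Complex.I) := by
    have := circleIntegral.integral_sub_center_inv (0 : ℂ) (R := 2) (by norm_num)
    simp only [sub_zero] at this
    simp only [div_eq_mul_inv]
    rw [circleIntegral.integral_const_mul, this]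
  rw [h2] at h1
  exact (mul_eq_zero.1 h1).resolve_right Complex.two_pi_I_ne_zero

theorem ev_eq_of_θ_eq_zero {h : OL} (hm : θ h = 0) {z z' : ℂ} (hz : z ^ 3 - z ≠ 0)
    (hz' : z' ^ 3 - z' ≠ 0) : ev hz h = ev hz' h := by
  rw [← fn_eq, ← fn_eq]
  have hd : ∀ z ∈ {z : ℂ | z ^ 3 - z ≠ 0}, HasDerivAt (fn h) 0 z := fun z hz => by
    have := hasDerivAt_fn hz h
    rwa [hm, map_zero, zero_div] at this
  exact isOpen_domain.is_const_of_deriv_eq_zero isPreconnected_domain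
    (fun z hz => (hd z hz).differentiableAt.differentiableWithinAt) (fun z hz => (hd z hz).deriv)
    hz hz'

/-- A derivative of the form `m₀ + m₁ x + m₄ x²` with `x = a + 1/a` of a function that vanishes
where `(a - 1/a)² = σ` is zero. -/
theorem eq_zero_of_θ_eq_poly {m₀ m₁ m₄ σ : ℂ} (hσ : σ ≠ 0) (hσ' : σ + 4 ≠ 0) {h : OL}
    (hθ : θ h = algebraMap ℂ OL m₀ + algebraMap ℂ OL m₁ * (a + a') +
      algebraMap ℂ OL m₄ * (a + a') ^ 2)
    (h0 : ∀ z (hz : z ^ 3 - z ≠ 0), (z - z⁻¹) ^ 2 = σ → ev hz h = 0) :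
    m₀ = 0 ∧ m₁ = 0 ∧ m₄ = 0 := by
  have hc : ∀ c : ℂ, θ (algebraMap ℂ OL c) = 0 := fun c => Derivation.map_algebraMap _ _
  -- Subtracting primitives of m₁(a + 1/a) and m₄(a² + 1/a²) leaves the constant m₀ + 2m₄, the 2
  -- coming from (a + 1/a)² = a² + 2 + 1/a². It is zero by the residue, so the difference is a
  -- constant function.
  have hd : θ (h - algebraMap ℂ OL m₁ * (a - a') -
      algebraMap ℂ OL (m₄ / 2) * (a ^ 2 - a' ^ 2)) = algebraMap ℂ OL (m₀ + 2 * m₄) := by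
    have e4 : algebraMap ℂ OL m₄ = 2 * algebraMap ℂ OL (m₄ / 2) := by
      rw [← map_ofNat (algebraMap ℂ OL) 2, ← map_mul]; congr 1; ring
    simp only [map_sub, map_add, map_mul, Derivation.leibniz, Derivation.leibniz_pow, hc, hθ,
      θ_a, θ_a', smul_eq_mul,
      map_ofNat, e4]
    simp
    linear_combination 4 * algebraMap ℂ OL (m₄ / 2) * a_mul
  have hm := eq_zero_of_θ_eq hd
  rw [hm, map_zero] at hd
  obtain ⟨r, hr⟩ := IsAlgClosed.exists_pow_nat_eq σ (n := 2) (by norm_num)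
  have hr0 : r ≠ 0 := by rintro rfl; exact hσ (by rw [← hr]; ring)
  obtain ⟨ρ, hρ⟩ := IsAlgClosed.exists_pow_nat_eq (σ + 4) (n := 2) (by norm_num)
  have hρ0 : ρ ≠ 0 := by rintro rfl; exact hσ' (by rw [← hρ]; ring)
  -- The point is z = (ρ + r)/2, for which z - 1/z = r and z + 1/z = ρ. Comparing values under ρ ↦
  -- -ρ isolates m₄, and then r ↦ -r isolates m₁.
  have key : ∀ r ρ : ℂ, r ^ 2 = σ → ρ ^ 2 = σ + 4 → ∃ (z : ℂ) (hz : z ^ 3 - z ≠ 0),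
      ev hz (h - algebraMap ℂ OL m₁ * (a - a') -
      algebraMap ℂ OL (m₄ / 2) * (a ^ 2 - a' ^ 2)) = - (m₁ * r + m₄ / 2 * (r * ρ)) := by
    intro r ρ hr hρ
    have hp : (ρ + r) / 2 * ((ρ - r) / 2) = 1 := by linear_combination (hρ - hr) / 4
    have hz0 : (ρ + r) / 2 ≠ 0 := left_ne_zero_of_mul_eq_one hp
    have hi : ((ρ + r) / 2)⁻¹ = (ρ - r) / 2 := inv_eq_of_mul_eq_one_right hp
    have hz : ((ρ + r) / 2) ^ 3 - (ρ + r) / 2 ≠ 0 := by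
      have e : ((ρ + r) / 2) ^ 3 - (ρ + r) / 2 = ((ρ + r) / 2) ^ 2 * r := by
        linear_combination ((ρ + r) / 2) * hp
      rw [e]
      refine mul_ne_zero (pow_ne_zero 2 hz0) ?_
      rintro rfl; exact hσ (by rw [← hr]; ring)
    refine ⟨_, hz, ?_⟩
    have := h0 _ hz (by rw [hi, ← hr]; ring)
    simp only [map_sub, map_mul, map_pow, this, ev_const, ev_a, ev_a', hi]
    ring
  obtain ⟨z₁, hz₁, e₁⟩ := key r ρ hr hρ
  obtain ⟨z₂, hz₂, e₂⟩ := key r (-ρ) hr (by rw [← hρ]; ring)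
  obtain ⟨z₃, hz₃, e₃⟩ := key (-r) ρ (by rw [← hr]; ring) hρ
  have e12 := ev_eq_of_θ_eq_zero hd hz₁ hz₂
  have e13 := ev_eq_of_θ_eq_zero hd hz₁ hz₃
  rw [e₁, e₂] at e12
  rw [e₁, e₃] at e13
  have h4 : m₄ = 0 := by
    have : m₄ * (r * ρ) = 0 := by linear_combination -e12
    exact (mul_eq_zero.1 this).resolve_right (mul_ne_zero hr0 hρ0)
  have h1 : m₁ = 0 := by
    have : m₁ * (2 * r) = 0 := by rw [h4] at e13; linear_combination -e13
    exact (mul_eq_zero.1 this).resolve_right (mul_ne_zero two_ne_zero hr0)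
  exact ⟨by rw [h4] at hm; simpa using hm, h1, h4⟩

end OL

/-! ### Charts of the fibres by Laurent polynomials -/

section Bracket

variable {S : Type*} [CommRing S] [Algebra ℂ S]

/-- The bracket defined by two derivations. -/
def bracket (D₁ D₂ : Derivation ℂ S S) (f g : S) : S := D₁ f * D₂ g - D₂ f * D₁ g

variable [Algebra OX S] [IsScalarTower ℂ OX S]

theorem derivation_algebraMap (D : Derivation ℂ S S) (f : OX) :
    D (algebraMap OX S f) = ∑ j, algebraMap OX S (dX j f) * D (algebraMap OX S (x j)) := by
  have : D.compAlgebraMap OX =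
      ∑ j, (LinearMap.toSpanSingleton OX S (D (algebraMap OX S (x j)))).compDer (dX j) := by
    apply derivation_OX_ext
    intro j
    fin_cases j <;> simp [Fin.sum_univ_three, dX_x]
  have := congrArg (fun D => D f) this
  simpa [Fin.sum_univ_three, Algebra.smul_def] using this

/-- If the brackets of the coordinates are the partial derivatives of `t`, then
the relations `∑ curl W_k ∂_k t` are sums of brackets. -/
theorem algebraMap_sum_curl_mul_gradT {D₁ D₂ : Derivation ℂ S S}
    (h : ∀ j, bracket D₁ D₂ (algebraMap OX S (x j)) (algebraMap OX S (x (j + 1))) =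
      algebraMap OX S (gradT (j + 2))) (W : Fin 3 → OX) :
    algebraMap OX S (∑ k, curl W k * gradT k) =
      ∑ i, bracket D₁ D₂ (algebraMap OX S (W i)) (algebraMap OX S (x i)) := by
  have h0 := h 0
  have h1 := h 1
  have h2 := h 2
  simp only [bracket, Fin.isValue, Fin.reduceAdd] at h0 h1 h2
  simp only [map_add, map_mul, curl, map_sub, Fin.sum_univ_three, bracket,
    derivation_algebraMap _ (W _), Fin.isValue, Fin.reduceAdd, ← h0, ← h1, ← h2]
  ring

end Bracket

namespace Chart

open LaurentPolynomial OL

/-- The coordinates of a chart of the fibre over `σ + 2`. -/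
def coord (σ : ℂ) : Fin 3 → LaurentPolynomial OL :=
  ![C (a + a'), C (a * (algebraMap ℂ OL σ - (a - a') ^ 2) * w') * T (-1) - C (a' * w') * T 1,
    C ((algebraMap ℂ OL σ - (a - a') ^ 2) * w') * T (-1) - C w' * T 1]

theorem C_mul_eq_one {r s : OL} (h : r * s = 1) :
    (C r * C s : LaurentPolynomial OL) = 1 := by rw [← map_mul, h, map_one]

theorem T_mul_T_neg : (T 1 * T (-1) : LaurentPolynomial OL) = 1 := by rw [← T_add]; simp

/-- The coordinates solve x₂ - a x₃ = T and x₂ - x₃/a = (σ - (a - 1/a)²)/T, the two factors of the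
fibre equation for x₁ = a + 1/a. -/
theorem coord_relation (σ : ℂ) : -2 + coord σ 0 ^ 2 + coord σ 1 ^ 2
    - coord σ 0 * coord σ 1 * coord σ 2 + coord σ 2 ^ 2 = C (algebraMap ℂ OL (σ + 2)) := by
  have ha := C_mul_eq_one a_mul
  have hw := C_mul_eq_one w_mul
  have hp := T_mul_T_neg
  simp only [coord, Matrix.cons_val, map_mul, map_sub, map_add, map_pow, map_ofNat] at *
  generalize (C a : LaurentPolynomial OL) = A at *
  generalize (C a' : LaurentPolynomial OL) = A' at *
  generalize (C w' : LaurentPolynomial OL) = w at *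
  generalize (C (algebraMap ℂ OL σ) : LaurentPolynomial OL) = s at *
  generalize (T 1 : LaurentPolynomial OL) = p at *
  generalize (T (-1) : LaurentPolynomial OL) = q at *
  grind

/-- Equivalently, dx₁ ∧ dx₂ ∧ dx₃ / dt is da/a ∧ dT/T in the chart. This is the hypothesis of
`algebraMap_sum_curl_mul_gradT`. -/
theorem bracket_coord (σ : ℂ) (j : Fin 3) :
    bracket (coeffDer θ) eulerDer (coord σ j) (coord σ (j + 1)) =
      2 * coord σ (j + 2) - coord σ j * coord σ (j + 1) := by
  have ha := C_mul_eq_one a_mul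
  have hw := C_mul_eq_one w_mul
  have hp := T_mul_T_neg
  have hθσ : θ (algebraMap ℂ OL σ) = 0 := Derivation.map_algebraMap _ _
  fin_cases j <;> simp only [bracket, coord, Matrix.cons_val, map_mul, map_sub, map_add, map_pow,
    map_ofNat,
    Derivation.leibniz, Derivation.leibniz_pow, coeffDer_C, eulerDer_C, coeffDer_T, eulerDer_T,
    θ_a, θ_a', θ_w', hθσ, smul_eq_mul, Fin.isValue, Fin.reduceAdd, Fin.zero_eta,
    Fin.mk_one, Fin.reduceFinMk, zero_add, map_neg, map_zero, Int.cast_one, Int.cast_neg, map_one] at *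
  all_goals
    generalize (C a : LaurentPolynomial OL) = A at *
    generalize (C a' : LaurentPolynomial OL) = A' at *
    generalize (C w' : LaurentPolynomial OL) = w at *
    generalize (C (algebraMap ℂ OL σ) : LaurentPolynomial OL) = s at *
    generalize (T 1 : LaurentPolynomial OL) = p at *
    generalize (T (-1) : LaurentPolynomial OL) = q at *
  all_goals grind

theorem constTerm_coord (σ : ℂ) (j : Fin 3) :
    constTerm OL (coord σ j) = if j = 0 then a + a' else 0 := by
  have hT : ∀ n : ℤ, n ≠ 0 → constTerm OL (T n) = 0 := fun n hn => by
    simpa [hn] using constTerm_C_mul_T (1 : OL) n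
  fin_cases j
  · exact constTerm_C _
  · simp [coord, constTerm_C_mul, hT, -map_mul]
  · simp [coord, constTerm_C_mul, hT, -map_mul]

theorem constTerm_coord_zero_sq (σ : ℂ) : constTerm OL (coord σ 0 ^ 2) = (a + a') ^ 2 := by
  change constTerm OL (C (a + a') ^ 2) = _
  rw [← map_pow, constTerm_C]

section Specialization

variable {σ z : ℂ} (hz : z ^ 3 - z ≠ 0) (h : (z - z⁻¹) ^ 2 = σ)

include h in
theorem ev_sub_sq : ev hz (algebraMap ℂ OL σ - (a - a') ^ 2) = 0 := by
  rw [map_sub, map_pow, map_sub, ev_a, ev_a', ev_const, h, sub_self]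

theorem mapCoeff_polar {r : OL} (hr : ev hz r = 0) (r' : OL) :
    mapCoeff (ev hz) (C r * T (-1) - C r' * T 1) =
      Polynomial.toLaurent (-Polynomial.C (ev hz r') * Polynomial.X) := by
  rw [map_sub, map_mul, map_mul, mapCoeff_C, mapCoeff_C, mapCoeff_T, mapCoeff_T, hr]
  simp

theorem mapCoeff_eulerDer_polar {r : OL} (hr : ev hz r = 0) (r' : OL) :
    mapCoeff (ev hz) (eulerDer (k := ℂ) (C r * T (-1) - C r' * T 1)) = C (-ev hz r') * T 1 := by
  rw [map_sub, eulerDer_C_mul_T, eulerDer_C_mul_T, map_sub, map_mul _ _ (T (-1)), map_mul _ _ (T 1),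
    mapCoeff_C, mapCoeff_C, mapCoeff_T, mapCoeff_T, map_mul (ev hz), hr]
  simp

include h in
/-- At the zeros of `σ - (a - 1/a)²`, the coordinates have no pole in `T`. -/
theorem mapCoeff_coord (j : Fin 3) :
    ∃ p : Polynomial ℂ, mapCoeff (ev hz) (coord σ j) = Polynomial.toLaurent p := by
  have hs := ev_sub_sq hz h
  fin_cases j
  · exact ⟨Polynomial.C (ev hz (a + a')), by
      simp only [coord, Matrix.cons_val, mapCoeff_C, Polynomial.toLaurent_C, Fin.zero_eta,
        Fin.isValue]⟩
  · exact ⟨_, mapCoeff_polar hz (by rw [map_mul, map_mul, hs, mul_zero, zero_mul]) _⟩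
  · exact ⟨_, mapCoeff_polar hz (by rw [map_mul, hs, zero_mul]) _⟩

include h in
theorem mapCoeff_eulerDer_coord (j : Fin 3) :
    ∃ c : ℂ, mapCoeff (ev hz) (eulerDer (k := ℂ) (coord σ j)) = C c * T 1 := by
  have hs := ev_sub_sq hz h
  fin_cases j
  · exact ⟨0, (congrArg _ (eulerDer_C (a + a'))).trans (by simp)⟩
  · exact ⟨_, mapCoeff_eulerDer_polar hz (by rw [map_mul, map_mul, hs, mul_zero, zero_mul]) _⟩
  · exact ⟨_, mapCoeff_eulerDer_polar hz (by rw [map_mul, hs, zero_mul]) _⟩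

end Specialization

end Chart

section Evaluation

variable {y₀ : ℂ} (h₂ : y₀ ≠ 2) (hm : y₀ ≠ -2)

include h₂ hm in
theorem eval_psi_ne_zero : psi.eval y₀ ≠ 0 := by
  have : psi.eval y₀ = (y₀ - 2) * (y₀ - -2) := by simp [psi]; ring
  rw [this]
  exact mul_ne_zero (sub_ne_zero.2 h₂) (sub_ne_zero.2 hm)

include h₂ hm in
theorem isUnit_aeval_psi : IsUnit (Polynomial.aeval (R := ℂ) y₀ psi) := by
  simpa [Polynomial.coe_aeval_eq_eval] using eval_psi_ne_zero h₂ hm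

/-- The evaluation at a point of `Y`. -/
def evY : OY →+* ℂ :=
  IsLocalization.Away.lift psi (g := (Polynomial.aeval (R := ℂ) y₀).toRingHom)
    (isUnit_aeval_psi h₂ hm)

theorem evY_algebraMap (p : Polynomial ℂ) : evY h₂ hm (algebraMap _ OY p) = p.eval y₀ := by
  rw [evY, IsLocalization.Away.lift_eq]
  simp [Polynomial.coe_aeval_eq_eval]

end Evaluation

theorem eq_zero_of_evY {c : OY} (h : ∀ y₀ (h₂ : y₀ ≠ 2) (hm : y₀ ≠ -2), evY h₂ hm c = 0) :
    c = 0 := by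
  obtain ⟨n, p, hp⟩ := IsLocalization.Away.surj psi c
  have h0 : p = 0 := by
    refine Polynomial.eq_zero_of_infinite_isRoot p
      (Set.Infinite.mono (s := ({2, -2} : Set ℂ)ᶜ) ?_ (Set.toFinite _).infinite_compl)
    intro y₀ hy
    simp only [Set.mem_compl_iff, Set.mem_insert_iff, Set.mem_singleton_iff, not_or] at hy
    have := congrArg (evY hy.1 hy.2) hp
    rw [map_mul, h, zero_mul, evY_algebraMap] at this
    exact this.symm
  rw [h0, map_zero] at hp
  exact (((IsLocalization.Away.algebraMap_isUnit (S := OY) psi).pow n).mul_left_eq_zero).1 hp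

namespace Chart

open LaurentPolynomial OL

theorem const_eq (c : ℂ) : algebraMap ℂ (LaurentPolynomial OL) c = C (algebraMap ℂ OL c) := by
  rw [IsScalarTower.algebraMap_apply ℂ OL (LaurentPolynomial OL), C_eq_algebraMap]

theorem aeval_coord_t (σ : ℂ) (k : Fin 3) :
    MvPolynomial.aeval (fun j => coord σ (j + k)) t =
      algebraMap ℂ (LaurentPolynomial OL) (σ + 2) := by
  rw [const_eq, ← coord_relation]
  fin_cases k <;> simp [t] <;> ring

variable {y₀ : ℂ} (h₂ : y₀ ≠ 2) (hm : y₀ ≠ -2) (k : Fin 3)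

include h₂ hm in
theorem isUnit_aeval_coord : IsUnit ((MvPolynomial.aeval (R := ℂ) fun j => coord (y₀ - 2) (j + k))
    (Polynomial.aeval t psi)) := by
  rw [← Polynomial.aeval_algHom_apply, aeval_coord_t, sub_add_cancel,
    Polynomial.aeval_algebraMap_apply]
  exact (isUnit_aeval_psi h₂ hm).map _

/-- A chart of the fibre over `y₀`. -/
def chart : OX →+* LaurentPolynomial OL :=
  IsLocalization.Away.lift (Polynomial.aeval t psi)
    (g := (MvPolynomial.aeval (R := ℂ) fun j => coord (y₀ - 2) (j + k)).toRingHom)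
    (isUnit_aeval_coord h₂ hm k)

theorem chart_algebraMap (p : MvPolynomial (Fin 3) ℂ) :
    chart h₂ hm k (algebraMap _ OX p) = MvPolynomial.aeval (fun j => coord (y₀ - 2) (j + k)) p := by
  rw [chart, IsLocalization.Away.lift_eq]
  rfl

theorem chart_x (j : Fin 3) : chart h₂ hm k (x j) = coord (y₀ - 2) (j + k) := by
  rw [x, chart_algebraMap, MvPolynomial.aeval_X]

theorem chart_const (c : ℂ) : chart h₂ hm k (algebraMap ℂ OX c) = algebraMap ℂ _ c := by
  rw [IsScalarTower.algebraMap_apply ℂ (MvPolynomial (Fin 3) ℂ) OX, chart_algebraMap]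
  simp

theorem chart_base (c : OY) :
    chart h₂ hm k (algebraMap OY OX c) = algebraMap ℂ _ (evY h₂ hm c) := by
  have : (chart h₂ hm k).comp (algebraMap OY OX) =
      (algebraMap ℂ (LaurentPolynomial OL)).comp (evY h₂ hm) := by
    refine IsLocalization.ringHom_ext (Submonoid.powers psi) (RingHom.ext fun p => ?_)
    simp only [RingHom.comp_apply]
    rw [evY_algebraMap, algebraMap_algebraMap, chart_algebraMap, ← Polynomial.aeval_algHom_apply,
      aeval_coord_t, sub_add_cancel, Polynomial.aeval_algebraMap_apply, Polynomial.coe_aeval_eq_eval]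
  exact congrArg (fun f => f c) this

theorem mapCoeff_const {z : ℂ} (hz : z ^ 3 - z ≠ 0) (c : ℂ) :
    mapCoeff (ev hz) (algebraMap ℂ _ c) = C c := by
  rw [const_eq, mapCoeff_C, ev_const]

theorem mapCoeff_chart {z : ℂ} (hz : z ^ 3 - z ≠ 0) (h : (z - z⁻¹) ^ 2 = y₀ - 2) (f : OX) :
    ∃ p : Polynomial ℂ, mapCoeff (ev hz) (chart h₂ hm k f) = Polynomial.toLaurent p := by
  have h1 : ∀ q : MvPolynomial (Fin 3) ℂ, mapCoeff (ev hz) (chart h₂ hm k (algebraMap _ OX q)) ∈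
      (Polynomial.toLaurent (R := ℂ)).range := fun q => by
    rw [chart_algebraMap]
    induction q using MvPolynomial.induction_on with
    | C c =>
      rw [MvPolynomial.algHom_C, mapCoeff_const]
      exact ⟨Polynomial.C c, Polynomial.toLaurent_C c⟩
    | add p q hp hq => rw [map_add, map_add]; exact add_mem hp hq
    | mul_X p j hp =>
      rw [map_mul, map_mul, MvPolynomial.aeval_X]
      obtain ⟨q, hq⟩ := mapCoeff_coord hz h (j + k)
      exact mul_mem hp ⟨q, hq.symm⟩
  obtain ⟨n, q, hq⟩ := exists_algebraMap_mul f
  obtain ⟨p, hp⟩ := h1 q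
  obtain ⟨e, he⟩ := (isUnit_y_sq_sub.pow n).exists_left_inv
  have h2 : chart h₂ hm k f =
      chart h₂ hm k (algebraMap OY OX e) * chart h₂ hm k (algebraMap _ OX q) := by
    rw [← map_mul, ← hq, ← mul_assoc, ← map_mul, he, map_one, one_mul]
  refine ⟨Polynomial.C (evY h₂ hm e) * p, ?_⟩
  rw [h2, map_mul, ← hp, chart_base, mapCoeff_const, map_mul, Polynomial.toLaurent_C]

/-- At these z the chart of f is a polynomial in T and T d/dT of a coordinate is a multiple of T, so
the product has only positive powers. -/
theorem ev_constTerm_eq_zero {z : ℂ} (hz : z ^ 3 - z ≠ 0) (h : (z - z⁻¹) ^ 2 = y₀ - 2) (f : OX)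
    (j : Fin 3) : ev hz (constTerm OL (chart h₂ hm k f *
      eulerDer (k := ℂ) (coord (y₀ - 2) j))) = 0 := by
  obtain ⟨p, hp⟩ := mapCoeff_chart h₂ hm k hz h f
  obtain ⟨c, hc⟩ := mapCoeff_eulerDer_coord hz h j
  rw [← constTerm_mapCoeff, map_mul, hp, hc, mul_left_comm, constTerm_C_mul,
    constTerm_toLaurent_mul_T, mul_zero]

/-- The constant term of a function whose class is zero is the derivative of a function that
vanishes at four points. -/
theorem exists_constTerm_chart {f : OX} (hf : cls f = 0) : ∃ h : OL,
    constTerm OL (chart h₂ hm k f) = θ h ∧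
    ∀ z (hz : z ^ 3 - z ≠ 0), (z - z⁻¹) ^ 2 = y₀ - 2 → ev hz h = 0 := by
  obtain ⟨W, rfl⟩ := cls_eq_zero.1 hf
  refine ⟨∑ i, constTerm OL (chart h₂ hm k (W i) * eulerDer (k := ℂ) (coord (y₀ - 2) (i + k))),
    ?_, fun z hz h => ?_⟩
  · let _ : Algebra OX (LaurentPolynomial OL) := (chart h₂ hm k).toAlgebra
    have : IsScalarTower ℂ OX (LaurentPolynomial OL) :=
      IsScalarTower.of_algebraMap_eq fun c => (chart_const h₂ hm k c).symm
    have e : ∀ f, algebraMap OX (LaurentPolynomial OL) f = chart h₂ hm k f := fun _ => rfl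
    rw [← e, algebraMap_sum_curl_mul_gradT (D₁ := coeffDer θ) (D₂ := eulerDer), map_sum, map_sum]
    · refine Finset.sum_congr rfl fun i _ => ?_
      rw [bracket, e, e, chart_x, constTerm_bracket]
    · intro j
      simp only [e, gradT, map_sub, map_mul, map_ofNat, chart_x]
      rw [add_right_comm j 1 k, bracket_coord]
      have h1 : ∀ j k : Fin 3, j + k + 2 = j + 2 + k := by decide
      have h2 : ∀ j k : Fin 3, j + k = j + 2 + 1 + k := by decide
      have h3 : ∀ j k : Fin 3, j + k + 1 = j + 2 + 2 + k := by decide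
      rw [← h1, ← h2, ← h3]
  · rw [map_sum]
    exact Finset.sum_eq_zero fun i _ => ev_constTerm_eq_zero h₂ hm k hz h _ _

end Chart

/-! ### Linear independence of the five monomial classes -/

open Chart OL LaurentPolynomial in
theorem linearIndependent_cls : LinearIndependent OY fun i => cls (gens i) := by
  rw [Fintype.linearIndependent_iff]
  intro c hc
  simp only [← Algebra.smul_def, ← map_smul, ← map_sum] at hc
  have key : ∀ y₀ (h₂ : y₀ ≠ 2) (hm : y₀ ≠ -2) (k : Fin 3), ∃ h : OL,
      θ h = ∑ i, algebraMap ℂ OL (evY h₂ hm (c i)) * constTerm OL (chart h₂ hm k (gens i)) ∧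
      ∀ z (hz : z ^ 3 - z ≠ 0), (z - z⁻¹) ^ 2 = y₀ - 2 → ev hz h = 0 := by
    intro y₀ h₂ hm k
    obtain ⟨h, h1, h2⟩ := exists_constTerm_chart h₂ hm k hc
    refine ⟨h, ?_, h2⟩
    rw [← h1, map_sum, map_sum]
    refine Finset.sum_congr rfl fun i _ => ?_
    rw [Algebra.smul_def, map_mul, chart_base, const_eq, constTerm_C_mul]
  have h1 : constTerm OL 1 = (1 : OL) := by
    rw [← map_one (C : OL →+* _), constTerm_C]
  have hσ : ∀ {y₀ : ℂ}, y₀ ≠ 2 → y₀ - 2 ≠ 0 := fun h => sub_ne_zero.2 h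
  have hσ' : ∀ {y₀ : ℂ}, y₀ ≠ -2 → y₀ - 2 + 4 ≠ 0 := fun h h0 =>
    h (by linear_combination h0)
  have k0 : ∀ y₀ (h₂ : y₀ ≠ 2) (hm : y₀ ≠ -2),
      evY h₂ hm (c 0) = 0 ∧ evY h₂ hm (c 1) = 0 ∧ evY h₂ hm (c 4) = 0 := by
    intro y₀ h₂ hm
    obtain ⟨h, e, h0⟩ := key y₀ h₂ hm 0
    refine eq_zero_of_θ_eq_poly (hσ h₂) (hσ' hm) (e.trans ?_) h0
    simp [Fin.sum_univ_five, gens, chart_x, constTerm_coord, constTerm_coord_zero_sq, h1]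
  have c0 : c 0 = 0 := eq_zero_of_evY fun y₀ h₂ hm => (k0 y₀ h₂ hm).1
  have c1 : c 1 = 0 := eq_zero_of_evY fun y₀ h₂ hm => (k0 y₀ h₂ hm).2.1
  have c4 : c 4 = 0 := eq_zero_of_evY fun y₀ h₂ hm => (k0 y₀ h₂ hm).2.2
  -- The unrotated chart does not see x₂ and x₃, whose constant terms vanish. The rotation k = 1
  -- sends x₃ to a + 1/a, and k = 2 sends x₂ there.
  have c3 : c 3 = 0 := eq_zero_of_evY fun y₀ h₂ hm => by
    obtain ⟨h, e, h0⟩ := key y₀ h₂ hm 1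
    refine (eq_zero_of_θ_eq_poly (m₀ := 0) (m₄ := 0) (hσ h₂) (hσ' hm) (e.trans ?_) h0).2.1
    simp [Fin.sum_univ_five, gens, chart_x, constTerm_coord, c0, c1, c4]
  have c2 : c 2 = 0 := eq_zero_of_evY fun y₀ h₂ hm => by
    obtain ⟨h, e, h0⟩ := key y₀ h₂ hm 2
    refine (eq_zero_of_θ_eq_poly (m₀ := 0) (m₄ := 0) (hσ h₂) (hσ' hm) (e.trans ?_) h0).2.1
    simp [Fin.sum_univ_five, gens, chart_x, constTerm_coord, c0, c1, c4]
  intro i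
  fin_cases i <;> assumption

end OneHoledTorus

/-! ### Change of basis from the monomials to B -/

section Basis

variable {A H : Type*} [CommRing A] [Algebra ℂ A] [AddCommGroup H] [Module A H] {T s u v : A}
  {m b : Fin 5 → H}

/-- The relations between two families of classes. -/
structure IsMarkovBasis (T s : A) (m b : Fin 5 → H) : Prop where
  r0 : b 0 = T • m 0 - m 4
  r1 : (3 : A) • b 1 = (4 * s) • m 1
  r2 : (3 : A) • b 2 = (2 * s) • m 2
  r3 : (3 : A) • b 3 = (2 * s) • m 3
  r4 : (2 : A) • b 4 = (3 * (s - 2)) • m 4 + (6 * T) • m 0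

namespace IsMarkovBasis

theorem isUnit_ofNat (n : ℕ) [n.AtLeastTwo] : IsUnit (OfNat.ofNat n : A) := by
  have := (IsUnit.mk0 (OfNat.ofNat n : ℂ) (OfNat.ofNat_ne_zero n)).map (algebraMap ℂ A)
  rwa [map_ofNat] at this

omit [Algebra ℂ A] in
theorem r5 (h : IsMarkovBasis T s m b) : (2 : A) • b 4 - (6 : A) • b 0 = (3 * s) • m 4 := by
  rw [h.r4, h.r0]; module

/-- The transition matrix is diagonal with unit entries on the indices 1, 2, 3 and has determinant
3Ts/2 on the indices 0, 4. -/
theorem span_eq_top (h : IsMarkovBasis T s m b) (hT : IsUnit T) (hs : IsUnit s)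
    (hm : Submodule.span A (Set.range m) = ⊤) : Submodule.span A (Set.range b) = ⊤ := by
  set N := Submodule.span A (Set.range b)
  have hb : ∀ i, b i ∈ N := fun i => Submodule.subset_span ⟨i, rfl⟩
  have m4 : m 4 ∈ N := by
    refine mem_of_isUnit_smul_mem ((isUnit_ofNat 3).mul hs) ?_
    rw [← h.r5]
    exact N.sub_mem (N.smul_mem _ (hb _)) (N.smul_mem _ (hb _))
  have m0 : m 0 ∈ N := by
    refine mem_of_isUnit_smul_mem hT ?_
    rw [show T • m 0 = b 0 + m 4 by rw [h.r0]; abel]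
    exact N.add_mem (hb _) m4
  have m1 : m 1 ∈ N := mem_of_isUnit_smul_mem ((isUnit_ofNat 4).mul hs)
    (h.r1 ▸ N.smul_mem _ (hb _))
  have m2 : m 2 ∈ N := mem_of_isUnit_smul_mem ((isUnit_ofNat 2).mul hs)
    (h.r2 ▸ N.smul_mem _ (hb _))
  have m3 : m 3 ∈ N := mem_of_isUnit_smul_mem ((isUnit_ofNat 2).mul hs)
    (h.r3 ▸ N.smul_mem _ (hb _))
  rw [eq_top_iff, ← hm, Submodule.span_le]
  rintro _ ⟨i, rfl⟩
  fin_cases i <;> assumption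

theorem linearIndependent (h : IsMarkovBasis T s m b) (hT : IsUnit T) (hs : IsUnit s)
    (hm : LinearIndependent A m) : LinearIndependent A b := by
  rw [Fintype.linearIndependent_iff] at *
  intro c hc
  -- The relation among the b i, multiplied by 6 to clear denominators and rewritten in the m i.
  have e := hm ![6 * T * c 0 + 18 * T * c 4, 8 * s * c 1, 4 * s * c 2, 4 * s * c 3,
    9 * (s - 2) * c 4 - 6 * c 0] (by
      simp only [Fin.sum_univ_five, Matrix.cons_val] at hc ⊢
      linear_combination (norm := module) (6 : A) • hc - (6 * c 0) • h.r0 - (2 * c 1) • h.r1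
        - (2 * c 2) • h.r2 - (2 * c 3) • h.r3 - (3 * c 4) • h.r4)
  have e0 := e 0
  have e1 := e 1
  have e2 := e 2
  have e3 := e 3
  have e4 := e 4
  simp only [Matrix.cons_val] at e0 e1 e2 e3 e4
  have c1 : c 1 = 0 := (((isUnit_ofNat 8).mul hs).mul_right_eq_zero).1 e1
  have c2 : c 2 = 0 := (((isUnit_ofNat 4).mul hs).mul_right_eq_zero).1 e2
  have c3 : c 3 = 0 := (((isUnit_ofNat 4).mul hs).mul_right_eq_zero).1 e3
  have e0' : c 0 + 3 * c 4 = 0 := (((isUnit_ofNat 6).mul hT).mul_right_eq_zero).1 (by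
    linear_combination e0)
  have c4 : c 4 = 0 := (((isUnit_ofNat 9).mul hs).mul_right_eq_zero).1 (by
    linear_combination e4 + 6 * e0')
  have c0 : c 0 = 0 := by rw [c4] at e0'; simpa using e0'
  intro i
  fin_cases i <;> assumption

/-- The classes of the divergences in terms of the basis. -/
theorem sum_E (h : IsMarkovBasis T s m b) (hs : u * s = 1) (hT : v * T = 1) (hTs : T = s + 4)
    (i : Fin 5) : ∑ j, OneHoledTorus.E u v i j • b j =
      (![1, 2, 1, 1, 3] i : A) • m i := by
  have c1 : (algebraMap ℂ A (1 / 6)) * 6 = 1 := by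
    rw [← map_ofNat (algebraMap ℂ A) 6, ← map_mul]; norm_num
  have c2 : algebraMap ℂ A (3 / 2) = 9 * algebraMap ℂ A (1 / 6) := by
    rw [← map_ofNat (algebraMap ℂ A) 9, ← map_mul]; norm_num
  have c3 : algebraMap ℂ A (-1 / 2) = -3 * algebraMap ℂ A (1 / 6) := by
    rw [← map_ofNat (algebraMap ℂ A) 3, ← map_neg, ← map_mul]; norm_num
  have c4 : algebraMap ℂ A (-1 / 6) = -algebraMap ℂ A (1 / 6) := by
    rw [← map_neg]; norm_num
  have c5 : algebraMap ℂ A (-6) = -6 := by rw [map_neg, map_ofNat]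
  have c6 : algebraMap ℂ A 2 = 2 := by rw [map_ofNat]
  have hs' : ∀ p : H, (u * s) • p = p := fun p => by rw [hs, one_smul]
  have hT' : ∀ p : H, (v * T) • p = p := fun p => by rw [hT, one_smul]
  have he' : ∀ p : H, (algebraMap ℂ A (1 / 6) * 6) • p = p := fun p => by rw [c1, one_smul]
  have r5 := h.r5
  obtain ⟨r0, r1, r2, r3, r4⟩ := h
  -- The factor 12 absorbs the rational coefficients. Since `module` knows nothing of us = 1, vT = 1
  -- and 6e = 1, these enter through `hs'`, `hT'`, `he'` applied to chosen vectors.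
  apply (isUnit_ofNat (A := A) 12).smul_left_cancel.1
  subst hTs
  fin_cases i <;>
    simp only [Fin.sum_univ_five, OneHoledTorus.E, Matrix.of_apply, Matrix.cons_val,
      Algebra.smul_def, c2, c3, c4, c5, c6, zero_smul, zero_add, add_zero, Fin.zero_eta,
      Fin.mk_one, Fin.reduceFinMk, Fin.isValue] <;>
    generalize algebraMap ℂ A (1 / 6) = e at *
  · linear_combination (norm := module) (2 : A) • he' ((9 * v - 3 * u) • b 0 + (u - v) • b 4)
      + (u - v) • r5 + (12 * v) • r0 + (12 : A) • hT' (m 0) + (3 : A) • hs' (m 4)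
      - (3 : A) • hT' (m 4)
  · linear_combination (norm := module) (2 : A) • he' ((9 * u) • b 1) + (6 * u) • r1
      + (24 : A) • hs' (m 1)
  · linear_combination (norm := module) (2 : A) • he' ((9 * u) • b 2) + (6 * u) • r2
      + (12 : A) • hs' (m 2)
  · linear_combination (norm := module) (2 : A) • he' ((9 * u) • b 3) + (6 * u) • r3
      + (12 : A) • hs' (m 3)
  · linear_combination (norm := module) (12 * u) • r5 + (36 : A) • hs' (m 4)

omit [Algebra ℂ A] in
theorem of_isMarkov [Invertible (2 : A)] {M : ℕ → ℕ → ℕ → H} (h : IsMarkov T M) (hT : T = s + 4)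
    (h0 : m 0 = M 0 0 0) (h1 : m 1 = M 1 0 0) (h2 : m 2 = M 0 1 0) (h3 : m 3 = M 0 0 1)
    (h4 : m 4 = M 2 0 0) (b0 : b 0 = (2 : A) • M 2 0 0 - M 1 1 1)
    (b1 : b 1 = (2 : A) • M 3 0 0 - M 2 1 1) (b2 : b 2 = (2 : A) • M 2 1 0 - M 1 2 1)
    (b3 : b 3 = (2 : A) • M 2 0 1 - M 1 1 2) (b4 : b 4 = (2 : A) • M 4 0 0 - M 3 1 1) :
    IsMarkovBasis T s m b where
  r0 := by rw [b0, h.class_one, h0, h4]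
  r1 := by rw [b1, h.class_x, h1, hT, add_sub_cancel_right]
  r2 := by rw [b2, h.class_y, h2, hT, add_sub_cancel_right]
  r3 := by rw [b3, h.class_z, h3, hT, add_sub_cancel_right]
  r4 := by
    rw [b4, h.class_sq, h0, h4, hT]
    congr 3
    ring

end IsMarkovBasis

end Basis

namespace OneHoledTorus

theorem cls_two_mul_sub {p q r : OX} (e : p = 2 * q - r) : cls p = (2 : OY) • cls q - cls r := by
  have h2 : algebraMap OY OX 2 = 2 := map_ofNat _ 2
  rw [e, algebraMap_smul_cls, h2, map_sub]

instance : Invertible (2 : OY) := (IsMarkovBasis.isUnit_ofNat 2).invertible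

theorem isMarkovBasis : IsMarkovBasis (y + 2) (y - 2) (fun i => cls (gens i))
    fun i => cls (gens i * x 0 * gradT 0) := by
  obtain ⟨e0, e1, e2, e3, e4⟩ := mono_eq_gens
  refine IsMarkovBasis.of_isMarkov isMarkov (by ring) (congrArg cls e0.symm)
    (congrArg cls e1.symm) (congrArg cls e2.symm) (congrArg cls e3.symm) (congrArg cls e4.symm)
    (cls_two_mul_sub ?_) (cls_two_mul_sub ?_) (cls_two_mul_sub ?_) (cls_two_mul_sub ?_)
    (cls_two_mul_sub ?_) <;> simp [gens, mono, gradT] <;> ring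

/-- The basis of the cohomology. -/
def basisH2 : Module.Basis (Fin 5) OY H2 :=
  Module.Basis.mk
    (isMarkovBasis.linearIndependent (isUnit_of_mul_isUnit_right isUnit_y_sq_sub)
      (isUnit_of_mul_isUnit_left isUnit_y_sq_sub) linearIndependent_cls)
    (isMarkovBasis.span_eq_top (isUnit_of_mul_isUnit_right isUnit_y_sq_sub)
      (isUnit_of_mul_isUnit_left isUnit_y_sq_sub) span_cls).ge

theorem basisH2_apply (i : Fin 5) : basisH2 i = cls (gens i * x 0 * gradT 0) := by
  rw [basisH2, Module.Basis.mk_apply]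

end OneHoledTorus

/-! ### Connections with a given matrix -/

section Connection

variable {k A H ι : Type*} [CommRing k] [CommRing A] [Algebra k A] [AddCommGroup H] [Module A H]
  [Module k H] [IsScalarTower k A H] [Fintype ι]

/-- The connection `d + E dy` in the basis `b`. -/
def connection (b : Module.Basis ι A H) (E : Matrix ι ι A) (y : A) : H →ₗ[k] Ω[A⁄k] ⊗[A] H :=
  ∑ i, ((((TensorProduct.mk A Ω[A⁄k] H).flip (b i)).restrictScalars k ∘ₗ
      (KaehlerDifferential.D k A).toLinearMap) +
    (LinearMap.toSpanSingleton A _ (KaehlerDifferential.D k A y ⊗ₜ[A]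
      ∑ j, E i j • b j)).restrictScalars k) ∘ₗ (b.coord i).restrictScalars k

theorem connection_sum (b : Module.Basis ι A H) (E : Matrix ι ι A) (y : A) (c : ι → A) :
    connection (k := k) b E y (∑ i, c i • b i) =
      ∑ i, KaehlerDifferential.D k A (c i) ⊗ₜ[A] b i +
      ∑ i, ∑ j, (c i * E i j) • (KaehlerDifferential.D k A y ⊗ₜ[A] b j) := by
  have h : ∀ i, b.coord i (∑ i, c i • b i) = c i := fun i => by
    rw [Module.Basis.coord_apply, b.repr_sum_self]
  rw [connection, LinearMap.sum_apply, ← Finset.sum_add_distrib]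
  refine Finset.sum_congr rfl fun i _ => ?_
  simp only [LinearMap.comp_apply, LinearMap.add_apply, LinearMap.restrictScalars_apply, h,
    LinearMap.flip_apply, TensorProduct.mk_apply, LinearMap.toSpanSingleton_apply,
    TensorProduct.tmul_sum, Finset.smul_sum, mul_smul, TensorProduct.tmul_smul]
  rfl

theorem connection_sum_of_D_eq (b : Module.Basis ι A H) (E : Matrix ι ι A) {y : A} {δ : A → A}
    (hδ : ∀ c, KaehlerDifferential.D k A c = δ c • KaehlerDifferential.D k A y) (c : ι → A) :
    connection (k := k) b E y (∑ i, c i • b i) =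
      KaehlerDifferential.D k A y ⊗ₜ[A] ∑ i, (δ (c i) • b i + c i • ∑ j, E i j • b j) := by
  rw [connection_sum, TensorProduct.tmul_sum, ← Finset.sum_add_distrib]
  refine Finset.sum_congr rfl fun i _ => ?_
  rw [hδ, TensorProduct.smul_tmul, TensorProduct.tmul_add, Finset.smul_sum, TensorProduct.tmul_sum]
  congr 1
  refine Finset.sum_congr rfl fun j _ => ?_
  rw [TensorProduct.tmul_smul, TensorProduct.tmul_smul, mul_smul]

end Connection

/-! ### The Gauss–Manin connection as a divergence -/

namespace OneHoledTorus

theorem D_eq_smul (c : OY) :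
    KaehlerDifferential.D ℂ OY c = dY c • KaehlerDifferential.D ℂ OY y := by
  have : KaehlerDifferential.D ℂ OY =
      (LinearMap.toSpanSingleton OY _ (KaehlerDifferential.D ℂ OY y)).compDer dY := by
    apply derivation_OY_ext
    simp [dY_y]
  have := congrArg (fun D => D c) this
  simpa using this

/-- The cross product of vector fields. -/
def cross (V W : Fin 3 → OX) (k : Fin 3) : OX := V (k + 1) * W (k + 2) - V (k + 2) * W (k + 1)

theorem div_curl (W : Fin 3 → OX) : div (curl W) = 0 := by
  have h : ∀ (i j : Fin 3) f, dX i (dX j f) = dX j (dX i f) := fun i j f => by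
    have : ⁅dX i, dX j⁆ = 0 := by
      apply derivation_OX_ext
      intro k
      rw [Derivation.commutator_apply, dX_x, dX_x]
      split_ifs <;> simp
    have := congrArg (fun D => D f) this
    rwa [Derivation.commutator_apply, Derivation.zero_apply, sub_eq_zero] at this
  simp only [div, curl, Fin.sum_univ_three, map_sub, Fin.isValue, Fin.reduceAdd]
  rw [h 1 0, h 2 0, h 2 1]
  ring

theorem div_cross_gradT (U : Fin 3 → OX) :
    div (cross gradT U) = -∑ k, curl U k * gradT k := by
  have h2 : ∀ i, dX i 2 = 0 := fun i => Derivation.map_natCast (dX i) 2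
  simp only [div, cross, curl, Fin.sum_univ_three, map_sub, Fin.isValue, Fin.reduceAdd,
    Derivation.leibniz, gradT, dX_x, h2, smul_eq_mul, Fin.reduceEq, if_true, if_false]
  simp
  ring

theorem div_sub (V W : Fin 3 → OX) : div (V - W) = div V - div W := by
  simp [div, Finset.sum_sub_distrib]

/-- A field V tangent to the fibres equals ∇t × (V × w) whenever w · ∇t = 1, by the triple product
formula. Its divergence is then -∇t · curl(V × w), a relation in H². -/
theorem exists_div_eq_sum_curl {V : Fin 3 → OX} (h : ∑ k, V k * gradT k = 0) :
    ∃ U, div V = ∑ k, curl U k * gradT k := by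
  have e : V = cross gradT (cross V bezout) := by
    have hb := sum_bezout
    rw [Fin.sum_univ_three] at h hb
    funext k
    fin_cases k <;> simp only [cross, Fin.isValue, Fin.reduceAdd, Fin.zero_eta, Fin.mk_one,
      Fin.reduceFinMk]
    · linear_combination bezout 0 * h - V 0 * hb
    · linear_combination bezout 1 * h - V 1 * hb
    · linear_combination bezout 2 * h - V 2 * hb
  have hn : ∀ W, curl (-W) = -curl W := fun W => by funext k; simp [curl]; ring
  refine ⟨-cross V bezout, ?_⟩
  rw [e, div_cross_gradT, ← e, hn]
  simp

/-- The vector fields `∑ c_i g_i x₁ ∂₁`. -/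
def field (c : Fin 5 → OY) : Fin 3 → OX :=
  Pi.single 0 (∑ i, algebraMap OY OX (c i) * (gens i * x 0))

theorem sum_field_mul_gradT (c : Fin 5 → OY) : ∑ k, field c k * gradT k =
    ∑ i, algebraMap OY OX (c i) * (gens i * x 0 * gradT 0) := by
  simp only [field, Fin.sum_univ_three, Pi.single_apply, Fin.isValue, if_true, Finset.sum_mul]
  simp [mul_assoc]

theorem dX_gens_mul (i : Fin 5) : dX 0 (gens i * x 0) = ![1, 2, 1, 1, 3] i * gens i := by
  fin_cases i <;> simp [gens, dX_x, Derivation.leibniz, Derivation.leibniz_pow] <;> ring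

theorem div_field (c : Fin 5 → OY) : div (field c) =
    ∑ i, (algebraMap OY OX (dY (c i)) * (gens i * x 0 * gradT 0) +
      algebraMap OY OX (c i) * (![1, 2, 1, 1, 3] i * gens i)) := by
  have : div (field c) = dX 0 (∑ i, algebraMap OY OX (c i) * (gens i * x 0)) := by
    simp [div, field, Fin.sum_univ_three, Pi.single_apply]
  rw [this, map_sum]
  refine Finset.sum_congr rfl fun i _ => ?_
  rw [Derivation.leibniz, dX_gens_mul, dX_algebraMap]
  simp only [smul_eq_mul]
  ring

section Cohomology

variable {H : Type*} [AddCommGroup H] [Module OY H] [Module ℂ H] [IsScalarTower ℂ OY H]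
  {φ : OX →ₗ[OY] H} {b : Module.Basis (Fin 5) OY H} {E : Matrix (Fin 5) (Fin 5) OY}

/-- Up to a curl and a field tangent to the fibres, V is the field ∑ c_i g_i x₁ ∂₁ given by the
coordinates of its class. A curl has divergence zero and a tangent field has divergence of class
zero, so only the explicit field counts. -/
theorem connection_apply (hφ : ∀ f, φ f = 0 ↔ ∃ W, f = ∑ k, curl W k * gradT k)
    (hb : ∀ i, b i = φ (gens i * x 0 * gradT 0))
    (hE : ∀ i, ∑ j, E i j • b j = (![1, 2, 1, 1, 3] i : OY) • φ (gens i)) (V : Fin 3 → OX) :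
    connection b E y (φ (∑ k, V k * gradT k)) =
      KaehlerDifferential.D ℂ OY y ⊗ₜ[OY] φ (div V) := by
  have hm : ∀ (c : OY) f, φ (algebraMap OY OX c * f) = c • φ f := fun c f => by
    rw [← Algebra.smul_def, map_smul]
  have hv : ∀ i, (![1, 2, 1, 1, 3] : Fin 5 → OX) i = algebraMap OY OX (![1, 2, 1, 1, 3] i) := by
    intro i
    fin_cases i
    · exact (map_one _).symm
    · exact (map_ofNat _ 2).symm
    · exact (map_one _).symm
    · exact (map_one _).symm
    · exact (map_ofNat _ 3).symm
  obtain ⟨c, hc⟩ : ∃ c : Fin 5 → OY, φ (∑ k, V k * gradT k) = ∑ i, c i • b i := ⟨_, (b.sum_repr _).symm⟩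
  have h0 : φ (∑ k, V k * gradT k - ∑ k, field c k * gradT k) = 0 := by
    rw [map_sub, hc, sum_field_mul_gradT, map_sum, sub_eq_zero]
    exact Finset.sum_congr rfl fun i _ => by rw [hm, hb]
  obtain ⟨W, hW⟩ := (hφ _).1 h0
  have h1 : ∑ k, (V - field c - curl W) k * gradT k = 0 := by
    simp only [Pi.sub_apply, sub_mul, Finset.sum_sub_distrib]
    rw [hW, sub_self]
  have h2 := (hφ _).2 (exists_div_eq_sum_curl h1)
  rw [div_sub, div_sub, div_curl, sub_zero, map_sub, sub_eq_zero] at h2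
  rw [hc, connection_sum_of_D_eq b E D_eq_smul, h2, div_field, map_sum]
  congr 1
  refine Finset.sum_congr rfl fun i _ => ?_
  rw [map_add, hm, ← hb, hm, hv, hm, hE]

end Cohomology

/-- The Gauss-Manin connection. -/
def gaussManin : H2 →ₗ[ℂ] Ω[OY⁄ℂ] ⊗[OY] H2 := connection basisH2 (E u v) y

theorem gaussManin_cls (V : Fin 3 → OX) : gaussManin (cls (∑ k, V k * gradT k)) =
    KaehlerDifferential.D ℂ OY y ⊗ₜ[OY] cls (div V) := by
  refine connection_apply (fun f => cls_eq_zero) basisH2_apply (fun i => ?_) V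
  refine Eq.trans ?_ (isMarkovBasis.sum_E u_mul v_mul (by ring) i)
  exact Finset.sum_congr rfl fun j _ => by rw [basisH2_apply]

theorem mul_dFun_y {w : Forms ℂ OX} {V W : Fin 3 → OX} (hw : w = form2 ℂ W)
    (h : d ℂ OX (form2 ℂ V) = w * dFun ℂ OX (algebraMap OY OX y)) :
    ∑ k, W k * gradT k = div V := by
  rw [hw, algebraMap_y, dFun_eq, d_form2] at h
  simp only [dX_tX] at h
  rw [form2_mul_form1] at h
  exact (vol_smul_injective h).symm

theorem isGaussManin_gaussManin : IsGaussManin ℂ OY OX 2 y gaussManin := by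
  intro ω hω w hw e h h' hh hh'
  obtain ⟨V, rfl⟩ := mem_degForms_two ℂ hω
  obtain ⟨W, rfl⟩ := mem_degForms_two ℂ hw
  have h1 := isClassOf_form2.1 hh
  have h2 := isClassOf_form2.1 hh'
  rw [mul_dFun_y rfl e] at h2
  subst h1 h2
  exact gaussManin_cls V

/-- The defining property determines the value on every class: the class of f lifts to the form with
coefficients f w, where w · ∇t = 1, and the differential of any such lift is a two-form wedge dt
because dx₁ ∧ dx₂ ∧ dx₃ is. -/
theorem eq_gaussManin {nabla : H2 →ₗ[ℂ] Ω[OY⁄ℂ] ⊗[OY] H2}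
    (hn : IsGaussManin ℂ OY OX 2 y nabla) : nabla = gaussManin := by
  refine LinearMap.ext fun h => ?_
  obtain ⟨f, rfl⟩ := cls_surjective h
  have hb : ∀ f : OX, ∑ k, (f • bezout) k * gradT k = f := fun f => by
    simp only [Pi.smul_apply, smul_eq_mul, mul_assoc]
    rw [← Finset.mul_sum, sum_bezout, mul_one]
  have e : d ℂ OX (form2 ℂ (f • bezout)) =
      form2 ℂ (div (f • bezout) • bezout) * dFun ℂ OX (algebraMap OY OX y) := by
    rw [algebraMap_y, dFun_eq, d_form2]
    simp only [dX_tX]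
    rw [form2_mul_form1, hb]
  have h1 : IsClassOf ℂ OY OX (cls f) (form2 ℂ (f • bezout)) :=
    isClassOf_form2.2 (congrArg cls (hb f).symm)
  have h2 : IsClassOf ℂ OY OX (cls (div (f • bezout))) (form2 ℂ (div (f • bezout) • bezout)) :=
    isClassOf_form2.2 (congrArg cls (hb (div (f • bezout))).symm)
  exact (hn _ (form2_mem ℂ _) _ (form2_mem ℂ _) e _ _ h1 h2).trans
    (isGaussManin_gaussManin _ (form2_mem ℂ _) _ (form2_mem ℂ _) e _ _ h1 h2).symm

theorem isClassOf_B (i : Fin 5) : IsClassOf ℂ OY OX (basisH2 i) (B i) := by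
  have e : B i = form2 ℂ (Pi.single 0 (gens i * x 0)) := by
    simp [B, form2, Fin.sum_univ_three, Pi.single_apply, gens, dx2, dx]
  rw [e, isClassOf_form2, basisH2_apply]
  congr 1
  simp [Fin.sum_univ_three, Pi.single_apply]

end OneHoledTorus

/-! ### Decomposition into horizontal submodules -/

section Blocks

variable {A H ι κ : Type*} [CommRing A] [AddCommGroup H] [Module A H]

theorem Module.Basis.isInternal_span_image [DecidableEq κ] (b : Module.Basis ι A H) (f : ι → κ) :
    DirectSum.IsInternal fun j : κ => Submodule.span A (b '' (f ⁻¹' {j})) := by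
  apply DirectSum.isInternal_submodule_of_iSupIndep_of_iSup_eq_top
  · intro j
    simp only [← Submodule.span_iUnion, ← Set.image_iUnion]
    refine b.linearIndependent.disjoint_span_image ?_
    rw [Set.disjoint_left]
    intro i hi hi'
    simp only [Set.mem_iUnion] at hi'
    obtain ⟨j', hj', hi'⟩ := hi'
    exact hj' (hi'.symm.trans hi)
  · rw [← Submodule.span_iUnion, ← Set.image_iUnion, ← Set.preimage_iUnion,
      Set.iUnion_of_singleton, Set.preimage_univ, Set.image_univ, b.span_eq]

theorem Module.Basis.exists_of_mem_span_image [Fintype ι] (b : Module.Basis ι A H) {s : Set ι}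
    {h : H} (hh : h ∈ Submodule.span A (b '' s)) :
    ∃ c : ι → A, (∀ i ∉ s, c i = 0) ∧ h = ∑ i, c i • b i := by
  refine ⟨b.repr h, fun i hi => ?_, (b.sum_repr h).symm⟩
  by_contra h0
  exact hi ((b.mem_span_image.1 hh) (Finsupp.mem_support_iff.2 h0))

variable {k : Type*} [CommRing k] [Algebra k A] [Module k H] [IsScalarTower k A H] [Fintype ι]

theorem isHorizontal_connection (b : Module.Basis ι A H) {E : Matrix ι ι A} {y : A} {s : Set ι}
    (hE : ∀ i ∈ s, ∀ j ∉ s, E i j = 0) :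
    IsHorizontal (connection (k := k) b E y) (Submodule.span A (b '' s)) := by
  intro h hh
  obtain ⟨c, hc, rfl⟩ := b.exists_of_mem_span_image hh
  have key : ∀ j ∈ s, ∀ ω : Ω[A⁄k], ω ⊗ₜ[A] b j ∈
      LinearMap.range (LinearMap.lTensor Ω[A⁄k] (Submodule.span A (b '' s)).subtype) :=
    fun j hj ω => ⟨ω ⊗ₜ ⟨b j, Submodule.subset_span ⟨j, hj, rfl⟩⟩, rfl⟩
  rw [connection_sum]
  refine Submodule.add_mem _ (Submodule.sum_mem _ fun i _ => ?_)
    (Submodule.sum_mem _ fun i _ => Submodule.sum_mem _ fun j _ => ?_)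
  · by_cases hi : i ∈ s
    · exact key i hi _
    · rw [hc i hi, map_zero, TensorProduct.zero_tmul]
      exact Submodule.zero_mem _
  · by_cases hi : i ∈ s
    · by_cases hj : j ∈ s
      · exact Submodule.smul_mem _ _ (key j hj _)
      · rw [hE i hi j hj, mul_zero, zero_smul]
        exact Submodule.zero_mem _
    · rw [hc i hi, zero_mul, zero_smul]
      exact Submodule.zero_mem _

end Blocks

namespace OneHoledTorus

section

variable {R : Type*} [CommRing R] [Algebra ℂ R]

theorem E_eq (u v : R) : E u v = u • (E (1 : ℂ) 0).map (algebraMap ℂ R) +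
    v • (E (0 : ℂ) 1).map (algebraMap ℂ R) := by
  ext i j
  simp only [Matrix.add_apply, Matrix.smul_apply, Matrix.map_apply, smul_eq_mul]
  fin_cases i <;> fin_cases j <;> simp [E, Algebra.smul_def, mul_comm, add_comm]

theorem A_eq_E (u v : R) (i j : Fin 2) : A u v i j = E u v (![0, 4] i) (![0, 4] j) := by
  simp only [A, Matrix.add_apply, Matrix.smul_apply, Matrix.map_apply, smul_eq_mul]
  fin_cases i <;> fin_cases j <;> simp [E, A2, Am2, Algebra.smul_def, mul_comm, add_comm]

variable {H : Type*} [AddCommGroup H] [Module R H] (b : Module.Basis (Fin 5) R H)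

omit [Algebra ℂ R] in
theorem isInternal_blocks : DirectSum.IsInternal
    (![Submodule.span R {b 1}, Submodule.span R {b 2}, Submodule.span R {b 3},
      Submodule.span R {b 0, b 4}] : Fin 4 → Submodule R H) := by
  -- The vector assigns to each basis index its block: 0 and 4 share the last one.
  convert b.isInternal_span_image (![3, 0, 1, 2, 3] : Fin 5 → Fin 4) using 2 with j
  have h : ∀ s : Set (Fin 5), (∀ i, ![3, 0, 1, 2, 3] i = j ↔ i ∈ s) →
      Submodule.span R (b '' (![3, 0, 1, 2, 3] ⁻¹' {j})) = Submodule.span R (b '' s) := fun s hs => by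
    congr 2
    ext i
    exact hs i
  fin_cases j
  · rw [h {1} (by decide), Set.image_singleton]; rfl
  · rw [h {2} (by decide), Set.image_singleton]; rfl
  · rw [h {3} (by decide), Set.image_singleton]; rfl
  · rw [h {0, 4} (by decide), Set.image_pair]; rfl

variable [Module ℂ H] [IsScalarTower ℂ R H] (u v y : R)

theorem isHorizontal_singleton (i : Fin 5) (hi : i ≠ 0) (hi' : i ≠ 4) :
    IsHorizontal (connection (k := ℂ) b (E u v) y) (Submodule.span R {b i}) := by
  rw [← Set.image_singleton]
  refine isHorizontal_connection b ?_
  intro l hl j hj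
  rw [Set.mem_singleton_iff] at hl hj
  subst hl
  fin_cases l <;> fin_cases j <;> simp [E] at *

theorem isHorizontal_pair :
    IsHorizontal (connection (k := ℂ) b (E u v) y) (Submodule.span R {b 0, b 4}) := by
  rw [← Set.image_pair]
  refine isHorizontal_connection b ?_
  intro i hi j hj
  fin_cases i <;> fin_cases j <;> simp [E] at *

theorem connection_rank_two (c : Fin 2 → R) :
    connection (k := ℂ) b (E u v) y (∑ i, c i • b (![0, 4] i)) =
      ∑ i, KaehlerDifferential.D ℂ R (c i) ⊗ₜ[R] b (![0, 4] i) +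
      ∑ i, ∑ j, (c i * A u v i j) •
        (KaehlerDifferential.D ℂ R y ⊗ₜ[R] b (![0, 4] j)) := by
  have e : ∑ i, c i • b (![0, 4] i) = ∑ i, (![c 0, 0, 0, 0, c 1] : Fin 5 → R) i • b i := by
    simp [Fin.sum_univ_five]
  rw [e, connection_sum]
  simp only [A_eq_E]
  simp [Fin.sum_univ_five, E]

end

end OneHoledTorus

end

end

theorem mainTheorem5 :
    -- the relative `H²` is free with basis `B`
    ∃ b : Module.Basis (Fin 5) OneHoledTorus.OY OneHoledTorus.H2,
      (∀ i, DeRham.IsClassOf ℂ OneHoledTorus.OY OneHoledTorus.OX (b i) (OneHoledTorus.B i)) ∧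
    -- the Gauss-Manin connection exists and is unique
    ∃ nabla : OneHoledTorus.H2 →ₗ[ℂ]
        Ω[OneHoledTorus.OY⁄ℂ] ⊗[OneHoledTorus.OY] OneHoledTorus.H2,
      DeRham.IsGaussManin ℂ OneHoledTorus.OY OneHoledTorus.OX 2 OneHoledTorus.y nabla ∧
      (∀ nabla', DeRham.IsGaussManin ℂ OneHoledTorus.OY OneHoledTorus.OX 2 OneHoledTorus.y nabla' →
        nabla' = nabla) ∧
    -- in the basis `b` it is `d + E dy`
      (∀ c : Fin 5 → OneHoledTorus.OY,
        nabla (∑ i, c i • b i) =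
          ∑ i, KaehlerDifferential.D ℂ OneHoledTorus.OY (c i) ⊗ₜ[OneHoledTorus.OY] b i +
          ∑ i, ∑ j, (c i * OneHoledTorus.E OneHoledTorus.u OneHoledTorus.v i j) •
            (KaehlerDifferential.D ℂ OneHoledTorus.OY OneHoledTorus.y
              ⊗ₜ[OneHoledTorus.OY] b j)) ∧
    -- the functions `u` and `v` are `1 / (y - 2)` and `1 / (y + 2)`; `E` has simple poles at `±2`
      OneHoledTorus.u * (OneHoledTorus.y - 2) = 1 ∧
      OneHoledTorus.v * (OneHoledTorus.y + 2) = 1 ∧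
      (∃ R2 Rm2 : Matrix (Fin 5) (Fin 5) ℂ, R2 ≠ 0 ∧ Rm2 ≠ 0 ∧
        OneHoledTorus.E OneHoledTorus.u OneHoledTorus.v =
          OneHoledTorus.u • R2.map (algebraMap ℂ OneHoledTorus.OY) +
          OneHoledTorus.v • Rm2.map (algebraMap ℂ OneHoledTorus.OY)) ∧
    -- it is the direct sum of three systems of rank one and one of rank two
      DirectSum.IsInternal
        (![Submodule.span OneHoledTorus.OY {b 1}, Submodule.span OneHoledTorus.OY {b 2},
          Submodule.span OneHoledTorus.OY {b 3}, Submodule.span OneHoledTorus.OY {b 0, b 4}] :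
          Fin 4 → Submodule OneHoledTorus.OY OneHoledTorus.H2) ∧
      DeRham.IsHorizontal nabla (Submodule.span OneHoledTorus.OY {b 1}) ∧
      DeRham.IsHorizontal nabla (Submodule.span OneHoledTorus.OY {b 2}) ∧
      DeRham.IsHorizontal nabla (Submodule.span OneHoledTorus.OY {b 3}) ∧
      DeRham.IsHorizontal nabla (Submodule.span OneHoledTorus.OY {b 0, b 4}) ∧
    -- the system of rank two has the residues `A2` and `Am2`
      (∀ c : Fin 2 → OneHoledTorus.OY,
        nabla (∑ i, c i • b (![0, 4] i)) =
          ∑ i, KaehlerDifferential.D ℂ OneHoledTorus.OY (c i)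
            ⊗ₜ[OneHoledTorus.OY] b (![0, 4] i) +
          ∑ i, ∑ j, (c i * OneHoledTorus.A OneHoledTorus.u OneHoledTorus.v i j) •
            (KaehlerDifferential.D ℂ OneHoledTorus.OY OneHoledTorus.y
              ⊗ₜ[OneHoledTorus.OY] b (![0, 4] j))) ∧
      OneHoledTorus.A2.charpoly.roots = {0, 3 / 2} ∧
      OneHoledTorus.Am2.charpoly.roots = {0, 3 / 2} ∧
      OneHoledTorus.Ainf = !![-1, 0; 6, -2] ∧
      OneHoledTorus.Ainf.charpoly.roots = {-1, -2} ∧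
    -- the monodromy of the system of rank two, in a suitable basis of flat sections near `0`
      ∃ C : GL (Fin 2) ℂ,
        (∀ γ : Path (0 : ℂ) 0, (∀ s, γ s ∈ OneHoledTorus.Y) →
          ∃! N, Monodromy.HasMonodromy OneHoledTorus.Y OneHoledTorus.sys γ C N) ∧
        Monodromy.HasMonodromy OneHoledTorus.Y OneHoledTorus.sys OneHoledTorus.loopm2 C
          OneHoledTorus.Nm2 ∧
        Monodromy.HasMonodromy OneHoledTorus.Y OneHoledTorus.sys OneHoledTorus.loop2 C
          OneHoledTorus.N2 ∧
        Monodromy.HasMonodromy OneHoledTorus.Y OneHoledTorus.sys OneHoledTorus.loopInf C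
          OneHoledTorus.Ninf ∧
        {N | ∃ γ : Path (0 : ℂ) 0,
          Monodromy.HasMonodromy OneHoledTorus.Y OneHoledTorus.sys γ C N} =
          (Subgroup.closure {OneHoledTorus.Nm2, OneHoledTorus.N2, OneHoledTorus.Ninf} :
            Set (GL (Fin 2) ℂ)) := by
  refine ⟨OneHoledTorus.basisH2, OneHoledTorus.isClassOf_B, OneHoledTorus.gaussManin,
    OneHoledTorus.isGaussManin_gaussManin, fun _ => OneHoledTorus.eq_gaussManin,
    connection_sum _ _ _, OneHoledTorus.u_mul, OneHoledTorus.v_mul,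
    ⟨_, _, ?_, ?_, OneHoledTorus.E_eq _ _⟩, OneHoledTorus.isInternal_blocks _,
    OneHoledTorus.isHorizontal_singleton _ _ _ _ 1 (by decide) (by decide),
    OneHoledTorus.isHorizontal_singleton _ _ _ _ 2 (by decide) (by decide),
    OneHoledTorus.isHorizontal_singleton _ _ _ _ 3 (by decide) (by decide),
    OneHoledTorus.isHorizontal_pair _ _ _ _, OneHoledTorus.connection_rank_two _ _ _ _,
    OneHoledTorus.charpoly_roots (by norm_num) (by norm_num),
    OneHoledTorus.charpoly_roots (by norm_num) (by norm_num), OneHoledTorus.Ainf_eq, ?_,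
    OneHoledTorus.initialFlat, fun _ => OneHoledTorus.existsUnique_hasMonodromy,
    OneHoledTorus.hasMonodromy_loopm2, OneHoledTorus.hasMonodromy_loop2,
    OneHoledTorus.hasMonodromy_loopInf, OneHoledTorus.setOf_hasMonodromy⟩
  -- The residues are `E 1 0` and `E 0 1`; in each of them some diagonal entry is 3/2.
  · intro h
    simpa [OneHoledTorus.E] using congrFun (congrFun h 1) 1
  · intro h
    simpa [OneHoledTorus.E] using congrFun (congrFun h 0) 0
  · rw [OneHoledTorus.Ainf_eq]
    exact OneHoledTorus.charpoly_roots (by norm_num) (by norm_num)
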